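/- Fix a finite relational schema $\Sigma$ and countably infinite sets of variables and of constants. A $\mathrm{UCQ}_\neg$ query $Q$ is a finite list of safe rules $S(\bar x) \leftarrow \alpha_1,\dots,\alpha_n$ with a common head, where each $\alpha_i$ is an atom over $\Sigma$, a negated atom over $\Sigma$, an equality $s=t$ or an inequality $s\ne t$ between variables and constants, and safe means that every variable of a rule occurs in an atom or an equality of its body; $Q(\mathbf J)$ denotes its answer on an instance (finite set of facts) $\mathbf J$. Given $\langle Q,\mathbf I,\bar a\rangle$, where $\mathbf I$ is an instance and $\bar a$ is a tuple of constants whose length is the arity of $Q$, a repair is a pair $U=(\mathrm{Ins},\mathrm{Del})$ of finite sets of facts with $\mathrm{Ins}\cap\mathbf I=\emptyset$, $\mathrm{Del}\subseteq\mathbf I$ and $\bar a\in Q((\mathbf I\cup\mathrm{Ins})\setminus\mathrm{Del})$; its size is $|\mathrm{Ins}\cup\mathrm{Del}|$. The problem $\mathrm{MA}_{size}$ asks, given $\langle Q,\mathbf I,\bar a\rangle$, for the minimum size of a repair (or $\infty$ if there is none), and $\mathrm{MA}_{min}$ asks for a repair of minimum size (or an indication that there is none). Inputs are encoded by bit strings,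 with numbers (names of variables, constants and relation symbols) in binary; strings that encode no input are treated as having no repair. An NP metric Turing machine is a nondeterministic polynomial-time Turing machine each of whose branches writes a binary number and accepts or rejects; its output is the smallest number on an accepting branch ($\infty$ if there is none). A function $f$ is in $\mathrm{OptP}[O(\log n)]$ if it is the output function of such a machine and the finite values $f(x)$ have binary length at most $l(|x|)$ for some $l(n)=O(\log n)$. A function problem is in $\mathrm{FP}^{\mathrm{NP}}[O(n^2)]$ if some deterministic polynomial-time Turing machine with an oracle in $\mathrm{NP}$, asking $O(n^2)$ queries on inputs of length $n$, produces a correct output on every input. **Theorem.** For every fixed finite schema $\Sigma$: 1. $\mathrm{MA}_{size}$ for $\mathrm{UCQ}_\neg$ is in $\mathrm{OptP}[O(\log n)]$; 2. $\mathrm{MA}_{min}$ for $\mathrm{UCQ}_\neg$ is in $\mathrm{FP}^{\mathrm{NP}}$, with $O(n^2)$ oracle queries, i.e. in $\mathrm{FP}^{\mathrm{NP}}[O(n^2)]$. -/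

import Mathlib

open Filter Asymptotics

/-! ## Turing machines

Storage is organised as in Mathlib's `Turing.TM2`, on which Mathlib's notion of polynomial-time
computability is built: a finite control together with finitely many stacks. A tape with a head is
a pair of stacks, and a larger finite tape alphabet is a bundle of parallel bit stacks, so that
multi-tape Turing machines are simulated step by step up to a constant factor, and conversely. -/

/-- What one transition does to one stack. -/
inductive StackOp where
  | keep
  | pop
  | push (b : Bool)

def StackOp.apply : StackOp → List Bool → List Bool
  | .keep, l => l
  | .pop, l => l.tail
  | .push b, l => b :: l

/-- A configuration: the state of the finite control and the contents of all stacks. -/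
structure Config (State Stack : Type) where
  state : State
  stk : Stack → List Bool

/-- Carry out a transition: change the state and act on every stack. -/
def Config.act {State Stack : Type} (c : Config State Stack)
    (a : State × (Stack → StackOp)) : Config State Stack :=
  ⟨a.1, fun s => (a.2 s).apply (c.stk s)⟩

/-- The tops of all stacks (`none` for an empty stack), which are what a transition can see. -/
def Config.tops {State Stack : Type} (c : Config State Stack) : Stack → Option Bool :=
  fun s => (c.stk s).head?

/-- The initial configuration: the input on stack `inp` (first symbol on top), all other stacks
empty. -/
def Config.init {State Stack : Type} [DecidableEq Stack] (start : State) (inp : Stack)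
    (x : List Bool) : Config State Stack :=
  ⟨start, fun s => if s = inp then x else []⟩

/-- A nondeterministic Turing machine. In each step it may follow either of the two transition
functions `δ false` and `δ true`. `halt q` is `none` if the machine goes on in state `q`,
`some true` if it halts and accepts, `some false` if it halts and rejects. -/
structure NTM where
  State : Type
  Stack : Type
  [stateFin : Fintype State]
  [stackFin : Fintype Stack]
  [stackDec : DecidableEq Stack]
  start : State
  inp : Stack
  out : Stack
  halt : State → Option Bool
  δ : Bool → State → (Stack → Option Bool) → State × (Stack → StackOp)

attribute [instance] NTM.stateFin NTM.stackFin NTM.stackDec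

namespace NTM

/-- One step with nondeterministic choice `b`; halting configurations do not change. -/
def step (M : NTM) (c : Config M.State M.Stack) (b : Bool) : Config M.State M.Stack :=
  match M.halt c.state with
  | some _ => c
  | none => c.act (M.δ b c.state c.tops)

/-- The configuration reached on input `x` along the nondeterministic choices `ch`. -/
def run (M : NTM) (x ch : List Bool) : Config M.State M.Stack :=
  ch.foldl M.step (Config.init M.start M.inp x)

/-- On inputs of length `n`, every branch halts within `p n` steps, for some polynomial `p`. -/
def PolyTime (M : NTM) : Prop :=
  ∃ p : Polynomial ℕ, ∀ x ch : List Bool, ch.length = p.eval x.length →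
    (M.halt (M.run x ch).state).isSome

/-- The branch with choices `ch` (has halted and) accepts. -/
def AcceptsAlong (M : NTM) (x ch : List Bool) : Prop :=
  M.halt (M.run x ch).state = some true

end NTM

/-- The number written in binary as the given string, least significant bit first. -/
def binVal (l : List Bool) : ℕ := l.foldr Nat.bit 0

/-- The class NP. -/
def InNP (L : Set (List Bool)) : Prop :=
  ∃ M : NTM, M.PolyTime ∧ ∀ x, x ∈ L ↔ ∃ ch, M.AcceptsAlong x ch

/-- The output of an NP metric Turing machine: the smallest binary number on the output stack at
the end of an accepting branch; `⊤` if no branch accepts. -/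
noncomputable def NTM.opt (M : NTM) (x : List Bool) : ℕ∞ :=
  sInf {v : ℕ∞ | ∃ ch, M.AcceptsAlong x ch ∧ v = (binVal ((M.run x ch).stk M.out) : ℕ)}

/-- The class OptP; the value `⊤` stands for "no solution". -/
def InOptP (f : List Bool → ℕ∞) : Prop :=
  ∃ M : NTM, M.PolyTime ∧ ∀ x, f x = M.opt x

/-- The class OptP[l(n)]: in addition, the binary encoding of the value `f x` has length at most
`l |x|`. -/
def InOptPBounded (l : ℕ → ℕ) (f : List Bool → ℕ∞) : Prop :=
  InOptP f ∧ ∀ (x : List Bool) (v : ℕ), f x = v → v.size ≤ l x.length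

/-- A deterministic oracle Turing machine. If `query q = some (y, n)`, then in state `q` the machine
asks its oracle about the string on stack `qry`. -/
structure OracleTM where
  State : Type
  Stack : Type
  [stateFin : Fintype State]
  [stackFin : Fintype Stack]
  [stackDec : DecidableEq Stack]
  start : State
  inp : Stack
  out : Stack
  qry : Stack
  halt : State → Bool
  query : State → Option (State × State)
  δ : State → (Stack → Option Bool) → State × (Stack → StackOp)

attribute [instance] OracleTM.stateFin OracleTM.stackFin OracleTM.stackDec

namespace OracleTM

open Classical in
/-- One step with oracle `L`, on a configuration paired with the number of oracle queries asked so
far. An oracle query takes one step, erases the query stack, and leads to state `y` if the answer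
is yes and to state `n` if it is no. -/
noncomputable def step (M : OracleTM) (L : Set (List Bool))
    (c : Config M.State M.Stack × ℕ) : Config M.State M.Stack × ℕ :=
  if M.halt c.1.state then c
  else
    match M.query c.1.state with
    | some (y, n) =>
        (⟨if c.1.stk M.qry ∈ L then y else n, Function.update c.1.stk M.qry []⟩, c.2 + 1)
    | none => (c.1.act (M.δ c.1.state c.1.tops), c.2)

/-- The configuration and the number of queries after `t` steps on input `x`. -/
noncomputable def run (M : OracleTM) (L : Set (List Bool)) (x : List Bool) (t : ℕ) :
    Config M.State M.Stack × ℕ :=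
  (M.step L)^[t] (Config.init M.start M.inp x, 0)

end OracleTM

/-- The class FP^NP[l(n)] of function problems. A function problem is given by the relation `R x y`:
"`y` is a correct output for the input `x`". Some polynomial-time oracle machine with an oracle in
NP produces a correct output for every input and asks `O(l(n))` queries on inputs of
length `n`. -/
def InFPNPQueries (l : ℕ → ℕ) (R : List Bool → List Bool → Prop) : Prop :=
  ∃ (L : Set (List Bool)) (M : OracleTM) (p : Polynomial ℕ) (q : ℕ → ℕ),
    InNP L ∧
    ((fun n => (q n : ℝ)) =O[atTop] fun n => (l n : ℝ)) ∧
    ∀ x : List Bool,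
      M.halt (M.run L x (p.eval x.length)).1.state = true ∧
      R x ((M.run L x (p.eval x.length)).1.stk M.out) ∧
      (M.run L x (p.eval x.length)).2 ≤ q x.length

/-! ## Databases and queries

Variables and constants are natural numbers. -/

/-- A finite schema of extensional database predicates. -/
structure Schema where
  numRel : ℕ
  arity : Fin numRel → ℕ

inductive Term where
  | var (x : ℕ)
  | const (a : ℕ)

def Term.eval (g : ℕ → ℕ) : Term → ℕ
  | .var x => g x
  | .const a => a

def Term.vars : Term → Set ℕ
  | .var x => {x}
  | .const _ => ∅

/-- A fact `R(a₁, …, a_k)`. An instance is a finite set of facts. -/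
abbrev DBFact (σ : Schema) : Type := Σ R : Fin σ.numRel, (Fin (σ.arity R) → ℕ)

/-- `rel true R t` is `R(t)` and `rel false R t` is `¬ R(t)`;
`eq true s t` is `s = t` and `eq false s t` is `s ≠ t`. -/
inductive Literal (σ : Schema) where
  | rel (positive : Bool) (R : Fin σ.numRel) (args : Fin (σ.arity R) → Term)
  | eq (positive : Bool) (s t : Term)

namespace Literal

variable {σ : Schema}

def Positive : Literal σ → Prop
  | rel b _ _ => b = true
  | eq b _ _ => b = true

def vars : Literal σ → Set ℕ
  | rel _ _ args => ⋃ i, (args i).vars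
  | eq _ s t => s.vars ∪ t.vars

/-- The literal is true in the instance `J` under the assignment `g`. -/
def Holds (J : Finset (DBFact σ)) (g : ℕ → ℕ) : Literal σ → Prop
  | rel true R args => (⟨R, fun i => (args i).eval g⟩ : DBFact σ) ∈ J
  | rel false R args => (⟨R, fun i => (args i).eval g⟩ : DBFact σ) ∉ J
  | eq true s t => s.eval g = t.eval g
  | eq false s t => s.eval g ≠ t.eval g

end Literal

/-- A union of conjunctive queries with negated atoms and inequalities: rules with the common head
`S(head)`, given by their bodies. Rules are safe: every variable of a rule occurs in a positive
literal of its body. (The name `S` of the answer predicate plays no role.) -/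
structure UCQNeg (σ : Schema) where
  head : List ℕ
  bodies : List (List (Literal σ))
  safe : ∀ body ∈ bodies, ∀ x : ℕ, (x ∈ head ∨ ∃ α ∈ body, x ∈ α.vars) →
    ∃ α ∈ body, α.Positive ∧ x ∈ α.vars

/-- The answer `Q(J)`. -/
def UCQNeg.answer {σ : Schema} (Q : UCQNeg σ) (J : Finset (DBFact σ)) : Set (List ℕ) :=
  {a | ∃ body ∈ Q.bodies, ∃ g : ℕ → ℕ, (∀ α ∈ body, α.Holds J g) ∧ Q.head.map g = a}

/-- An input `⟨Q, I, a⟩` of the missing answer problems; the instance is presented as a list of its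
facts, in any order. -/
structure MAInput (σ : Schema) where
  query : UCQNeg σ
  facts : List (DBFact σ)
  tuple : List ℕ
  length_eq : tuple.length = query.head.length

def MAInput.inst {σ : Schema} (x : MAInput σ) : Finset (DBFact σ) := x.facts.toFinset

/-- An update for the instance `I`: facts to be inserted and facts to be deleted. -/
structure Update {σ : Schema} (I : Finset (DBFact σ)) where
  ins : Finset (DBFact σ)
  del : Finset (DBFact σ)
  ins_new : ∀ f ∈ ins, f ∉ I
  del_old : del ⊆ I

namespace Update

variable {σ : Schema} {I : Finset (DBFact σ)}

/-- The updated instance. -/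
def result (U : Update I) : Finset (DBFact σ) := (I ∪ U.ins) \ U.del

def size (U : Update I) : ℕ := (U.ins ∪ U.del).card

end Update

/-- `U` is a repair with respect to the input `⟨Q, I, a⟩`. -/
def MAInput.IsRepair {σ : Schema} (x : MAInput σ) (U : Update x.inst) : Prop :=
  x.tuple ∈ x.query.answer U.result

/-- `U` is a repair of minimum size. -/
def MAInput.IsMinRepair {σ : Schema} (x : MAInput σ) (U : Update x.inst) : Prop :=
  x.IsRepair U ∧ ∀ V : Update x.inst, x.IsRepair V → U.size ≤ V.size

/-- The minimum size of a repair; `⊤` if there is no repair. -/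
noncomputable def MAInput.minSize {σ : Schema} (x : MAInput σ) : ℕ∞ :=
  sInf {k : ℕ∞ | ∃ U : Update x.inst, x.IsRepair U ∧ k = U.size}

/-! ## Encoding by bit strings

All encodings are prefix-free, and numbers are written in binary. -/

/-- Each binary digit is preceded by `1`; the end is marked by `0`. -/
def encNat (n : ℕ) : List Bool := (n.bits.flatMap fun b => [true, b]) ++ [false]

/-- Each entry is preceded by `1`; the end is marked by `0`. -/
def encList {α : Type} (e : α → List Bool) (l : List α) : List Bool :=
  (l.flatMap fun a => true :: e a) ++ [false]

/-- A tuple whose length is already known. -/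
def encTuple {α : Type} (e : α → List Bool) {k : ℕ} (t : Fin k → α) : List Bool :=
  (List.ofFn t).flatMap e

def encTerm : Term → List Bool
  | .var x => false :: encNat x
  | .const a => true :: encNat a

def encFact {σ : Schema} (f : DBFact σ) : List Bool := encNat f.1 ++ encTuple encNat f.2

def encLiteral {σ : Schema} : Literal σ → List Bool
  | .rel b R args => false :: b :: (encNat R ++ encTuple encTerm args)
  | .eq b s t => true :: b :: (encTerm s ++ encTerm t)

def MAInput.encode {σ : Schema} (x : MAInput σ) : List Bool :=
  encList encNat x.query.head ++ encList (encList encLiteral) x.query.bodies ++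
    encList encFact x.facts ++ encList encNat x.tuple

/-- The string `y` encodes the update `U`: it lists the insertions, then the deletions. -/
def Update.EncodedBy {σ : Schema} {I : Finset (DBFact σ)} (U : Update I) (y : List Bool) : Prop :=
  ∃ insL delL : List (DBFact σ), insL.toFinset = U.ins ∧ delL.toFinset = U.del ∧
    y = true :: (encList encFact insL ++ encList encFact delL)

/-- `MA_size` as a function on bit strings: the minimum size of a repair with respect to the encoded
input, and `⊤` if there is no repair or the string encodes no input. -/
noncomputable def maSize (σ : Schema) (w : List Bool) : ℕ∞ :=
  sInf {k : ℕ∞ | ∃ x : MAInput σ, x.encode = w ∧ k = x.minSize}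

/-- `MA_min` as a function problem on bit strings: `y` is a correct output for `w` if `y` encodes a
minimum repair with respect to the input encoded by `w`, or if there is none (because there is no
repair, or `w` encodes no input) and `y` is the string `0`, which indicates this. -/
def MAMin (σ : Schema) (w y : List Bool) : Prop :=
  (∃ x : MAInput σ, x.encode = w ∧ ∃ U : Update x.inst, x.IsMinRepair U ∧ U.EncodedBy y) ∨
  ((¬ ∃ x : MAInput σ, x.encode = w ∧ ∃ U : Update x.inst, x.IsRepair U) ∧ y = [false])

/-! The encoding of inputs is injective. -/

def PrefixFree {α : Type} (e : α → List Bool) : Prop :=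
  ∀ x y s t, e x ++ s = e y ++ t → x = y ∧ s = t

theorem prefixFree_encList {α : Type} {e : α → List Bool} (he : PrefixFree e) :
    PrefixFree (encList e) := by
  intro l
  induction l with
  | nil =>
    intro l' s t h
    cases l' with
    | nil => simpa [encList] using h
    | cons b l' => simp [encList] at h
  | cons a l ih =>
    intro l' s t h
    cases l' with
    | nil => simp [encList] at h
    | cons b l' =>
      simp only [encList, List.flatMap_cons, List.cons_append, List.append_assoc,
        List.cons.injEq, true_and] at h
      obtain ⟨e1, k1⟩ := he _ _ _ _ h; subst e1; replace h := k1
      obtain ⟨e2, k2⟩ := ih l' s t (by simpa [encList] using h); subst e2; replace h := k2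
      exact ⟨rfl, h⟩

theorem prefixFree_encNat : PrefixFree encNat := by
  intro m n s t h
  have hb : PrefixFree (fun b : Bool => [b]) := by
    intro x y s t h
    simpa using h
  obtain ⟨h1, h2⟩ := prefixFree_encList hb m.bits n.bits s t h
  refine ⟨?_, h2⟩
  have key : ∀ k : ℕ, k.bits.foldr Nat.bit 0 = k := by
    intro k
    induction k using Nat.binaryRec' with
    | zero => simp
    | bit b k hk ih => rw [Nat.bits_append_bit k b hk, List.foldr_cons, ih]
  rw [← key m, ← key n, h1]

theorem prefixFree_encTuple {α : Type} {e : α → List Bool} (he : PrefixFree e) (k : ℕ) :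
    PrefixFree (encTuple e (k := k)) := by
  have key : ∀ l l' : List α, l.length = l'.length → ∀ s t : List Bool,
      l.flatMap e ++ s = l'.flatMap e ++ t → l = l' ∧ s = t := by
    intro l
    induction l with
    | nil =>
      intro l' hl s t h
      cases l' with
      | nil => simpa using h
      | cons b l' => simp at hl
    | cons a l ih =>
      intro l' hl s t h
      cases l' with
      | nil => simp at hl
      | cons b l' =>
        simp only [List.flatMap_cons, List.append_assoc] at h
        obtain ⟨e3, k3⟩ := he _ _ _ _ h; subst e3; replace h := k3
        obtain ⟨e4, k4⟩ := ih l' (by simpa using hl) s t h; subst e4; replace h := k4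
        exact ⟨rfl, h⟩
  intro x y s t h
  obtain ⟨h1, h2⟩ := key _ _ (by simp) s t h
  exact ⟨List.ofFn_injective h1, h2⟩

theorem prefixFree_encTerm : PrefixFree encTerm := by
  intro x y s t h
  cases x <;> cases y <;> simp [encTerm] at h <;>
    (obtain ⟨e0, k0⟩ := prefixFree_encNat _ _ _ _ h; subst e0; replace h := k0; exact ⟨rfl, h⟩)

theorem prefixFree_encFact {σ : Schema} : PrefixFree (encFact (σ := σ)) := by
  rintro ⟨R, a⟩ ⟨R', a'⟩ s t h
  simp only [encFact, List.append_assoc] at h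
  obtain ⟨h1, h⟩ := prefixFree_encNat _ _ _ _ h
  obtain rfl := Fin.ext h1
  obtain ⟨e5, k5⟩ := prefixFree_encTuple prefixFree_encNat _ _ _ _ _ h; subst e5; replace h := k5
  exact ⟨rfl, h⟩

theorem prefixFree_encLiteral {σ : Schema} : PrefixFree (encLiteral (σ := σ)) := by
  rintro (⟨b, R, a⟩ | ⟨b, u, v⟩) (⟨b', R', a'⟩ | ⟨b', u', v'⟩) s t h
  · simp only [encLiteral, List.cons_append, List.append_assoc, List.cons.injEq, true_and] at h
    obtain ⟨e6, k6⟩ := h; subst e6; replace h := k6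
    obtain ⟨h1, h⟩ := prefixFree_encNat _ _ _ _ h
    obtain rfl := Fin.ext h1
    obtain ⟨e7, k7⟩ := prefixFree_encTuple prefixFree_encTerm _ _ _ _ _ h; subst e7; replace h := k7
    exact ⟨rfl, h⟩
  · simp [encLiteral] at h
  · simp [encLiteral] at h
  · simp only [encLiteral, List.cons_append, List.append_assoc, List.cons.injEq, true_and] at h
    obtain ⟨e8, k8⟩ := h; subst e8; replace h := k8
    obtain ⟨e9, k9⟩ := prefixFree_encTerm _ _ _ _ h; subst e9; replace h := k9
    obtain ⟨e10, k10⟩ := prefixFree_encTerm _ _ _ _ h; subst e10; replace h := k10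
    exact ⟨rfl, h⟩

theorem MAInput.encode_injective {σ : Schema} :
    Function.Injective (MAInput.encode (σ := σ)) := by
  rintro ⟨⟨hd, bs, hs⟩, fs, a, hl⟩ ⟨⟨hd', bs', hs'⟩, fs', a', hl'⟩ h
  simp only [MAInput.encode, List.append_assoc] at h
  obtain ⟨e11, k11⟩ := prefixFree_encList prefixFree_encNat _ _ _ _ h; subst e11; replace h := k11
  obtain ⟨e12, k12⟩ := prefixFree_encList (prefixFree_encList prefixFree_encLiteral) _ _ _ _ h; subst e12; replace h := k12
  obtain ⟨e13, k13⟩ := prefixFree_encList prefixFree_encFact _ _ _ _ h; subst e13; replace h := k13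
  obtain ⟨rfl, -⟩ := prefixFree_encList prefixFree_encNat a a' [] [] (by simpa using h)
  rfl

/-!
Both parts rest on one nondeterministic program. On input `w` it guesses a `certificate`: a number
`k` in unary, followed by the code of a list `A` of facts to be inserted and a list `B` of facts to
be deleted, with `k` facts altogether. It then guesses an assignment, checks that `w` encodes an
input, guesses one of its rules, and checks that the assignment satisfies the rule once `A` has been
inserted and `B` deleted (`Accepted`).

*Short certificates suffice.* If a repair makes the body of a rule true under an assignment `g`,
then it has to insert at most the positive atoms of the body and to delete at most the negated ones,
so the size of a minimum repair is bounded by the length of the rule. Its constants may be huge, but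
rules mention only the constants of the input: a permutation `π` of the natural numbers that fixes
those maps the other values of `g` to numbers below twice the length of the input
(`exists_perm_small`), and by `Literal.renamed_update` the atoms under `π ∘ g` still describe a
repair that is no larger. So there is a certificate of at most quadratic length for a repair that is
no larger than the given one (`MAInput.IsRepair.exists_certificate`), and conversely every accepted
certificate describes a repair of size at most `k` (`Accepted.exists_repair`). Hence the minimum
size of a repair is the least `k` with an accepted certificate; it is at most quadratic in the
length of the input and so has a binary code of logarithmic length.

*Finding a repair.* The code begins with `k` in unary, so the lexicographically least certificate
has the least `k`, and what follows `k` encodes a minimum repair (`Accepted.exists_minRepair`). It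
is found by prefix search: extend the current prefix by `0` if the oracle says that the result is a
prefix of a certificate, otherwise by `1` if it says so of that, and stop if neither is the case.
These are at most two queries for each of the `O(n ^ 2)` bits (`PrefixSearch.inFPNPQueries`). The
oracle set consists of the pairs of a string and a prefix of one of its certificates, which is in NP
by the same program, started with a prefix to continue.

*Machines.* Programs (`Prog`) act on finitely many stacks by elementary operations, composition,
nondeterministic choice and loops of at most `N` rounds each, for a parameter `N`; their meaning is
a relation between stores (`Prog.Rel`). A program is compiled into a machine that keeps the program
that remains to be run in its finite control and counts the rounds of its loops on additional
stacks; with `N` the length of the input plus two this takes polynomial time (`Ctrl.exists_ntm`,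
`Ctrl.exists_ntm_pair`). Parsers for the encodings are composed from parsers for numbers (`Parses`),
and `Prog.exists_rel_solve` identifies what the whole program accepts.
-/

/-! ### Regular programs over stacks -/

/-- `m`-fold composition of a relation. -/
def Iter {α : Type} (R : α → α → Prop) : ℕ → α → α → Prop
  | 0, s, t => s = t
  | m + 1, s, t => ∃ u, R s u ∧ Iter R m u t

/-- The contents of all stacks. -/
abbrev Store (K : Type) := K → List Bool

/-- Push the bit `b` on every stack of the list `bs`. -/
def Store.emit {K : Type} [DecidableEq K] (s : Store K) (bs : List K) (b : Bool) : Store K :=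
  fun k => if k ∈ bs then b :: s k else s k

/-- Drop the top of stack `a` and push the bit `b` on every other stack of the list `bs`. -/
def Store.shift {K : Type} [DecidableEq K] (s : Store K) (a : K) (bs : List K) (b : Bool) :
    Store K :=
  fun k => if k = a then (s a).tail else if k ∈ bs then b :: s k else s k

/-- Nondeterministic regular programs over stacks. `fail` aborts; `empty a` aborts unless stack `a`
is empty; `emit b bs` pushes `b` on the stacks `bs`; `shift a b bs` aborts unless the top of `a` is
`b`, and otherwise moves it to the stacks `bs`; the rest are composition, choice and iteration. -/
inductive Prog (K : Type) where
  | fail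
  | empty (a : K)
  | emit (b : Bool) (bs : List K)
  | shift (a : K) (b : Bool) (bs : List K)
  | seq (c d : Prog K)
  | alt (c d : Prog K)
  | star (c : Prog K)

namespace Prog

variable {K : Type}

/-- The input-output relation of a program, where every loop may be iterated at most `N` times. -/
def Rel [DecidableEq K] (N : ℕ) : Prog K → Store K → Store K → Prop
  | fail, _, _ => False
  | empty a, s, s' => s a = [] ∧ s' = s
  | emit b bs, s, s' => s' = s.emit bs b
  | shift a b bs, s, s' => (s a).head? = some b ∧ s' = s.shift a bs b
  | seq c d, s, s' => ∃ t, c.Rel N s t ∧ d.Rel N t s'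
  | alt c d, s, s' => c.Rel N s s' ∨ d.Rel N s s'
  | star c, s, s' => ∃ m ≤ N, Iter (c.Rel N) m s s'

/-- The nesting depth of loops. -/
def depth : Prog K → ℕ
  | seq c d => max c.depth d.depth
  | alt c d => max c.depth d.depth
  | star c => c.depth + 1
  | _ => 0

/-- A bound on the number of machine steps, as a polynomial in the number of iterations that each
loop may make. -/
noncomputable def time : Prog K → Polynomial ℕ
  | seq c d => c.time + d.time + 1
  | alt c d => c.time + d.time + 1
  | star c => .X * (c.time + 1) + 1 + (.X + 1)
  | _ => 1

theorem eval_time_mono (c : Prog K) {m n : ℕ} (h : m ≤ n) : c.time.eval m ≤ c.time.eval n := by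
  induction c with
  | seq c d hc hd => simp only [time, Polynomial.eval_add, Polynomial.eval_one]; omega
  | alt c d hc hd => simp only [time, Polynomial.eval_add, Polynomial.eval_one]; omega
  | star c hc =>
    simp only [time, Polynomial.eval_add, Polynomial.eval_mul, Polynomial.eval_X,
      Polynomial.eval_one]
    gcongr
  | _ => simp [time]

end Prog

/-! ### Compilation of regular programs -/

/-- An item of a continuation: a program still to be run, or the task of refilling the clock of the
loops of height `h`. -/
inductive Frame (K : Type) where
  | run (c : Prog K)
  | refill (h : ℕ)

/-- The control states of the machine that executes a program. The program is run by the states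
`exec κ`, where `κ` lists what remains to be done. Before that, the states `head` and `bit` read a
string coded in pairs from the input onto a stack, up to the pair that starts with `0`, and the
states `load` and `back` go over the rest of the input once to fill the clocks. -/
inductive Ctrl (K : Type) where
  | head
  | bit
  | load
  | back
  | exec (κ : List (Frame K))
  | reject

/-- The stacks of the machine that executes a program: those of the program, and two clock stacks
for each nesting depth of loops, holding the remaining and the used ticks. -/
abbrev MStack (K : Type) (D : ℕ) := K ⊕ (Fin D × Bool)

namespace Ctrl

variable {K : Type}

/-- The state `exec []` accepts. -/
def halt : Ctrl K → Option Bool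
  | exec [] => some true
  | reject => some false
  | _ => none

variable [DecidableEq K] {D : ℕ} [NeZero D]

/-- The index of the clock for loops of height `h`, for `h < D`. -/
def clockIdx (D : ℕ) [NeZero D] (h : ℕ) : Fin D := Fin.ofNat D h

/-- The clock stack for loops of height `h`. -/
abbrev clk (K : Type) (D : ℕ) [NeZero D] (h : ℕ) (used : Bool) : MStack K D :=
  .inr (clockIdx D h, used)

/-- The transition function; `inp` is the input stack, `pre` the stack for the string coded in
pairs, `tmp` an auxiliary stack, and `main` the program to be executed. -/
def delta (inp pre tmp : K) (main : Prog K) (b : Bool) :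
    Ctrl K → (MStack K D → Option Bool) → Ctrl K × (MStack K D → StackOp)
  | head, t =>
    match t (.inl inp) with
    | some true => (bit, fun k => if k = .inl inp then .pop else .keep)
    | some false => (load, fun k => if k = .inl inp then .pop else .keep)
    | none => (reject, fun _ => .keep)
  | bit, t =>
    match t (.inl inp) with
    | some x => (head, fun k =>
        if k = .inl inp then .pop else if k = .inl pre then .push x else .keep)
    | none => (reject, fun _ => .keep)
  | load, t =>
    match t (.inl inp) with
    | some x => (load, fun k =>
        if k = .inl inp then .pop else if k = .inl tmp then .push x else .keep)
    | none => (back, Sum.elim (fun _ => .keep) fun e => if e.2 then .keep else .push true)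
  | back, t =>
    match t (.inl tmp) with
    | some x => (back, Sum.elim
        (fun k => if k = tmp then .pop else if k = inp then .push x else .keep)
        fun e => if e.2 then .keep else .push true)
    | none =>
      (exec [.run main], Sum.elim (fun _ => .keep) fun e => if e.2 then .keep else .push true)
  | exec [], _ => (exec [], fun _ => .keep)
  | exec (.run .fail :: _), _ => (reject, fun _ => .keep)
  | exec (.run (.empty a) :: κ), t =>
    (if t (.inl a) = none then exec κ else reject, fun _ => .keep)
  | exec (.run (.emit x bs) :: κ), _ =>
    (exec κ, Sum.elim (fun k => if k ∈ bs then .push x else .keep) fun _ => .keep)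
  | exec (.run (.shift a x bs) :: κ), t =>
    (if t (.inl a) = some x then exec κ else reject,
      Sum.elim (fun k => if k = a then .pop else if k ∈ bs then .push x else .keep)
        fun _ => .keep)
  | exec (.run (.seq c d) :: κ), _ => (exec (.run c :: .run d :: κ), fun _ => .keep)
  | exec (.run (.alt c d) :: κ), _ => (exec (.run (if b then c else d) :: κ), fun _ => .keep)
  | exec (.run (.star c) :: κ), t =>
    if b = true ∧ t (clk K D c.depth false) = some true then
      (exec (.run c :: .run (.star c) :: κ), fun k =>
        if k = clk K D c.depth false then .pop
        else if k = clk K D c.depth true then .push true else .keep)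
    else (exec (.refill c.depth :: κ), fun _ => .keep)
  | exec (.refill h :: κ), t =>
    if t (clk K D h true) = some true then
      (exec (.refill h :: κ), fun k =>
        if k = clk K D h true then .pop
        else if k = clk K D h false then .push true else .keep)
    else (exec κ, fun _ => .keep)
  | reject, _ => (reject, fun _ => .keep)

end Ctrl

/-! ### Execution of compiled programs -/

namespace Ctrl

variable {K : Type} [DecidableEq K] {D : ℕ} [NeZero D]

/-- The configurations of a machine that executes a program. -/
abbrev MConfig (K : Type) (D : ℕ) := Config (Ctrl K) (MStack K D)

/-- One step of the machine, whose set of control states is not yet cut down to a finite one. -/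
def step (inp pre tmp : K) (main : Prog K) (c : MConfig K D) (b : Bool) : MConfig K D :=
  match c.state.halt with
  | some _ => c
  | none => c.act (delta inp pre tmp main b c.state c.tops)

/-- Within `T` steps every branch from `c` reaches a configuration that satisfies `Φ`. -/
def Ends (inp pre tmp : K) (main : Prog K) (T : ℕ) (c : MConfig K D) (Φ : MConfig K D → Prop) :
    Prop :=
  ∀ ch : List Bool, T ≤ ch.length → ∃ m ≤ T, Φ ((ch.take m).foldl (step inp pre tmp main) c)

/-- Some branch from `c` reaches `c'`. -/
def Reach (inp pre tmp : K) (main : Prog K) (c c' : MConfig K D) : Prop :=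
  ∃ ch : List Bool, ch.foldl (step inp pre tmp main) c = c'

variable {inp pre tmp : K} {main : Prog K} {c c' c'' : MConfig K D}
  {Φ Ψ : MConfig K D → Prop} {T T' : ℕ}

theorem Ends.of_now (h : Φ c) : Ends inp pre tmp main T c Φ :=
  fun _ _ => ⟨0, Nat.zero_le _, by simpa using h⟩

theorem Ends.cons (h : ∀ b, Ends inp pre tmp main T (step inp pre tmp main c b) Φ) :
    Ends inp pre tmp main (T + 1) c Φ := by
  rintro (_ | ⟨b, ch⟩) hl
  · simp at hl
  · obtain ⟨m, hm, h⟩ := h b ch (by simpa using hl)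
    exact ⟨m + 1, by omega, by simpa using h⟩

theorem Ends.bind (h : Ends inp pre tmp main T c Φ)
    (h' : ∀ c', Φ c' → Ends inp pre tmp main T' c' Ψ) :
    Ends inp pre tmp main (T + T') c Ψ := by
  intro ch hl
  obtain ⟨m, hm, h⟩ := h ch (by omega)
  obtain ⟨m', hm', h'⟩ := h' _ h (ch.drop m) (by simp; omega)
  refine ⟨m + m', by omega, ?_⟩
  rwa [List.take_add, List.foldl_append]

theorem Ends.mono (h : Ends inp pre tmp main T c Φ) (hT : T ≤ T') (hΦ : ∀ c', Φ c' → Ψ c') :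
    Ends inp pre tmp main T' c Ψ := by
  intro ch hl
  obtain ⟨m, hm, h⟩ := h ch (by omega)
  exact ⟨m, by omega, hΦ _ h⟩

theorem Reach.refl (c : MConfig K D) : Reach inp pre tmp main c c := ⟨[], rfl⟩

theorem Reach.trans (h : Reach inp pre tmp main c c') (h' : Reach inp pre tmp main c' c'') :
    Reach inp pre tmp main c c'' := by
  obtain ⟨ch, rfl⟩ := h
  obtain ⟨ch', rfl⟩ := h'
  exact ⟨ch ++ ch', by rw [List.foldl_append]⟩

theorem Reach.cons (b : Bool) (h : Reach inp pre tmp main (step inp pre tmp main c b) c') :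
    Reach inp pre tmp main c c' := by
  obtain ⟨ch, rfl⟩ := h
  exact ⟨b :: ch, rfl⟩

/-- A deterministic computation is followed by all branches. -/
theorem Ends.reach (h : Ends inp pre tmp main T c (· = c')) : Reach inp pre tmp main c c' := by
  obtain ⟨m, -, h⟩ := h (List.replicate T true) (by simp)
  exact ⟨_, h⟩

/-! The effect of single steps. -/

/-- The configuration with continuation `κ`, program stacks `s` and clock stacks `τ`. -/
def conf (κ : List (Frame K)) (s : Store K) (τ : Fin D × Bool → List Bool) : MConfig K D :=
  ⟨.exec κ, Sum.elim s τ⟩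

variable {κ : List (Frame K)} {s s' : Store K} {τ : Fin D × Bool → List Bool}

theorem step_empty (a : K) (b : Bool) (h : s a = []) :
    step inp pre tmp main (conf (.run (.empty a) :: κ) s τ) b = conf κ s τ := by
  simp [step, conf, halt, delta, Config.act, Config.tops, h, StackOp.apply]

theorem step_empty_ne (a : K) (b : Bool) (h : s a ≠ []) :
    (step inp pre tmp main (conf (.run (.empty a) :: κ) s τ) b).state = .reject := by
  simp [step, conf, halt, delta, Config.act, Config.tops, h]

theorem step_emit (x : Bool) (bs : List K) (b : Bool) :
    step inp pre tmp main (conf (.run (.emit x bs) :: κ) s τ) b = conf κ (s.emit bs x) τ := by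
  simp only [step, conf, halt, delta, Config.act, Config.mk.injEq, true_and]
  funext k
  rcases k with k | e
  · by_cases hk : k ∈ bs <;> simp [hk, Store.emit, StackOp.apply]
  · simp [StackOp.apply]

theorem step_shift (a : K) (x : Bool) (bs : List K) (b : Bool) (h : (s a).head? = some x) :
    step inp pre tmp main (conf (.run (.shift a x bs) :: κ) s τ) b =
      conf κ (s.shift a bs x) τ := by
  simp only [step, conf, halt, delta, Config.act, Config.tops, Sum.elim_inl, h, if_true,
    Config.mk.injEq, true_and]
  funext k
  rcases k with k | e
  · by_cases ha : k = a
    · simp [ha, Store.shift, StackOp.apply]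
    · by_cases hk : k ∈ bs <;> simp [ha, hk, Store.shift, StackOp.apply]
  · simp [StackOp.apply]

theorem step_shift_ne (a : K) (x : Bool) (bs : List K) (b : Bool) (h : (s a).head? ≠ some x) :
    (step inp pre tmp main (conf (.run (.shift a x bs) :: κ) s τ) b).state = .reject := by
  simp [step, conf, halt, delta, Config.act, Config.tops, h]

theorem step_seq (c d : Prog K) (b : Bool) :
    step inp pre tmp main (conf (.run (.seq c d) :: κ) s τ) b =
      conf (.run c :: .run d :: κ) s τ := rfl

theorem step_alt (c d : Prog K) (b : Bool) :
    step inp pre tmp main (conf (.run (.alt c d) :: κ) s τ) b =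
      conf (.run (if b then c else d) :: κ) s τ := rfl

/-- The clock stacks `τ` with the clock for height `h` showing `i` remaining and `j` used ticks. -/
def setClk (τ : Fin D × Bool → List Bool) (h i j : ℕ) : Fin D × Bool → List Bool :=
  fun e => if e.1 = clockIdx D h then List.replicate (if e.2 then j else i) true else τ e

theorem step_star_go (c : Prog K) (i j : ℕ) :
    step inp pre tmp main (conf (.run (.star c) :: κ) s (setClk τ c.depth (i + 1) j)) true =
      conf (.run c :: .run (.star c) :: κ) s (setClk τ c.depth i (j + 1)) := by
  have : Config.tops (conf (.run (.star c) :: κ) s (setClk τ c.depth (i + 1) j))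
      (clk K D c.depth false) = some true := by
    simp [Config.tops, conf, setClk, clk, List.replicate_succ]
  simp only [step, conf, halt, delta, Config.act] at this ⊢
  rw [if_pos ⟨trivial, this⟩]
  simp only [Config.mk.injEq, true_and]
  funext k
  rcases k with k | ⟨e, b⟩
  · simp [StackOp.apply]
  · by_cases he : e = clockIdx D c.depth
    · cases b <;> simp [he, setClk, StackOp.apply, List.replicate_succ]
    · simp [he, setClk, StackOp.apply]

theorem step_star_stop (c : Prog K) (b : Bool) (i j : ℕ) (h : b = false ∨ i = 0) :
    step inp pre tmp main (conf (.run (.star c) :: κ) s (setClk τ c.depth i j)) b =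
      conf (.refill c.depth :: κ) s (setClk τ c.depth i j) := by
  have : ¬ (b = true ∧ Config.tops (conf (.run (.star c) :: κ) s (setClk τ c.depth i j))
      (clk K D c.depth false) = some true) := by
    rcases h with rfl | rfl <;> simp [Config.tops, conf, setClk, clk]
  simp only [step, conf, halt, delta, Config.act] at this ⊢
  rw [if_neg this]
  rfl

theorem step_refill_go (h i j : ℕ) (b : Bool) :
    step inp pre tmp main (conf (.refill h :: κ) s (setClk τ h i (j + 1))) b =
      conf (.refill h :: κ) s (setClk τ h (i + 1) j) := by
  have : Config.tops (conf (.refill h :: κ) s (setClk τ h i (j + 1)))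
      (clk K D h true) = some true := by
    simp [Config.tops, conf, setClk, clk, List.replicate_succ]
  simp only [step, conf, halt, delta, Config.act] at this ⊢
  rw [if_pos this]
  simp only [Config.mk.injEq, true_and]
  funext k
  rcases k with k | ⟨e, b⟩
  · simp [StackOp.apply]
  · by_cases he : e = clockIdx D h
    · cases b <;> simp [he, setClk, StackOp.apply, List.replicate_succ]
    · simp [he, setClk, StackOp.apply]

theorem step_refill_stop (h i : ℕ) (b : Bool) :
    step inp pre tmp main (conf (.refill h :: κ) s (setClk τ h i 0)) b =
      conf κ s (setClk τ h i 0) := by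
  have : ¬ (Config.tops (conf (.refill h :: κ) s (setClk τ h i 0))
      (clk K D h true) = some true) := by
    simp [Config.tops, conf, setClk, clk]
  simp only [step, conf, halt, delta, Config.act] at this ⊢
  rw [if_neg this]
  rfl

theorem ends_refill (h i j : ℕ) :
    Ends inp pre tmp main (j + 1) (conf (.refill h :: κ) s (setClk τ h i j))
      (· = conf κ s (setClk τ h (i + j) 0)) := by
  induction j generalizing i with
  | zero =>
    refine Ends.cons fun b => ?_
    rw [step_refill_stop]
    exact Ends.of_now rfl
  | succ j ih =>
    refine Ends.cons fun b => ?_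
    rw [step_refill_go]
    have := ih (i + 1)
    rwa [show i + 1 + j = i + (j + 1) by omega] at this

/-- All clocks for heights below `d` show `N` remaining and no used ticks. -/
def Full (N d : ℕ) (τ : Fin D × Bool → List Bool) : Prop :=
  ∀ h < d, τ (clockIdx D h, false) = List.replicate N true ∧ τ (clockIdx D h, true) = []

theorem Full.mono {N d d' : ℕ} (hτ : Full N d τ) (h : d' ≤ d) : Full N d' τ :=
  fun e he => hτ e (by omega)

theorem Full.setClk {N d : ℕ} (hτ : Full N d τ) (hd : d < D) (i j : ℕ) :
    Full N d (setClk τ d i j) := by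
  intro h hh
  have : clockIdx D h ≠ clockIdx D d := by
    intro e
    have := congrArg Fin.val e
    simp only [clockIdx, Fin.val_ofNat, Nat.mod_eq_of_lt (hh.trans hd), Nat.mod_eq_of_lt hd] at this
    omega
  simpa [Ctrl.setClk, this] using hτ h hh

theorem Full.setClk_eq {N d h : ℕ} (hτ : Full N d τ) (hd : h < d) : Ctrl.setClk τ h N 0 = τ := by
  funext ⟨e, b⟩
  by_cases he : e = clockIdx D h
  · subst he; cases b <;> simp [Ctrl.setClk, (hτ h hd).1, (hτ h hd).2]
  · simp [Ctrl.setClk, he]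

/-- Every branch of the machine that runs a program aborts or ends in a store related by the
program to the initial one, within the time bound. -/
theorem ends_run {N : ℕ} (c : Prog K) (hD : c.depth ≤ D) (κ : List (Frame K)) (s : Store K)
    (τ : Fin D × Bool → List Bool) (hτ : Full N c.depth τ) :
    Ends inp pre tmp main (c.time.eval N) (conf (.run c :: κ) s τ)
      (fun x => x.state = .reject ∨ ∃ s', c.Rel N s s' ∧ x = conf κ s' τ) := by
  induction c generalizing κ s τ with
  | fail =>
    simp only [Prog.time, Polynomial.eval_one]
    exact Ends.cons fun b => Ends.of_now (.inl rfl)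
  | empty a =>
    simp only [Prog.time, Polynomial.eval_one]
    refine Ends.cons fun b => Ends.of_now ?_
    by_cases h : s a = []
    · exact .inr ⟨s, ⟨h, rfl⟩, step_empty a b h⟩
    · exact .inl (step_empty_ne a b h)
  | emit x bs =>
    simp only [Prog.time, Polynomial.eval_one]
    exact Ends.cons fun b => Ends.of_now (.inr ⟨_, rfl, step_emit x bs b⟩)
  | shift a x bs =>
    simp only [Prog.time, Polynomial.eval_one]
    refine Ends.cons fun b => Ends.of_now ?_
    by_cases h : (s a).head? = some x
    · exact .inr ⟨_, ⟨h, rfl⟩, step_shift a x bs b h⟩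
    · exact .inl (step_shift_ne a x bs b h)
  | seq c d hc hd =>
    simp only [Prog.time, Polynomial.eval_one, Polynomial.eval_add]
    simp only [Prog.depth] at hD hτ
    refine Ends.cons fun b => ?_
    rw [step_seq]
    refine (hc (by omega) _ s τ (hτ.mono (by omega))).bind ?_
    rintro x (hx | ⟨t, ht, rfl⟩)
    · exact Ends.of_now (.inl hx)
    · refine (hd (by omega) κ t τ (hτ.mono (by omega))).mono le_rfl ?_
      rintro x (hx | ⟨s', hs', rfl⟩)
      · exact .inl hx
      · exact .inr ⟨s', ⟨t, ht, hs'⟩, rfl⟩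
  | alt c d hc hd =>
    simp only [Prog.time, Polynomial.eval_one, Polynomial.eval_add]
    simp only [Prog.depth] at hD hτ
    refine Ends.cons fun b => ?_
    rw [step_alt]
    cases b
    · refine (hd (by omega) κ s τ (hτ.mono (by omega))).mono (by omega) ?_
      rintro x (hx | ⟨s', hs', rfl⟩)
      · exact .inl hx
      · exact .inr ⟨s', .inr hs', rfl⟩
    · refine (hc (by omega) κ s τ (hτ.mono (by omega))).mono (by omega) ?_
      rintro x (hx | ⟨s', hs', rfl⟩)
      · exact .inl hx
      · exact .inr ⟨s', .inl hs', rfl⟩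
  | star c hc =>
    simp only [Prog.depth] at hD hτ
    simp only [Prog.time, Polynomial.eval_add, Polynomial.eval_mul, Polynomial.eval_X,
      Polynomial.eval_one]
    have quiet : ∀ (s : Store K) (i j : ℕ), i + j = N →
        Ends inp pre tmp main (N + 1) (conf (.refill c.depth :: κ) s (setClk τ c.depth i j))
          (fun x => x.state = .reject ∨ ∃ s', (∃ m ≤ i, Iter (c.Rel N) m s s') ∧
            x = conf κ s' τ) := by
      intro s i j hij
      refine (ends_refill c.depth i j).mono (by omega) ?_
      rintro x rfl
      refine .inr ⟨s, ⟨0, Nat.zero_le _, rfl⟩, ?_⟩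
      rw [hij, hτ.setClk_eq (Nat.lt_succ_self _)]
    have key : ∀ (i j : ℕ) (s : Store K), i + j = N →
        Ends inp pre tmp main (i * (c.time.eval N + 1) + 1 + (N + 1))
          (conf (.run (.star c) :: κ) s (setClk τ c.depth i j))
          (fun x => x.state = .reject ∨ ∃ s', (∃ m ≤ i, Iter (c.Rel N) m s s') ∧
            x = conf κ s' τ) := by
      intro i
      induction i with
      | zero =>
        intro j s hij
        have : 0 * (c.time.eval N + 1) + 1 + (N + 1) = (N + 1) + 1 := by omega
        rw [this]
        refine Ends.cons fun b => ?_
        rw [step_star_stop c b 0 j (.inr rfl)]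
        exact quiet s 0 j hij
      | succ i ih =>
        intro j s hij
        have : (i + 1) * (c.time.eval N + 1) + 1 + (N + 1) =
            (c.time.eval N + (i * (c.time.eval N + 1) + 1 + (N + 1))) + 1 := by ring
        rw [this]
        refine Ends.cons fun b => ?_
        cases b
        · rw [step_star_stop c false _ j (.inl rfl)]
          exact (quiet s (i + 1) j hij).mono (by nlinarith) fun _ h => h
        · rw [step_star_go]
          refine (hc (by omega) _ s _ ((hτ.mono (Nat.le_succ _)).setClk (by omega) i (j + 1))).bind
            ?_
          rintro x (hx | ⟨t, ht, rfl⟩)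
          · exact Ends.of_now (.inl hx)
          · refine (ih (j + 1) t (by omega)).mono le_rfl ?_
            rintro x (hx | ⟨s', ⟨m, hm, hs'⟩, rfl⟩)
            · exact .inl hx
            · exact .inr ⟨s', ⟨m + 1, by omega, t, ht, hs'⟩, rfl⟩
    have := key N 0 s (by omega)
    rwa [hτ.setClk_eq (Nat.lt_succ_self _)] at this

/-- Every result of a program is produced by some branch of the machine. -/
theorem reach_run {N : ℕ} (c : Prog K) (hD : c.depth ≤ D) (κ : List (Frame K)) (s s' : Store K)
    (τ : Fin D × Bool → List Bool) (hτ : Full N c.depth τ) (h : c.Rel N s s') :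
    Reach inp pre tmp main (conf (.run c :: κ) s τ) (conf κ s' τ) := by
  induction c generalizing κ s s' τ with
  | fail => exact h.elim
  | empty a =>
    obtain ⟨h, rfl⟩ := h
    refine Reach.cons true ?_
    rw [step_empty a _ h]
    exact Reach.refl _
  | emit x bs =>
    obtain rfl := h
    refine Reach.cons true ?_
    rw [step_emit]
    exact Reach.refl _
  | shift a x bs =>
    obtain ⟨h, rfl⟩ := h
    refine Reach.cons true ?_
    rw [step_shift a x bs _ h]
    exact Reach.refl _
  | seq c d hc hd =>
    obtain ⟨t, h1, h2⟩ := h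
    simp only [Prog.depth] at hD hτ
    refine Reach.cons true ?_
    rw [step_seq]
    exact (hc (by omega) _ s t τ (hτ.mono (by omega)) h1).trans
      (hd (by omega) κ t s' τ (hτ.mono (by omega)) h2)
  | alt c d hc hd =>
    simp only [Prog.depth] at hD hτ
    rcases h with h | h
    · refine Reach.cons true ?_
      rw [step_alt]
      exact hc (by omega) κ s s' τ (hτ.mono (by omega)) h
    · refine Reach.cons false ?_
      rw [step_alt]
      exact hd (by omega) κ s s' τ (hτ.mono (by omega)) h
  | star c hc =>
    obtain ⟨m, hm, h⟩ := h
    simp only [Prog.depth] at hD hτ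
    have key : ∀ (m i j : ℕ) (s : Store K), i + j = N → m ≤ i → Iter (c.Rel N) m s s' →
        Reach inp pre tmp main (conf (.run (.star c) :: κ) s (setClk τ c.depth i j))
          (conf κ s' τ) := by
      intro m
      induction m with
      | zero =>
        rintro i j s hij - rfl
        refine Reach.cons false ?_
        rw [step_star_stop c false i j (.inl rfl)]
        have := (ends_refill (inp := inp) (pre := pre) (tmp := tmp) (main := main) (κ := κ)
          (s := s) (τ := τ) c.depth i j).reach
        rwa [hij, hτ.setClk_eq (Nat.lt_succ_self _)] at this
      | succ m ih =>
        rintro i j s hij hmi ⟨t, h1, h2⟩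
        obtain ⟨i, rfl⟩ : ∃ i', i = i' + 1 := ⟨i - 1, by omega⟩
        refine Reach.cons true ?_
        rw [step_star_go]
        exact (hc (by omega) _ s t _ ((hτ.mono (Nat.le_succ _)).setClk (by omega) i (j + 1))
          h1).trans (ih i (j + 1) t (by omega) (by omega) h2)
    have := key m N 0 s (by omega) hm h
    rwa [hτ.setClk_eq (Nat.lt_succ_self _)] at this

end Ctrl

namespace Ctrl

variable {K : Type} [DecidableEq K] {D : ℕ} [NeZero D]
variable {inp pre tmp : K} {main : Prog K}

/-! ### Loading the input of a program -/

/-- Clock stacks showing `i` remaining and no used ticks. -/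
def ticks (D i : ℕ) : Fin D × Bool → List Bool :=
  fun e => if e.2 then [] else List.replicate i true

/-- The initial store of a program: `w` on stack `inp` and `p` on stack `pre`. -/
def initStore (inp pre : K) (p w : List Bool) : Store K :=
  fun k => if k = inp then w else if k = pre then p else []

theorem ends_back (ht : tmp ≠ inp) (y x : List Bool) (s : Store K) (i : ℕ) :
    Ends inp pre tmp main (y.length + 1)
      (⟨.back, Sum.elim (Function.update (Function.update s inp x) tmp y) (ticks D i)⟩)
      (· = conf [.run main]
        (Function.update (Function.update s inp (y.reverse ++ x)) tmp [])
        (ticks D (i + y.length + 1))) := by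
  induction y generalizing x i with
  | nil =>
    refine Ends.cons fun b => Ends.of_now ?_
    simp only [step, halt, delta, Config.tops, Sum.elim_inl, Function.update_self, List.head?_nil,
      Config.act, conf, Config.mk.injEq, true_and]
    funext k
    rcases k with k | ⟨e, b⟩
    · simp [StackOp.apply]
    · cases b <;> simp [StackOp.apply, ticks, List.replicate_succ]
  | cons a y ih =>
    refine Ends.cons fun b => ?_
    have : step inp pre tmp main
        (⟨.back, Sum.elim (Function.update (Function.update s inp x) tmp (a :: y)) (ticks D i)⟩) b
        = ⟨.back, Sum.elim (Function.update (Function.update s inp (a :: x)) tmp y)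
          (ticks D (i + 1))⟩ := by
      simp only [step, halt, delta, Config.tops, Sum.elim_inl, Function.update_self,
        List.head?_cons, Config.act, Config.mk.injEq, true_and]
      funext k
      rcases k with k | ⟨e, b⟩
      · by_cases h1 : k = tmp
        · subst h1; simp [StackOp.apply]
        · by_cases h2 : k = inp
          · subst h2; simp [StackOp.apply, h1]
          · simp [StackOp.apply, h1, h2]
      · cases b <;> simp [StackOp.apply, ticks, List.replicate_succ]
    rw [this]
    have h := ih (a :: x) (i + 1)
    rw [List.reverse_cons, List.append_assoc, List.length_cons,
      show i + (y.length + 1) + 1 = i + 1 + y.length + 1 by omega]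
    exact h

theorem ends_load (ht : tmp ≠ inp) (x y : List Bool) (s : Store K) (i : ℕ) :
    Ends inp pre tmp main (x.length + 1)
      (⟨.load, Sum.elim (Function.update (Function.update s inp x) tmp y) (ticks D i)⟩)
      (· = ⟨.back, Sum.elim (Function.update (Function.update s inp []) tmp (x.reverse ++ y))
        (ticks D (i + 1))⟩) := by
  induction x generalizing y with
  | nil =>
    refine Ends.cons fun b => Ends.of_now ?_
    simp only [step, halt, delta, Config.tops, Sum.elim_inl, Function.update_self, List.head?_nil,
      Config.act, Config.mk.injEq, Function.update_of_ne ht.symm, true_and]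
    funext k
    rcases k with k | ⟨e, b⟩
    · simp [StackOp.apply]
    · cases b <;> simp [StackOp.apply, ticks, List.replicate_succ]
  | cons a x ih =>
    refine Ends.cons fun b => ?_
    have : step inp pre tmp main
        (⟨.load, Sum.elim (Function.update (Function.update s inp (a :: x)) tmp y) (ticks D i)⟩) b
        = ⟨.load, Sum.elim (Function.update (Function.update s inp x) tmp (a :: y))
          (ticks D i)⟩ := by
      simp only [step, halt, delta, Config.tops, Sum.elim_inl, Function.update_self,
        Function.update_of_ne ht.symm, List.head?_cons, Config.act, Config.mk.injEq, true_and]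
      funext k
      rcases k with k | ⟨e, b⟩
      · by_cases h1 : k = tmp
        · subst h1; simp [StackOp.apply, ht]
        · by_cases h2 : k = inp
          · subst h2; simp [StackOp.apply, h1]
          · simp [StackOp.apply, h1, h2]
      · cases b <;> simp [StackOp.apply]
    rw [this]
    have h := ih (a :: y)
    rw [List.reverse_cons, List.append_assoc]
    exact h

theorem ends_load_back (hi : inp ≠ pre) (ht : tmp ≠ inp) (hp : tmp ≠ pre) (p w : List Bool) :
    Ends inp pre tmp main (2 * w.length + 2)
      (⟨.load, Sum.elim (initStore inp pre p w) (ticks D 0)⟩)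
      (· = conf [.run main] (initStore inp pre p w) (ticks D (w.length + 2))) := by
  have e : initStore inp pre p w =
      Function.update (Function.update (initStore inp pre p w) inp w) tmp [] := by
    funext k
    by_cases h1 : k = tmp
    · subst h1; simp [initStore, ht, hp]
    · by_cases h2 : k = inp
      · subst h2; simp [initStore, h1]
      · simp [h1, h2]
  rw [e]
  have h1 := ends_load (D := D) (pre := pre) (main := main) ht w [] (initStore inp pre p w) 0
  refine (h1.bind (T' := w.length + 1) ?_).mono (by omega) fun _ h => h
  rintro x rfl
  have h2 := ends_back (D := D) (pre := pre) (main := main) ht w.reverse []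
    (initStore inp pre p w) 1
  rw [List.length_reverse, List.reverse_reverse, List.append_nil,
    show 1 + w.length + 1 = w.length + 2 by omega] at h2
  rw [List.append_nil]
  exact h2

/-- The code of a string in which each bit is preceded by `1`. -/
def pairs (l : List Bool) : List Bool := l.flatMap fun b => [true, b]

theorem step_head_true (hi : inp ≠ pre) (a : Bool) (p q : List Bool) (b b' : Bool) :
    step inp pre tmp main (step inp pre tmp main
      ⟨.head, Sum.elim (initStore inp pre p (true :: a :: q)) (ticks D 0)⟩ b) b' =
      ⟨.head, Sum.elim (initStore inp pre (a :: p) q) (ticks D 0)⟩ := by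
  simp only [step, halt, delta, Config.tops, Sum.elim_inl, initStore, if_true, List.head?_cons,
    Config.act, StackOp.apply, List.tail_cons, Config.mk.injEq, true_and]
  funext k
  rcases k with k | e
  · by_cases h1 : k = inp
    · subst h1; simp [initStore]
    · by_cases h2 : k = pre
      · subst h2; simp [initStore, h1]
      · simp [initStore, h1, h2]
  · simp

theorem step_head_false (p q : List Bool) (b : Bool) :
    step inp pre tmp main ⟨.head, Sum.elim (initStore inp pre p (false :: q)) (ticks D 0)⟩ b =
      ⟨.load, Sum.elim (initStore inp pre p q) (ticks D 0)⟩ := by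
  simp only [step, halt, delta, Config.tops, Sum.elim_inl, initStore, if_true, List.head?_cons,
    Config.act, Config.mk.injEq, true_and]
  funext k
  rcases k with k | e
  · by_cases h1 : k = inp
    · subst h1; simp [initStore, StackOp.apply]
    · simp [initStore, h1, StackOp.apply]
  · simp [StackOp.apply]

theorem ends_head (hi : inp ≠ pre) : ∀ (q p : List Bool),
    Ends inp pre tmp main (q.length + 1)
      (⟨.head, Sum.elim (initStore inp pre p q) (ticks D 0)⟩)
      (fun x => x.state = .reject ∨ ∃ l w, q = pairs l ++ false :: w ∧
        x = ⟨.load, Sum.elim (initStore inp pre (l.reverse ++ p) w) (ticks D 0)⟩)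
  | [], p => by
    refine Ends.cons fun b => Ends.of_now (.inl ?_)
    simp [step, halt, delta, Config.tops, initStore, Config.act]
  | false :: q, p => by
    refine (Ends.cons (T := 0) fun b => Ends.of_now (.inr ⟨[], q, rfl, ?_⟩)).mono
      (by simp) fun _ h => h
    rw [step_head_false]
    rfl
  | [true], p => by
    refine Ends.cons fun b => (Ends.cons (T := 0) fun b' => Ends.of_now (.inl ?_))
    simp [step, halt, delta, Config.tops, initStore, Config.act, StackOp.apply]
  | true :: a :: q, p => by
    refine Ends.cons fun b => Ends.cons fun b' => ?_
    rw [step_head_true hi]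
    refine (ends_head hi q (a :: p)).mono le_rfl ?_
    rintro x (hx | ⟨l, w, rfl, rfl⟩)
    · exact .inl hx
    · exact .inr ⟨a :: l, w, by simp [pairs], by simp⟩

theorem reach_head (hi : inp ≠ pre) (l w p : List Bool) :
    Reach (D := D) inp pre tmp main
      (⟨.head, Sum.elim (initStore inp pre p (pairs l ++ false :: w)) (ticks D 0)⟩)
      ⟨.load, Sum.elim (initStore inp pre (l.reverse ++ p) w) (ticks D 0)⟩ := by
  induction l generalizing p with
  | nil =>
    refine Reach.cons true ?_
    simp only [pairs, List.flatMap_nil, List.nil_append, step_head_false]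
    exact Reach.refl _
  | cons a l ih =>
    refine Reach.cons true (Reach.cons true ?_)
    simp only [pairs, List.flatMap_cons, List.cons_append, List.nil_append] at ih ⊢
    rw [step_head_true hi]
    simpa using ih (a :: p)

omit [DecidableEq K] in
theorem full_ticks (N d : ℕ) : Full N d (ticks D N) := by
  intro h _; simp [ticks]

theorem foldl_step_of_halt (c : MConfig K D) (h : (halt c.state).isSome) (ch : List Bool) :
    ch.foldl (step inp pre tmp main) c = c := by
  induction ch with
  | nil => rfl
  | cons b ch ih =>
    have : step inp pre tmp main c b = c := by
      obtain ⟨v, hv⟩ := Option.isSome_iff_exists.1 h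
      simp [step, hv]
    rw [List.foldl_cons, this, ih]

/-! ### The finite control -/

/-- The continuations that occur while a program is run with continuation `κ`. -/
def conts : Prog K → List (Frame K) → Set (List (Frame K))
  | .seq c d, κ => {.run (.seq c d) :: κ} ∪ (conts c (.run d :: κ) ∪ conts d κ)
  | .alt c d, κ => {.run (.alt c d) :: κ} ∪ (conts c κ ∪ conts d κ)
  | .star c, κ => {.run (.star c) :: κ, .refill c.depth :: κ} ∪ conts c (.run (.star c) :: κ)
  | c, κ => {.run c :: κ}

omit [DecidableEq K] in
/-- Only finitely many continuations occur, so finitely many control states are enough. -/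
theorem finite_conts (c : Prog K) (κ : List (Frame K)) : (conts c κ).Finite := by
  induction c generalizing κ with
  | seq c d hc hd => exact (Set.finite_singleton _).union ((hc _).union (hd _))
  | alt c d hc hd => exact (Set.finite_singleton _).union ((hc _).union (hd _))
  | star c hc => exact (Set.toFinite _).union (hc _)
  | _ => exact Set.finite_singleton _

omit [DecidableEq K] in
theorem mem_conts (c : Prog K) (κ : List (Frame K)) : .run c :: κ ∈ conts c κ := by
  cases c <;> simp [conts]

/-- The continuations in `conts c κ` are closed under the transitions, up to the point where `κ` is
reached. -/
theorem delta_conts (c : Prog K) (κ κ' : List (Frame K)) (h : κ' ∈ conts c κ) (b : Bool)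
    (t : MStack K D → Option Bool) :
    (delta inp pre tmp main b (exec κ') t).1 = reject ∨
      ∃ κ'', (delta inp pre tmp main b (exec κ') t).1 = exec κ'' ∧
        (κ'' ∈ conts c κ ∨ κ'' = κ) := by
  induction c generalizing κ with
  | fail => obtain rfl := h; exact .inl rfl
  | empty a =>
    obtain rfl := h
    by_cases ha : t (.inl a) = none
    · exact .inr ⟨κ, by simp [delta, ha], .inr rfl⟩
    · exact .inl (by simp [delta, ha])
  | emit x bs => obtain rfl := h; exact .inr ⟨κ, rfl, .inr rfl⟩
  | shift a x bs =>
    obtain rfl := h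
    by_cases ha : t (.inl a) = some x
    · exact .inr ⟨κ, by simp [delta, ha], .inr rfl⟩
    · exact .inl (by simp [delta, ha])
  | seq c d hc hd =>
    rcases h with rfl | h | h
    · exact .inr ⟨_, rfl, .inl (.inr (.inl (mem_conts _ _)))⟩
    · rcases hc _ h with h | ⟨κ'', h1, h | rfl⟩
      · exact .inl h
      · exact .inr ⟨_, h1, .inl (.inr (.inl h))⟩
      · exact .inr ⟨_, h1, .inl (.inr (.inr (mem_conts _ _)))⟩
    · rcases hd _ h with h | ⟨κ'', h1, h | rfl⟩
      · exact .inl h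
      · exact .inr ⟨_, h1, .inl (.inr (.inr h))⟩
      · exact .inr ⟨_, h1, .inr rfl⟩
  | alt c d hc hd =>
    rcases h with rfl | h | h
    · cases b
      · exact .inr ⟨_, rfl, .inl (.inr (.inr (mem_conts _ _)))⟩
      · exact .inr ⟨_, rfl, .inl (.inr (.inl (mem_conts _ _)))⟩
    · rcases hc _ h with h | ⟨κ'', h1, h | rfl⟩
      · exact .inl h
      · exact .inr ⟨_, h1, .inl (.inr (.inl h))⟩
      · exact .inr ⟨_, h1, .inr rfl⟩
    · rcases hd _ h with h | ⟨κ'', h1, h | rfl⟩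
      · exact .inl h
      · exact .inr ⟨_, h1, .inl (.inr (.inr h))⟩
      · exact .inr ⟨_, h1, .inr rfl⟩
  | star c hc =>
    rcases h with (rfl | rfl) | h
    · simp only [delta]
      split
      · exact .inr ⟨_, rfl, .inl (.inr (mem_conts _ _))⟩
      · exact .inr ⟨_, rfl, .inl (.inl (.inr rfl))⟩
    · simp only [delta]
      split
      · exact .inr ⟨_, rfl, .inl (.inl (.inr rfl))⟩
      · exact .inr ⟨_, rfl, .inr rfl⟩
    · rcases hc _ h with h | ⟨κ'', h1, h | rfl⟩
      · exact .inl h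
      · exact .inr ⟨_, h1, .inl (.inr h)⟩
      · exact .inr ⟨_, h1, .inl (.inl (.inl rfl))⟩

/-- The control states that are needed to run the program `main`. -/
def states (main : Prog K) : Set (Ctrl K) :=
  {head, bit, load, back, reject} ∪ exec '' (conts main [] ∪ {[]})

omit [DecidableEq K] in
theorem finite_states (main : Prog K) : (states main).Finite :=
  (Set.toFinite _).union (((finite_conts _ _).union (Set.finite_singleton _)).image _)

theorem delta_mem_states (b : Bool) (q : Ctrl K) (t : MStack K D → Option Bool)
    (hq : q ∈ states main) : (delta inp pre tmp main b q t).1 ∈ states main := by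
  have hex : exec [.run main] ∈ states main := .inr ⟨_, .inl (mem_conts _ _), rfl⟩
  cases q with
  | head => simp only [delta]; split <;> simp [states]
  | bit => simp only [delta]; split <;> simp [states]
  | load => simp only [delta]; split <;> simp [states]
  | back =>
    simp only [delta]
    split
    · simp [states]
    · exact hex
  | reject => exact hq
  | exec κ =>
    rcases hq with hq | ⟨κ', h, h'⟩
    · simp at hq
    · obtain rfl : κ' = κ := by simpa using h'
      rcases h with h | rfl
      · rcases delta_conts (inp := inp) (pre := pre) (tmp := tmp) (main := main) main [] κ' h b t
          with h | ⟨κ'', h1, h⟩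
        · rw [h]; simp [states]
        · rw [h1]; exact .inr ⟨κ'', h, rfl⟩
      · exact .inr ⟨[], .inr rfl, rfl⟩

/-- The Turing machine that executes the program `main`. -/
noncomputable def toNTM [Fintype K] (inp pre tmp out : K) (main : Prog K) (start : Ctrl K)
    (hs : start ∈ states main) : NTM where
  State := states main
  Stack := MStack K (main.depth + 1)
  stateFin := (finite_states main).fintype
  start := ⟨start, hs⟩
  inp := .inl inp
  out := .inl out
  halt q := halt q.1
  δ b q t := (⟨_, delta_mem_states (inp := inp) (pre := pre) (tmp := tmp) b q.1 t q.2⟩,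
    (delta inp pre tmp main b q.1 t).2)

variable [Fintype K] {out : K} {start : Ctrl K} {hs : start ∈ states main}

theorem run_toNTM (x ch : List Bool) :
    halt ((toNTM inp pre tmp out main start hs).run x ch).state.1 =
        halt (ch.foldl (step inp pre tmp main)
          ⟨start, Sum.elim (initStore inp pre [] x) (ticks (main.depth + 1) 0)⟩).state ∧
      ((toNTM inp pre tmp out main start hs).run x ch).stk =
        (ch.foldl (step inp pre tmp main)
          ⟨start, Sum.elim (initStore inp pre [] x) (ticks (main.depth + 1) 0)⟩).stk := by
  set M := toNTM inp pre tmp out main start hs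
  let up : Config M.State M.Stack → MConfig K (main.depth + 1) := fun c => ⟨c.state.1, c.stk⟩
  have hstep : ∀ c b, up (M.step c b) = step inp pre tmp main (up c) b := by
    intro c b
    change up (match halt c.state.1 with | some _ => c | none => c.act (M.δ b c.state c.tops)) =
      match halt c.state.1 with
      | some _ => up c
      | none => (up c).act (delta inp pre tmp main b c.state.1 c.tops)
    cases h : halt c.state.1 <;> rfl
  have hfold : ∀ c, up (ch.foldl M.step c) = ch.foldl (step inp pre tmp main) (up c) := by
    induction ch with
    | nil => intro c; rfl
    | cons b ch ih => intro c; rw [List.foldl_cons, ih, hstep]; rfl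
  have hinit : up (Config.init M.start M.inp x) =
      ⟨start, Sum.elim (initStore inp pre [] x) (ticks (main.depth + 1) 0)⟩ := by
    change (⟨start, _⟩ : MConfig K (main.depth + 1)) = ⟨start, _⟩
    congr 1
    funext k
    change (@ite _ (k = Sum.inl inp) ((toNTM inp pre tmp out main start hs).stackDec k _) x []) = _
    rcases k with k | ⟨e, b⟩
    · by_cases h : k = inp
      · exact (if_pos (congrArg Sum.inl h)).trans (by simp [initStore, h])
      · exact (if_neg fun e => h (Sum.inl_injective e)).trans (by simp [initStore, h])
    · cases b <;> simp [ticks]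
  have := hfold (Config.init M.start M.inp x)
  rw [hinit] at this
  rw [← this]
  exact ⟨rfl, rfl⟩

/-- If all branches from the initial configuration halt in time and accepting ones satisfy `Φ`, then
the machine runs in polynomial time, and its accepting branches are those that satisfy `Φ`. -/
theorem toNTM_spec (p : Polynomial ℕ) (Φ : List Bool → MConfig K (main.depth + 1) → Prop)
    (h : ∀ x, Ends inp pre tmp main (p.eval x.length)
      ⟨start, Sum.elim (initStore inp pre [] x) (ticks (main.depth + 1) 0)⟩
      (fun c => c.state = .reject ∨ (Φ x c ∧ halt c.state = some true)))
    (h' : ∀ x c, Φ x c → Reach inp pre tmp main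
      ⟨start, Sum.elim (initStore inp pre [] x) (ticks (main.depth + 1) 0)⟩ c ∧
        halt c.state = some true) :
    (toNTM inp pre tmp out main start hs).PolyTime ∧
    ∀ x y, (∃ ch, (toNTM inp pre tmp out main start hs).AcceptsAlong x ch ∧
        ((toNTM inp pre tmp out main start hs).run x ch).stk (Sum.inl out) = y) ↔
      ∃ c, Φ x c ∧ c.stk (.inl out) = y := by
  have hend : ∀ x (ch : List Bool), p.eval x.length ≤ ch.length →
      (ch.foldl (step inp pre tmp main)
        ⟨start, Sum.elim (initStore inp pre [] x) (ticks (main.depth + 1) 0)⟩).state = .reject ∨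
      (Φ x (ch.foldl (step inp pre tmp main)
        ⟨start, Sum.elim (initStore inp pre [] x) (ticks (main.depth + 1) 0)⟩) ∧
      halt (ch.foldl (step inp pre tmp main)
        ⟨start, Sum.elim (initStore inp pre [] x) (ticks (main.depth + 1) 0)⟩).state
          = some true) := by
    intro x ch hl
    obtain ⟨m, -, hm⟩ := h x ch hl
    rw [← List.take_append_drop m ch, List.foldl_append, foldl_step_of_halt]
    · exact hm
    · rcases hm with hm | ⟨-, hm⟩
      · rw [hm]; rfl
      · rw [hm]; rfl
  refine ⟨⟨p, fun x ch hl => ?_⟩, fun x y => ⟨?_, ?_⟩⟩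
  · change (halt ((toNTM inp pre tmp out main start hs).run x ch).state.1).isSome
    rw [(run_toNTM x ch).1]
    rcases hend x ch hl.ge with hm | ⟨-, hm⟩
    · rw [hm]; rfl
    · rw [hm]; rfl
  · rintro ⟨ch, hacc, hy⟩
    change halt ((toNTM inp pre tmp out main start hs).run x ch).state.1 = some true at hacc
    rw [(run_toNTM x ch).1] at hacc
    rw [(run_toNTM x ch).2] at hy
    have := hend x (ch ++ List.replicate (p.eval x.length) true) (by simp)
    rw [List.foldl_append, foldl_step_of_halt _ (by rw [hacc]; rfl)] at this
    rcases this with hm | ⟨hm, -⟩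
    · rw [hm] at hacc; simp [halt] at hacc
    · exact ⟨_, hm, hy⟩
  · rintro ⟨c, hc, hy⟩
    obtain ⟨⟨ch, hch⟩, hacc⟩ := h' x c hc
    refine ⟨ch, ?_, ?_⟩
    · change halt ((toNTM inp pre tmp out main start hs).run x ch).state.1 = some true
      rw [(run_toNTM x ch).1, hch, hacc]
    · rw [(run_toNTM x ch).2, hch, hy]

/-- A program gives a polynomial-time machine whose accepting branches produce the results of the
program for the given input. -/
theorem exists_ntm (hi : inp ≠ pre) (ht : tmp ≠ inp) (hp : tmp ≠ pre) (out : K) (main : Prog K) :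
    ∃ M : NTM, M.PolyTime ∧ ∀ x y, (∃ ch, M.AcceptsAlong x ch ∧ (M.run x ch).stk M.out = y) ↔
      ∃ s', main.Rel (x.length + 2) (initStore inp pre [] x) s' ∧ s' out = y := by
  have hs : (load : Ctrl K) ∈ states main := by simp [states]
  have key := toNTM_spec (inp := inp) (pre := pre) (tmp := tmp) (out := out) (hs := hs)
    (2 * .X + 2 + main.time.comp (.X + 2))
    (fun x c => ∃ s', main.Rel (x.length + 2) (initStore inp pre [] x) s' ∧
      c = conf [] s' (ticks _ (x.length + 2)))
  obtain ⟨h1, h2⟩ := key (by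
    intro x
    have := (ends_load_back (D := main.depth + 1) (main := main) hi ht hp [] x).bind
      (T' := main.time.eval (x.length + 2)) (Ψ := fun c => c.state = .reject ∨
        ((∃ s', main.Rel (x.length + 2) (initStore inp pre [] x) s' ∧
      c = conf [] s' (ticks _ (x.length + 2))) ∧ halt c.state = some true)) ?_
    · simpa using this
    · rintro _ rfl
      refine (ends_run main (by omega) _ _ _ (full_ticks _ _)).mono le_rfl ?_
      rintro c (h | ⟨s', h, rfl⟩)
      · exact .inl h
      · exact .inr ⟨⟨s', h, rfl⟩, rfl⟩) (by
    rintro x _ ⟨s', h, rfl⟩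
    exact ⟨(ends_load_back hi ht hp [] x).reach.trans
      (reach_run main (by omega) _ _ _ _ (full_ticks _ _) h), rfl⟩)
  refine ⟨_, h1, fun x y => (h2 x y).trans ⟨?_, ?_⟩⟩
  · rintro ⟨_, ⟨s', h, rfl⟩, hy⟩
    exact ⟨s', h, hy⟩
  · rintro ⟨s', h, hy⟩
    exact ⟨_, ⟨s', h, rfl⟩, hy⟩

/-- The string that presents the pair of `p` and `w` to the machine. -/
def pairCode (p w : List Bool) : List Bool := pairs p.reverse ++ false :: w

/-- The variant of `exists_ntm` for a program that takes a pair of strings as its input. -/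
theorem exists_ntm_pair (hi : inp ≠ pre) (ht : tmp ≠ inp) (hp : tmp ≠ pre) (main : Prog K) :
    ∃ M : NTM, M.PolyTime ∧ ∀ x, (∃ ch, M.AcceptsAlong x ch) ↔
      ∃ p w s', x = pairCode p w ∧ main.Rel (w.length + 2) (initStore inp pre p w) s' := by
  have hs : (head : Ctrl K) ∈ states main := by simp [states]
  have key := toNTM_spec (inp := inp) (pre := pre) (tmp := tmp) (out := inp) (hs := hs)
    (.X + 1 + (2 * .X + 2 + main.time.comp (.X + 2)))
    (fun x c => ∃ p w s', x = pairCode p w ∧ main.Rel (w.length + 2) (initStore inp pre p w) s' ∧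
      c = conf [] s' (ticks _ (w.length + 2)))
  obtain ⟨h1, h2⟩ := key (by
    intro x
    have := (ends_head (D := main.depth + 1) (tmp := tmp) (main := main) hi x []).bind
      (T' := 2 * x.length + 2 + main.time.eval (x.length + 2))
      (Ψ := fun c => c.state = .reject ∨
        ((∃ p w s', x = pairCode p w ∧ main.Rel (w.length + 2) (initStore inp pre p w) s' ∧
      c = conf [] s' (ticks _ (w.length + 2))) ∧ halt c.state = some true)) ?_
    · simpa using this
    · rintro c (h | ⟨l, w, rfl, rfl⟩)
      · exact Ends.of_now (.inl h)
      have hle : w.length ≤ (pairs l ++ false :: w).length := by simp; omega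
      rw [List.append_nil]
      refine ((ends_load_back hi ht hp l.reverse w).bind
        (T' := main.time.eval (w.length + 2)) ?_).mono (Nat.add_le_add (by omega)
          (main.eval_time_mono (by omega))) fun _ h => h
      rintro _ rfl
      refine (ends_run main (by omega) _ _ _ (full_ticks _ _)).mono le_rfl ?_
      rintro c (h | ⟨s', h, rfl⟩)
      · exact .inl h
      · exact .inr ⟨⟨l.reverse, w, s', by simp [pairCode], h, rfl⟩, rfl⟩) (by
    rintro x _ ⟨p, w, s', rfl, h, rfl⟩
    have := reach_head (D := main.depth + 1) (tmp := tmp) (main := main) hi p.reverse w []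
    rw [List.reverse_reverse, List.append_nil] at this
    exact ⟨this.trans ((ends_load_back hi ht hp p w).reach.trans
      (reach_run main (by omega) _ _ _ _ (full_ticks _ _) h)), rfl⟩)
  refine ⟨_, h1, fun x => ⟨?_, ?_⟩⟩
  · rintro ⟨ch, h⟩
    obtain ⟨_, ⟨p, w, s', hx, h, rfl⟩, -⟩ := (h2 x _).1 ⟨ch, h, rfl⟩
    exact ⟨p, w, s', hx, h⟩
  · rintro ⟨p, w, s', hx, h⟩
    obtain ⟨ch, h, -⟩ := (h2 x _).2 ⟨_, ⟨p, w, s', hx, h, rfl⟩, rfl⟩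
    exact ⟨ch, h⟩

end Ctrl

/-! ### Greedy prefix search with an oracle -/

namespace OracleTM

variable (M : OracleTM) (L : Set (List Bool)) (c : Config M.State M.Stack × ℕ)

theorem step_of_halt (h : M.halt c.1.state = true) : M.step L c = c := by
  simp [step, h]

theorem step_of_query_none (h : M.halt c.1.state = false) (hq : M.query c.1.state = none) :
    M.step L c = (c.1.act (M.δ c.1.state c.1.tops), c.2) := by
  simp [step, h, hq]

open Classical in
theorem step_of_query_some (h : M.halt c.1.state = false) {y n : M.State}
    (hq : M.query c.1.state = some (y, n)) :
    M.step L c = (⟨if c.1.stk M.qry ∈ L then y else n, Function.update c.1.stk M.qry []⟩,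
      c.2 + 1) := by
  simp [step, h, hq]

end OracleTM

namespace PrefixSearch

/-- The control states of the search machine. The bit `c` is the one to be tried next. -/
inductive State where
  | inpToTmp (c : Bool)
  | tmpToQry (c : Bool)
  | accToTmp (c : Bool)
  | copy (c : Bool)
  | mark (c : Bool)
  | bit (c : Bool)
  | ask (c : Bool)
  | yes (c : Bool)
  | no (c : Bool)
  | accToOut
  | strip
  | done
  deriving DecidableEq, Fintype

/-- The stacks of the search machine: `acc` holds the prefix found so far, last bit on top. -/
inductive Stack where
  | inp
  | out
  | qry
  | acc
  | tmp
  deriving DecidableEq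

instance : Fintype Stack := ⟨{.inp, .out, .qry, .acc, .tmp}, by rintro (_ | _) <;> decide⟩

/-- The contents of the five stacks. -/
def contents {α : Type} (i o q a t : α) : Stack → α
  | .inp => i
  | .out => o
  | .qry => q
  | .acc => a
  | .tmp => t

open StackOp in
/-- The transitions of the search machine. First the query about the prefix found so far, extended
by the bit `c`, is composed from its end: the input is copied to `qry` by way of `tmp`, then a `0`
is pushed, and then each bit of the prefix, preceded by `1`. After the answer the search goes on
with a longer prefix, or with the other bit; if neither bit is possible, the output is produced. -/
def delta : State → (Stack → Option Bool) → State × (Stack → StackOp)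
  | .inpToTmp c, t =>
    match t .inp with
    | some b => (.inpToTmp c, contents pop keep keep keep (push b))
    | none => (.tmpToQry c, fun _ => keep)
  | .tmpToQry c, t =>
    match t .tmp with
    | some b => (.tmpToQry c, contents (push b) keep (push b) keep pop)
    | none => (.accToTmp c, contents keep keep (push false) keep keep)
  | .accToTmp c, t =>
    match t .acc with
    | some b => (.accToTmp c, contents keep keep keep pop (push b))
    | none => (.copy c, fun _ => keep)
  | .copy c, t =>
    match t .tmp with
    | some b => (.mark c, contents keep keep (push b) (push b) pop)
    | none => (.bit c, contents keep keep (push c) keep keep)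
  | .mark c, _ => (.copy c, contents keep keep (push true) keep keep)
  | .bit c, _ => (.ask c, contents keep keep (push true) keep keep)
  | .ask c, _ => (.ask c, fun _ => keep)
  | .yes c, _ => (.inpToTmp false, contents keep keep keep (push c) keep)
  | .no false, _ => (.inpToTmp true, fun _ => keep)
  | .no true, _ => (.accToOut, fun _ => keep)
  | .accToOut, t =>
    match t .acc with
    | some b => (.accToOut, contents keep (push b) keep pop keep)
    | none => (.strip, fun _ => keep)
  | .strip, t =>
    match t .out with
    | some true => (.strip, contents keep pop keep keep keep)
    | some false => (.done, contents keep pop keep keep keep)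
    | none => (.done, contents keep (push false) keep keep keep)
  | .done, _ => (.done, fun _ => keep)

/-- The oracle is asked in the states `ask`. -/
def query : State → Option (State × State)
  | .ask c => some (.yes c, .no c)
  | _ => none

/-- The machine that extends a prefix bit by bit, preferring `0` to `1`, as long as the oracle
answers that the extended prefix has a continuation. The query about the prefix `p` for input `w` is
`pairCode p w`. In the end the leading ones and the first zero are removed from the string found; if
there is no zero, the output is the string `0`. -/
@[reducible] def machine : OracleTM where
  State := State
  Stack := Stack
  start := .inpToTmp false
  inp := .inp
  out := .out
  qry := .qry
  halt q := q == .done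
  query := query
  δ := delta

/-- The output for the string found by the search. -/
def output : List Bool → List Bool
  | [] => [false]
  | true :: l => output l
  | false :: l => l

variable {L : Set (List Bool)}

/-- A configuration of the search machine, with the number of queries so far. -/
abbrev SConf := Config machine.State machine.Stack × ℕ

def conf (q : State) (i o y a t : List Bool) (m : ℕ) : SConf :=
  (⟨q, contents i o y a t⟩, m)

/-- The machine goes from `c` to `c'` in `n` steps. -/
def Go (L : Set (List Bool)) (n : ℕ) (c c' : SConf) : Prop :=
  (machine.step L)^[n] c = c'

theorem Go.trans {n n' : ℕ} {c c' c'' : SConf} (h : Go L n c c')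
    (h' : Go L n' c' c'') : Go L (n + n') c c'' := by
  unfold Go at *
  rw [add_comm, Function.iterate_add_apply, h, h']

theorem go_step {q q' : State} {i o y a t : List Bool} {m : ℕ} {f : Stack → StackOp}
    {i' o' y' a' t' : List Bool} (hq : ∀ c, q ≠ .ask c) (hd : q ≠ .done)
    (h : delta q (fun k => (contents i o y a t k).head?) = (q', f))
    (h' : (fun k => (f k).apply (contents i o y a t k)) = contents i' o' y' a' t') :
    Go L 1 (conf q i o y a t m) (conf q' i' o' y' a' t' m) := by
  have h2 : query q = none := by
    cases q <;> first | rfl | exact absurd rfl (hq _)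
  have h1 : (q == State.done) = false := by simpa using hd
  refine (OracleTM.step_of_query_none machine L _ h1 h2).trans ?_
  change (Config.act _ (delta q fun k => (contents i o y a t k).head?), m) = _
  rw [h]
  unfold conf
  rw [← h']
  rfl

theorem go_inpToTmp (c : Bool) (i o y a t : List Bool) (m : ℕ) :
    Go L (i.length + 1) (conf (.inpToTmp c) i o y a t m)
      (conf (.tmpToQry c) [] o y a (i.reverse ++ t) m) := by
  induction i generalizing t with
  | nil => exact go_step (by simp) (by simp) rfl (by funext k; cases k <;> rfl)
  | cons b i ih =>
    have h1 : Go L 1 (conf (.inpToTmp c) (b :: i) o y a t m)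
        (conf (.inpToTmp c) i o y a (b :: t) m) :=
      go_step (by simp) (by simp) rfl (by funext k; cases k <;> rfl)
    have h := h1.trans (ih (b :: t))
    rw [List.reverse_cons, List.append_assoc, List.length_cons, add_comm]
    exact h

theorem go_tmpToQry (c : Bool) (i o y a t : List Bool) (m : ℕ) :
    Go L (t.length + 1) (conf (.tmpToQry c) i o y a t m)
      (conf (.accToTmp c) (t.reverse ++ i) o (false :: (t.reverse ++ y)) a [] m) := by
  induction t generalizing i y with
  | nil => exact go_step (by simp) (by simp) rfl (by funext k; cases k <;> rfl)
  | cons b t ih =>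
    have h1 : Go L 1 (conf (.tmpToQry c) i o y a (b :: t) m)
        (conf (.tmpToQry c) (b :: i) o (b :: y) a t m) :=
      go_step (by simp) (by simp) rfl (by funext k; cases k <;> rfl)
    have h := h1.trans (ih (b :: i) (b :: y))
    rw [List.reverse_cons, List.append_assoc, List.append_assoc, List.length_cons, add_comm]
    exact h

theorem go_accToTmp (c : Bool) (i o y a t : List Bool) (m : ℕ) :
    Go L (a.length + 1) (conf (.accToTmp c) i o y a t m)
      (conf (.copy c) i o y [] (a.reverse ++ t) m) := by
  induction a generalizing t with
  | nil => exact go_step (by simp) (by simp) rfl (by funext k; cases k <;> rfl)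
  | cons b a ih =>
    have h1 : Go L 1 (conf (.accToTmp c) i o y (b :: a) t m)
        (conf (.accToTmp c) i o y a (b :: t) m) :=
      go_step (by simp) (by simp) rfl (by funext k; cases k <;> rfl)
    have h := h1.trans (ih (b :: t))
    rw [List.reverse_cons, List.append_assoc, List.length_cons, add_comm]
    exact h

theorem go_copy (c : Bool) (i o y a t : List Bool) (m : ℕ) :
    Go L (2 * t.length + 1) (conf (.copy c) i o y a t m)
      (conf (.bit c) i o (c :: (Ctrl.pairs t.reverse ++ y)) (t.reverse ++ a) [] m) := by
  induction t generalizing y a with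
  | nil => exact go_step (by simp) (by simp) rfl (by funext k; cases k <;> rfl)
  | cons b t ih =>
    have h1 : Go L 1 (conf (.copy c) i o y a (b :: t) m)
        (conf (.mark c) i o (b :: y) (b :: a) t m) :=
      go_step (by simp) (by simp) rfl (by funext k; cases k <;> rfl)
    have h2 : Go L 1 (conf (.mark c) i o (b :: y) (b :: a) t m)
        (conf (.copy c) i o (true :: b :: y) (b :: a) t m) :=
      go_step (by simp) (by simp) rfl (by funext k; cases k <;> rfl)
    have h := (h1.trans h2).trans (ih (true :: b :: y) (b :: a))
    have e : 2 * (b :: t).length + 1 = 1 + 1 + (2 * t.length + 1) := by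
      rw [List.length_cons]; omega
    rw [e]
    simpa [Ctrl.pairs] using h

open Classical in
theorem go_ask (c : Bool) (i o y a t : List Bool) (m : ℕ) :
    Go L 1 (conf (.ask c) i o y a t m)
      (conf (if y ∈ L then .yes c else .no c) i o [] a t (m + 1)) := by
  refine (OracleTM.step_of_query_some machine L (conf (.ask c) i o y a t m) rfl rfl).trans ?_
  have e : Function.update (contents i o y a t) Stack.qry [] = contents i o [] a t := by
    funext k; cases k <;> rfl
  unfold conf
  rw [← e]
  rfl

open Classical in
/-- One round of the search: the query whether `a.reverse ++ [c]` has a continuation. -/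
theorem go_round (c : Bool) (w o a : List Bool) (m : ℕ) :
    Go L (2 * w.length + 3 * a.length + 6) (conf (.inpToTmp c) w o [] a [] m)
      (conf (if Ctrl.pairCode (a.reverse ++ [c]) w ∈ L then .yes c else .no c)
        w o [] a [] (m + 1)) := by
  have h1 := go_inpToTmp (L := L) c w o [] a [] m
  have h2 := go_tmpToQry (L := L) c [] o [] a (w.reverse ++ []) m
  have h3 := go_accToTmp (L := L) c w o (false :: w) a [] m
  have h4 := go_copy (L := L) c w o (false :: w) [] (a.reverse ++ []) m
  have h5 : Go L 1 (conf (.bit c) w o (c :: (Ctrl.pairs a ++ false :: w)) a [] m)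
      (conf (.ask c) w o (true :: c :: (Ctrl.pairs a ++ false :: w)) a [] m) :=
    go_step (by simp) (by simp) rfl (by funext k; cases k <;> rfl)
  have h6 := go_ask (L := L) c w o (true :: c :: (Ctrl.pairs a ++ false :: w)) a [] m
  simp only [List.append_nil, List.reverse_reverse, List.length_reverse] at h1 h2 h3 h4
  have h := ((((h1.trans h2).trans h3).trans h4).trans h5).trans h6
  have e : Ctrl.pairCode (a.reverse ++ [c]) w = true :: c :: (Ctrl.pairs a ++ false :: w) := by
    simp [Ctrl.pairCode, Ctrl.pairs]
  rw [e]
  have e' : w.length + 1 + (w.length + 1) + (a.length + 1) + (2 * a.length + 1) + 1 + 1 =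
    2 * w.length + 3 * a.length + 6 := by omega
  rwa [e'] at h

theorem go_accToOut (i o y a t : List Bool) (m : ℕ) :
    Go L (a.length + 1) (conf .accToOut i o y a t m)
      (conf .strip i (a.reverse ++ o) y [] t m) := by
  induction a generalizing o with
  | nil => exact go_step (by simp) (by simp) rfl (by funext k; cases k <;> rfl)
  | cons b a ih =>
    have h1 : Go L 1 (conf .accToOut i o y (b :: a) t m) (conf .accToOut i (b :: o) y a t m) :=
      go_step (by simp) (by simp) rfl (by funext k; cases k <;> rfl)
    have h := h1.trans (ih (b :: o))
    rw [List.reverse_cons, List.append_assoc, List.length_cons, add_comm]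
    exact h

theorem go_strip (i o y a t : List Bool) (m : ℕ) :
    ∃ n ≤ o.length + 1, Go L n (conf .strip i o y a t m) (conf .done i (output o) y a t m) := by
  induction o with
  | nil => exact ⟨1, by simp, go_step (by simp) (by simp) rfl (by funext k; cases k <;> rfl)⟩
  | cons b o ih =>
    cases b
    · exact ⟨1, by simp, go_step (by simp) (by simp) rfl (by funext k; cases k <;> rfl)⟩
    · obtain ⟨n, hn, h⟩ := ih
      have h1 : Go L 1 (conf .strip i (true :: o) y a t m) (conf .strip i o y a t m) :=
        go_step (by simp) (by simp) rfl (by funext k; cases k <;> rfl)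
      exact ⟨1 + n, by simp; omega, h1.trans h⟩

/-- The string `p` has a continuation in `W`. -/
def Ext (W : Set (List Bool)) (p : List Bool) : Prop := ∃ z ∈ W, p <+: z

/-- Wherever `p` has a `1`, no element of `W` agrees with `p` before that place and has a `0`
there. -/
def Greedy (W : Set (List Bool)) (p : List Bool) : Prop :=
  ∀ i, p[i]? = some true → ¬ Ext W (p.take i ++ [false])

theorem Greedy.append {W : Set (List Bool)} {p : List Bool} (h : Greedy W p) {b : Bool}
    (hb : b = true → ¬ Ext W (p ++ [false])) : Greedy W (p ++ [b]) := by
  intro i hi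
  rcases lt_trichotomy i p.length with hl | rfl | hl
  · rw [List.getElem?_append_left hl] at hi
    rw [List.take_append_of_le_length hl.le]
    exact h i hi
  · simp at hi
    simpa using hb hi
  · rw [List.getElem?_eq_none (by simp; omega)] at hi
    simp at hi

/-- The search ends with a greedy prefix that cannot be extended. -/
theorem go_search {W : Set (List Bool)} {w : List Bool} {B : ℕ}
    (hL : ∀ p, Ctrl.pairCode p w ∈ L ↔ Ext W p) (hB : ∀ z ∈ W, z.length ≤ B) (d : ℕ) :
    ∀ (p : List Bool) (m : ℕ), p.length + d = B → (Ext W p ∨ p = []) → Greedy W p →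
    ∃ p' n k, n ≤ 2 * (d + 1) * (2 * w.length + 3 * B + 7) ∧ k ≤ 2 * (d + 1) ∧ p'.length ≤ B ∧
      (Ext W p' ∨ p' = []) ∧ Greedy W p' ∧ (∀ b, ¬ Ext W (p' ++ [b])) ∧
      Go L n (conf (.inpToTmp false) w [] [] p.reverse [] m)
        (conf .accToOut w [] [] p'.reverse [] (m + k)) := by
  classical
  have hlen : ∀ p, Ext W p → p.length ≤ B := by
    rintro p ⟨z, hz, hp⟩
    exact hp.length_le.trans (hB z hz)
  induction d with
  | zero =>
    intro p m hd hE hG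
    have hno : ∀ b, ¬ Ext W (p ++ [b]) := by
      intro b hb
      have := hlen _ hb
      simp at this; omega
    have h1 := go_round (L := L) false w [] p.reverse m
    have h3 := go_round (L := L) true w [] p.reverse (m + 1)
    rw [List.reverse_reverse, if_neg (by rw [hL]; exact hno _)] at h1 h3
    have h2 : Go L 1 (conf (.no false) w [] [] p.reverse [] (m + 1))
        (conf (.inpToTmp true) w [] [] p.reverse [] (m + 1)) :=
      go_step (by simp) (by simp) rfl (by funext k; cases k <;> rfl)
    have h4 : Go L 1 (conf (.no true) w [] [] p.reverse [] (m + 1 + 1))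
        (conf .accToOut w [] [] p.reverse [] (m + 1 + 1)) :=
      go_step (by simp) (by simp) rfl (by funext k; cases k <;> rfl)
    refine ⟨p, _, 2, ?_, le_rfl, by omega, hE, hG, hno, ((h1.trans h2).trans h3).trans h4⟩
    simp only [List.length_reverse]; omega
  | succ d ih =>
    intro p m hd hE hG
    have bd : 2 * (d + 1 + 1) * (2 * w.length + 3 * B + 7) =
      2 * (d + 1) * (2 * w.length + 3 * B + 7) + 2 * (2 * w.length + 3 * B + 7) := by ring
    have h1 := go_round (L := L) false w [] p.reverse m
    rw [List.reverse_reverse, List.length_reverse] at h1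
    by_cases hf : Ext W (p ++ [false])
    · rw [if_pos ((hL _).2 hf)] at h1
      have h2 : Go L 1 (conf (.yes false) w [] [] p.reverse [] (m + 1))
          (conf (.inpToTmp false) w [] [] (p ++ [false]).reverse [] (m + 1)) := by
        rw [List.reverse_append]
        exact go_step (by simp) (by simp) rfl (by funext k; cases k <;> rfl)
      obtain ⟨p', n, k, hn, hk, hl, hE', hG', hno, h⟩ :=
        ih (p ++ [false]) (m + 1) (by simp; omega) (.inl hf) (hG.append (by simp))
      have hc := (h1.trans h2).trans h
      rw [add_assoc m] at hc
      exact ⟨p', _, 1 + k, by omega, by omega, hl, hE', hG', hno, hc⟩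
    · rw [if_neg (fun h => hf ((hL _).1 h))] at h1
      have h2 : Go L 1 (conf (.no false) w [] [] p.reverse [] (m + 1))
          (conf (.inpToTmp true) w [] [] p.reverse [] (m + 1)) :=
        go_step (by simp) (by simp) rfl (by funext k; cases k <;> rfl)
      have h3 := go_round (L := L) true w [] p.reverse (m + 1)
      rw [List.reverse_reverse, List.length_reverse] at h3
      by_cases ht : Ext W (p ++ [true])
      · rw [if_pos ((hL _).2 ht)] at h3
        have h4 : Go L 1 (conf (.yes true) w [] [] p.reverse [] (m + 1 + 1))
            (conf (.inpToTmp false) w [] [] (p ++ [true]).reverse [] (m + 1 + 1)) := by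
          rw [List.reverse_append]
          exact go_step (by simp) (by simp) rfl (by funext k; cases k <;> rfl)
        obtain ⟨p', n, k, hn, hk, hl, hE', hG', hno, h⟩ :=
          ih (p ++ [true]) (m + 1 + 1) (by simp; omega) (.inl ht) (hG.append fun _ => hf)
        have hc := (((h1.trans h2).trans h3).trans h4).trans h
        rw [add_assoc m, add_assoc m] at hc
        exact ⟨p', _, 1 + 1 + k, by omega, by omega, hl, hE', hG', hno, hc⟩
      · rw [if_neg (fun h => ht ((hL _).1 h))] at h3
        have h4 : Go L 1 (conf (.no true) w [] [] p.reverse [] (m + 1 + 1))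
            (conf .accToOut w [] [] p.reverse [] (m + 1 + 1)) :=
          go_step (by simp) (by simp) rfl (by funext k; cases k <;> rfl)
        refine ⟨p, _, 2, ?_, by omega, by omega, hE, hG, ?_, ((h1.trans h2).trans h3).trans h4⟩
        · omega
        · rintro (_ | _)
          exacts [hf, ht]

theorem go_done (c : SConf) (h : c.1.state = State.done) (n : ℕ) : Go L n c c := by
  induction n with
  | zero => rfl
  | succ n ih =>
    have : machine.step L c = c := machine.step_of_halt L c (by rw [h]; rfl)
    unfold Go at *
    rw [Function.iterate_succ_apply, this, ih]

/-- If the prefixes of the elements of `W w` can be recognized in NP and these elements have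
polynomial length `B`, then the greedy element of `W w` is found with at most `2 (B + 1)`
queries. -/
theorem inFPNPQueries {W : List Bool → Set (List Bool)} {l : ℕ → ℕ}
    {R : List Bool → List Bool → Prop} (B : Polynomial ℕ) (hL : InNP L)
    (hLW : ∀ p w, Ctrl.pairCode p w ∈ L ↔ Ext (W w) p)
    (hB : ∀ w, ∀ z ∈ W w, z.length ≤ B.eval w.length)
    (hl : (fun n => ((2 * (B.eval n + 1) : ℕ) : ℝ)) =O[atTop] fun n => (l n : ℝ))
    (hempty : ∀ w, W w = ∅ → R w [false])
    (hR : ∀ w, ∀ z ∈ W w, Greedy (W w) z → R w (output z)) : InFPNPQueries l R := by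
  refine ⟨L, machine, 2 * (B + 1) * (2 * .X + 3 * B + 7) + (B + 1) + (B + 1),
    fun n => 2 * (B.eval n + 1), hL, hl, fun w => ?_⟩
  obtain ⟨p, n, k, hn, hk, hp, hE, hG, hno, h⟩ := go_search (hLW · w) (hB w) (B.eval w.length) []
    0 (by simp) (.inr rfl) (by intro i hi; simp at hi)
  have h1 := go_accToOut (L := L) w [] [] p.reverse [] (0 + k)
  rw [List.reverse_reverse, List.length_reverse, List.append_nil] at h1
  obtain ⟨n', hn', h2⟩ := go_strip (L := L) w p [] [] [] (0 + k)
  have h3 := (h.trans h1).trans h2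
  set T := (2 * (B + 1) * (2 * .X + 3 * B + 7) + (B + 1) + (B + 1) : Polynomial ℕ).eval w.length
    with hT
  have hle : n + (p.length + 1) + n' ≤ T := by
    rw [hT]
    simp only [Polynomial.eval_add, Polynomial.eval_mul, Polynomial.eval_X, Polynomial.eval_one,
      Polynomial.eval_ofNat]
    omega
  obtain ⟨r, hr⟩ := Nat.exists_eq_add_of_le hle
  have h4 := h3.trans (go_done (L := L) _ rfl r)
  rw [← hr] at h4
  have hrun : machine.run L w T = conf .done w (output p) [] [] [] (0 + k) := by
    rw [← h4]
    unfold OracleTM.run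
    congr 1
    simp only [Config.init, conf, Prod.mk.injEq, and_true]
    congr 1
    funext k
    cases k <;> rfl
  rw [hrun]
  refine ⟨rfl, ?_, by simpa [conf] using hk⟩
  change R w (output p)
  rcases (W w).eq_empty_or_nonempty with hW | ⟨z₀, hz₀⟩
  · rcases hE with ⟨z, hz, -⟩ | rfl
    · simp [hW] at hz
    · exact hempty w hW
  · have hE' : Ext (W w) p := by
      rcases hE with h | rfl
      · exact h
      · exact ⟨z₀, hz₀, List.nil_prefix⟩
    obtain ⟨z, hz, r, rfl⟩ := hE'
    rcases r with _ | ⟨b, r⟩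
    · rw [List.append_nil] at hz
      exact hR w p hz hG
    · exact absurd ⟨_, hz, ⟨r, by simp⟩⟩ (hno b)

end PrefixSearch

namespace Prog

variable {K : Type} [DecidableEq K] {N : ℕ}

/-! ### Loops -/

/-- `j + 1` nested loops: at most `N ^ (j + 1)` iterations. -/
def nestedStar (c : Prog K) : ℕ → Prog K
  | 0 => star c
  | j + 1 => star (nestedStar c j)

/-- A loop with at most `N ^ 8` iterations. -/
def many (c : Prog K) : Prog K := nestedStar c 7

theorem Iter.split {α : Type} {R : α → α → Prop} {m n : ℕ} {s u : α} (h : Iter R (m + n) s u) :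
    ∃ t, Iter R m s t ∧ Iter R n t u := by
  induction m generalizing s with
  | zero => exact ⟨s, rfl, by simpa using h⟩
  | succ m ih =>
    rw [Nat.add_right_comm] at h
    obtain ⟨v, h1, h2⟩ := h
    obtain ⟨t, h3, h4⟩ := ih h2
    exact ⟨t, ⟨v, h1, h3⟩, h4⟩

theorem rel_nestedStar {c : Prog K} {j : ℕ} {s s' : Store K} (k : ℕ) (hk : k ≤ N ^ (j + 1)) :
    Iter (c.Rel N) k s s' → (c.nestedStar j).Rel N s s' := by
  induction j generalizing k s s' with
  | zero => exact fun h => ⟨k, by simpa using hk, h⟩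
  | succ j ih =>
    intro h
    have key : ∀ (n k : ℕ) (s : Store K), k ≤ n * N ^ (j + 1) → Iter (c.Rel N) k s s' →
        ∃ m ≤ n, Iter ((c.nestedStar j).Rel N) m s s' := by
      intro n
      induction n with
      | zero =>
        intro k s hk h
        obtain rfl : k = 0 := by simpa using hk
        exact ⟨0, le_rfl, h⟩
      | succ n ihn =>
        intro k s hk h
        rcases le_total k (N ^ (j + 1)) with hle | hle
        · exact ⟨1, by omega, s', ih k hle h, rfl⟩
        · obtain ⟨d, rfl⟩ := Nat.exists_eq_add_of_le hle
          obtain ⟨t, h1, h2⟩ := Iter.split h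
          rw [Nat.succ_mul] at hk
          obtain ⟨m, hm, h3⟩ := ihn d t (by omega) h2
          exact ⟨m + 1, by omega, t, ih _ le_rfl h1, h3⟩
    exact key N k s (by rw [pow_succ'] at hk; exact hk) h

theorem reflTransGen_of_iter {α : Type} {R : α → α → Prop} {m : ℕ} {s t : α} (h : Iter R m s t) :
    Relation.ReflTransGen R s t := by
  induction m generalizing s with
  | zero => obtain rfl := h; exact .refl
  | succ m ih =>
    obtain ⟨u, h1, h2⟩ := h
    exact .head h1 (ih h2)

theorem reflTransGen_of_rel_nestedStar {c : Prog K} {j : ℕ} {s s' : Store K}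
    (h : (c.nestedStar j).Rel N s s') : Relation.ReflTransGen (c.Rel N) s s' := by
  induction j generalizing s s' with
  | zero =>
    obtain ⟨m, -, h⟩ := h
    exact reflTransGen_of_iter h
  | succ j ih =>
    obtain ⟨m, -, h⟩ := h
    have h' := reflTransGen_of_iter h
    clear h
    induction h' with
    | refl => exact .refl
    | tail _ h1 h2 => exact h2.trans (ih h1)

/-- A loop that makes a quantity of size at most `N ^ 8` smaller in each iteration can be iterated
as often as possible. -/
theorem rel_many_iff {c : Prog K} (I : Store K → Prop) (μ : Store K → ℕ)
    (hc : ∀ s s', I s → c.Rel N s s' → I s' ∧ μ s' < μ s) {s s' : Store K} (hs : I s)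
    (hμ : μ s ≤ N ^ 8) :
    (many c).Rel N s s' ↔ Relation.ReflTransGen (c.Rel N) s s' := by
  refine ⟨reflTransGen_of_rel_nestedStar, fun h => ?_⟩
  obtain ⟨m, hm, h⟩ : ∃ m ≤ μ s, Iter (c.Rel N) m s s' := by
    clear hμ
    induction h using Relation.ReflTransGen.head_induction_on with
    | refl => exact ⟨0, Nat.zero_le _, rfl⟩
    | head h _ ih =>
      obtain ⟨h1, h2⟩ := hc _ _ hs h
      obtain ⟨m, hm, h3⟩ := ih h1
      exact ⟨m + 1, by omega, _, h, h3⟩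
  exact rel_nestedStar m (hm.trans hμ) h

/-! ### Programs that read a code from a stack -/

/-- The program does nothing. -/
def skip : Prog K := emit true []

/-- Choose one of finitely many programs. -/
def altFin {n : ℕ} (f : Fin n → Prog K) : Prog K :=
  (List.finRange n).foldr (fun i c => alt (f i) c) fail

theorem rel_altFin {n : ℕ} {f : Fin n → Prog K} {s s' : Store K} :
    (altFin f).Rel N s s' ↔ ∃ i, (f i).Rel N s s' := by
  have : ∀ l : List (Fin n), ((l.foldr (fun i c => alt (f i) c) fail).Rel N s s') ↔
      ∃ i ∈ l, (f i).Rel N s s' := by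
    intro l
    induction l with
    | nil => simp [Rel]
    | cons i l ih => simp [Rel, ih]
  simpa [altFin] using this (List.finRange n)

@[simp]
theorem rel_skip {s s' : Store K} : (skip : Prog K).Rel N s s' ↔ s' = s := by
  simp only [skip, Rel]
  have : s.emit [] true = s := by funext k; simp [Store.emit]
  rw [this]

end Prog

/-- The store in which `r` is left on stack `a` and the string `o k` has been pushed, bit by bit, on
every other stack `k`. -/
def Store.out {K : Type} [DecidableEq K] (s : Store K) (a : K) (r : List Bool)
    (o : K → List Bool) : Store K :=
  fun k => if k = a then r else (o k).reverse ++ s k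

/-- The string `l` for each stack of the list `bs`. -/
def onto {K : Type} [DecidableEq K] (bs : List K) (l : List Bool) : K → List Bool :=
  fun k => if k ∈ bs then l else []

section

variable {K : Type} [DecidableEq K]

@[simp]
theorem Store.out_self (s : Store K) (a : K) (r : List Bool) (o : K → List Bool) :
    s.out a r o a = r := by simp [Store.out]

theorem Store.out_of_ne (s : Store K) {a k : K} (h : k ≠ a) (r : List Bool)
    (o : K → List Bool) : s.out a r o k = (o k).reverse ++ s k := by simp [Store.out, h]

theorem Store.out_out (s : Store K) (a : K) (r r' : List Bool) (o o' : K → List Bool) :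
    (s.out a r o).out a r' o' = s.out a r' (fun k => o k ++ o' k) := by
  funext k
  by_cases h : k = a <;> simp [Store.out, h]

theorem Store.out_nil (s : Store K) (a : K) : s.out a (s a) (fun _ => []) = s := by
  funext k
  by_cases h : k = a <;> simp [Store.out, h]

theorem onto_append (bs : List K) (l l' : List Bool) (k : K) :
    onto bs l k ++ onto bs l' k = onto bs (l ++ l') k := by
  by_cases h : k ∈ bs <;> simp [onto, h]

end

/-- On stores that satisfy `I`, the program `c` takes the code `e v` of some `v` with `P v` from
stack `a` and pushes `o v k` on every other stack `k`, and it can do so for every such `v`. -/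
def Parses {K : Type} [DecidableEq K] {α : Type} (N : ℕ) (I : Store K → Prop) (c : Prog K) (a : K)
    (e : α → List Bool) (P : α → Prop) (o : α → K → List Bool) : Prop :=
  ∀ s s', I s → (c.Rel N s s' ↔ ∃ v r, P v ∧ s a = e v ++ r ∧ s' = s.out a r (o v))

namespace Parses

open Prog

variable {K : Type} [DecidableEq K] {N : ℕ} {α β : Type} {I I' : Store K → Prop} {c d : Prog K}
  {a : K} {e : α → List Bool} {P : α → Prop} {o : α → K → List Bool}
  {e' : β → List Bool} {P' : β → Prop} {o' : β → K → List Bool}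

theorem mono (h : Parses N I c a e P o) (hI : ∀ s, I' s → I s) : Parses N I' c a e P o :=
  fun s s' hs => h s s' (hI s hs)

theorem retype (h : Parses N I c a e P o) (f : α → β) (hf : f.Surjective) (he : ∀ v, e' (f v) = e v)
    (hP : ∀ v, P' (f v) ↔ P v) (ho : ∀ v k, k ≠ a → o' (f v) k = o v k) :
    Parses N I c a e' P' o' := by
  intro s s' hs
  rw [h s s' hs]
  constructor
  · rintro ⟨v, r, h1, h2, rfl⟩
    refine ⟨f v, r, (hP v).2 h1, by rw [he, h2], ?_⟩
    funext k
    by_cases hk : k = a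
    · simp [Store.out, hk]
    · simp [Store.out, hk, ho v k hk]
  · rintro ⟨w, r, h1, h2, rfl⟩
    obtain ⟨v, rfl⟩ := hf w
    refine ⟨v, r, (hP v).1 h1, by rw [← he, h2], ?_⟩
    funext k
    by_cases hk : k = a
    · simp [Store.out, hk]
    · simp [Store.out, hk, ho v k hk]

theorem congr_out {o'' : α → K → List Bool} (h : Parses N I c a e P o)
    (ho : ∀ v k, k ≠ a → o'' v k = o v k) : Parses N I c a e P o'' :=
  h.retype id Function.surjective_id (fun _ => rfl) (fun _ => Iff.rfl) ho

theorem shift (a : K) (b : Bool) (bs : List K) :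
    Parses N I (.shift a b bs) a (fun _ : Unit => [b]) (fun _ => True)
      (fun _ => onto bs [b]) := by
  intro s s' _
  have e : s.shift a bs b = s.out a (s a).tail (onto bs [b]) := by
    funext k
    by_cases hk : k = a
    · simp [Store.shift, Store.out, hk]
    · by_cases hb : k ∈ bs <;> simp [Store.shift, Store.out, onto, hk, hb]
  simp only [Prog.Rel, e, exists_const, true_and]
  constructor
  · rintro ⟨h, rfl⟩
    refine ⟨(s a).tail, ?_, rfl⟩
    cases h' : s a <;> simp_all
  · rintro ⟨r, h, rfl⟩
    simp [h]

theorem emit {a : K} (b : Bool) {bs : List K} (ha : a ∉ bs) :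
    Parses N I (.emit b bs) a (fun _ : Unit => []) (fun _ => True) (fun _ => onto bs [b]) := by
  intro s s' _
  have e : s.emit bs b = s.out a (s a) (onto bs [b]) := by
    funext k
    by_cases hk : k = a
    · subst hk; simp [Store.emit, Store.out, ha]
    · by_cases hb : k ∈ bs <;> simp [Store.emit, Store.out, onto, hk, hb]
  simp [Prog.Rel, e]

theorem skip (a : K) :
    Parses N I (skip : Prog K) a (fun _ : Unit => []) (fun _ => True) (fun _ _ => []) := by
  intro s s' _
  simp [Store.out_nil]

theorem seq (h : Parses N I c a e P o) (h' : Parses N I' d a e' P' o')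
    (hI : ∀ s v r, I s → P v → s a = e v ++ r → I' (s.out a r (o v))) :
    Parses N I (.seq c d) a (fun v : α × β => e v.1 ++ e' v.2) (fun v => P v.1 ∧ P' v.2)
      (fun v k => o v.1 k ++ o' v.2 k) := by
  intro s s' hs
  constructor
  · rintro ⟨t, h1, h2⟩
    obtain ⟨v, r, hv, hr, rfl⟩ := (h s t hs).1 h1
    obtain ⟨w, r', hw, hr', rfl⟩ := (h' _ _ (hI s v r hs hv hr)).1 h2
    rw [Store.out_self] at hr'
    exact ⟨(v, w), r', ⟨hv, hw⟩, by rw [hr, hr', List.append_assoc], Store.out_out ..⟩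
  · rintro ⟨⟨v, w⟩, r', ⟨hv, hw⟩, hr, rfl⟩
    rw [List.append_assoc] at hr
    refine ⟨s.out a (e' w ++ r') (o v), (h s _ hs).2 ⟨v, _, hv, hr, rfl⟩, ?_⟩
    refine (h' _ _ (hI s v _ hs hv hr)).2 ⟨w, r', hw, Store.out_self .., (Store.out_out ..).symm⟩

theorem alt (h : Parses N I c a e P o) (h' : Parses N I d a e' P' o') :
    Parses N I (.alt c d) a (Sum.elim e e') (Sum.elim P P') (Sum.elim o o') := by
  intro s s' hs
  simp only [Prog.Rel]
  rw [h s s' hs, h' s s' hs, Sum.exists]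
  rfl

theorem altFin {n : ℕ} {f : Fin n → Prog K} {α : Fin n → Type} {e : ∀ i, α i → List Bool}
    {P : ∀ i, α i → Prop} {o : ∀ i, α i → K → List Bool}
    (h : ∀ i, Parses N I (f i) a (e i) (P i) (o i)) :
    Parses N I (Prog.altFin f) a (fun v : Σ i, α i => e v.1 v.2) (fun v => P v.1 v.2)
      (fun v => o v.1 v.2) := by
  intro s s' hs
  rw [rel_altFin]
  constructor
  · rintro ⟨i, hi⟩
    obtain ⟨v, r, h1⟩ := (h i s s' hs).1 hi
    exact ⟨⟨i, v⟩, r, h1⟩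
  · rintro ⟨⟨i, v⟩, r, h1⟩
    exact ⟨i, (h i s s' hs).2 ⟨v, r, h1⟩⟩

/-- A loop around a parser reads a sequence of codes. As no code is empty, each round shortens stack
`a`, so the bound on the number of rounds does no harm. -/
theorem many (h : Parses N I c a e P o) (he : ∀ v, e v ≠ [])
    (hI : ∀ s v r, I s → P v → s a = e v ++ r → I (s.out a r (o v)))
    (hN : ∀ s, I s → (s a).length ≤ N ^ 8) :
    Parses N I (many c) a (fun l : List α => l.flatMap e) (fun l => ∀ v ∈ l, P v)
      (fun l k => l.flatMap fun v => o v k) := by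
  intro s s' hs
  rw [rel_many_iff I (fun s => (s a).length) _ hs (hN s hs)]
  · constructor
    · intro hr
      induction hr using Relation.ReflTransGen.head_induction_on with
      | refl => exact ⟨[], _, by simp, rfl, by simp [Store.out_nil]⟩
      | head h1 _ ih =>
        obtain ⟨v, r, hv, hr, rfl⟩ := (h _ _ hs).1 h1
        obtain ⟨l, r', hl, hr', rfl⟩ := ih (hI _ v r hs hv hr)
        rw [Store.out_self] at hr'
        exact ⟨v :: l, r', by simpa using ⟨hv, hl⟩, by simp [hr, hr'], by
          rw [Store.out_out]; simp⟩
    · rintro ⟨l, r, hl, hr, rfl⟩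
      induction l generalizing s with
      | nil =>
        simp only [List.flatMap_nil, List.nil_append] at hr ⊢
        rw [← hr, Store.out_nil]
      | cons v l ih =>
        simp only [List.flatMap_cons, List.append_assoc] at hr
        have hv : P v := hl v (by simp)
        refine .head ((h _ _ hs).2 ⟨v, _, hv, hr, rfl⟩) ?_
        have := ih _ (hI s v _ hs hv hr) (fun v hv => hl v (by simp [hv])) (by
          rw [Store.out_self])
        rw [Store.out_out] at this
        simpa using this
  · intro s t hs h1
    obtain ⟨v, r, hv, hr, rfl⟩ := (h s t hs).1 h1
    refine ⟨hI s v r hs hv hr, ?_⟩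
    have := List.length_pos_of_ne_nil (he v)
    rw [Store.out_self, hr, List.length_append]
    omega

end Parses

section

variable {K : Type} [DecidableEq K]

/-- The condition `I` on stores persists when something is popped from stack `a` and something is
pushed on stacks in `S`. -/
def Stable (I : Store K → Prop) (a : K) (S : Set K) : Prop :=
  ∀ s r o, I s → r.length ≤ (s a).length → (∀ k ∉ S, o k = []) → I (s.out a r o)

theorem Stable.out {I : Store K → Prop} {a : K} {S : Set K} (h : Stable I a S) {s : Store K}
    {l r : List Bool} {o : K → List Bool} (hs : I s) (hr : s a = l ++ r)
    (ho : ∀ k ∉ S, o k = []) : I (s.out a r o) :=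
  h s r o hs (by simp [hr]) ho

theorem onto_eq_nil {bs : List K} {S : Set K} (h : ∀ k ∈ bs, k ∈ S) (l : List Bool) :
    ∀ k ∉ S, onto bs l k = [] := by
  intro k hk
  simp only [onto, ite_eq_right_iff]
  exact fun h' => absurd (h k h') hk

/-- The stack `a` is short enough for the loops that go through it. -/
def Short (N : ℕ) (a : K) (s : Store K) : Prop := (s a).length ≤ N ^ 8

theorem stable_short (N : ℕ) (a : K) (S : Set K) : Stable (Short N a) a S := by
  intro s r o hs hr _
  rw [Short, Store.out_self]
  exact hr.trans hs

end

namespace Prog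

variable {K : Type}

/-- Repeat a program `k` times. -/
def rep (k : ℕ) (c : Prog K) : Prog K :=
  match k with
  | 0 => skip
  | k + 1 => seq c (rep k c)

/-- Pop the string `l` and move it to the stacks `bs`. -/
def readStr (a : K) (bs : List K) : List Bool → Prog K
  | [] => skip
  | b :: l => seq (shift a b bs) (readStr a bs l)

/-- Pop a list, whose entries are read by `c`. -/
def readList (a : K) (bs : List K) (c : Prog K) : Prog K :=
  seq (many (seq (shift a true bs) c)) (shift a false bs)

/-- Pop one bit and move it to the stacks `bs`. -/
def readBit (a : K) (bs : List K) : Prog K := alt (shift a true bs) (shift a false bs)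

/-- Pop the code of a number. The last digit of a nonzero number is `1`. -/
def readNat (a : K) (bs : List K) : Prog K :=
  alt (shift a false bs)
    (seq (many (seq (shift a true bs) (readBit a bs))) (readStr a bs [true, true, false]))

end Prog

namespace Parses

open Prog

variable {K : Type} [DecidableEq K] {N : ℕ} {α β : Type} {I I' : Store K → Prop} {c d : Prog K}
  {a : K} {e : α → List Bool} {P : α → Prop} {o : α → K → List Bool}
  {e' : β → List Bool} {P' : β → Prop} {o' : β → K → List Bool} {S : Set K}

theorem seqS (hS : Stable I a S) (h : Parses N I c a e P o) (h' : Parses N I d a e' P' o')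
    (ho : ∀ v, ∀ k ∉ S, o v k = []) :
    Parses N I (.seq c d) a (fun v : α × β => e v.1 ++ e' v.2) (fun v => P v.1 ∧ P' v.2)
      (fun v k => o v.1 k ++ o' v.2 k) :=
  h.seq h' fun _ v _ hs _ hr => hS.out hs hr (ho v)

theorem rep (hS : Stable I a S) (h : Parses N I c a e P o) (ho : ∀ v, ∀ k ∉ S, o v k = [])
    (n : ℕ) :
    Parses N I (rep n c) a (fun t : Fin n → α => (List.ofFn t).flatMap e) (fun t => ∀ i, P (t i))
      (fun t k => (List.ofFn t).flatMap fun v => o v k) := by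
  induction n with
  | zero =>
    refine (Parses.skip a).retype (fun _ => Fin.elim0) (fun t => ⟨(), funext fun i => i.elim0⟩) ?_
      ?_ ?_ <;> simp
  | succ n ih =>
    refine (h.seqS hS ih ho).retype (fun v => Fin.cons v.1 v.2)
      (fun t => ⟨(t 0, Fin.tail t), Fin.cons_self_tail t⟩) ?_ ?_ ?_
    · simp [List.ofFn_succ]
    · simp [Fin.forall_fin_succ]
    · simp [List.ofFn_succ]

theorem readStr (hS : Stable I a S) {bs : List K} (hb : ∀ k ∈ bs, k ∈ S) (l : List Bool) :
    Parses N I (readStr a bs l) a (fun _ : Unit => l) (fun _ => True) (fun _ => onto bs l) := by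
  induction l with
  | nil => exact (Parses.skip a).congr_out (by simp [onto])
  | cons b l ih =>
    refine ((Parses.shift a b bs).seqS hS ih fun _ => onto_eq_nil hb _).retype (fun _ => ())
      (fun _ => ⟨((), ()), rfl⟩) ?_ ?_ ?_ <;> simp [onto_append]

theorem readBit (bs : List K) :
    Parses N I (readBit a bs) a (fun b : Bool => [b]) (fun _ => True) (fun b => onto bs [b]) := by
  refine ((Parses.shift a true bs).alt (Parses.shift a false bs)).retype
    (Sum.elim (fun _ => true) (fun _ => false)) ?_ ?_ ?_ ?_
  · rintro (_ | _)
    exacts [⟨.inr (), rfl⟩, ⟨.inl (), rfl⟩]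
  all_goals simp

theorem readList (hS : Stable I a S) (hI : ∀ s, I s → Short N a s) {bs : List K}
    (hb : ∀ k ∈ bs, k ∈ S) (h : Parses N I c a e P o) (ho : ∀ v, ∀ k ∉ S, o v k = []) :
    Parses N I (readList a bs c) a (encList e) (fun l => ∀ v ∈ l, P v)
      (fun l k => (l.flatMap fun v => onto bs [true] k ++ o v k) ++ onto bs [false] k) := by
  have h1 := (Parses.shift (N := N) a true bs).seqS hS h fun _ => onto_eq_nil hb _
  have h2 : Parses N I (.seq (.shift a true bs) c) a (fun v => true :: e v) P
      (fun v k => onto bs [true] k ++ o v k) :=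
    h1.retype Prod.snd (fun v => ⟨((), v), rfl⟩) (by simp) (by simp) (by simp)
  have ho' : ∀ v, ∀ k ∉ S, onto bs [true] k ++ o v k = [] := by
    intro v k hk
    rw [onto_eq_nil hb _ k hk, ho v k hk, List.append_nil]
  have h3 := h2.many (by simp) (fun s v r hs _ hr => hS.out hs hr (ho' v)) hI
  refine (h3.seqS hS (Parses.shift a false bs) ?_).retype Prod.fst (fun v => ⟨(v, ()), rfl⟩)
    ?_ ?_ ?_
  · intro l k hk
    simp [ho' _ k hk]
  all_goals simp [encList]

/-- The special case of `readList` in which the program for the entries copies them. -/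
theorem readList_copy (hS : Stable I a S) (hI : ∀ s, I s → Short N a s) {bs : List K}
    (hb : ∀ k ∈ bs, k ∈ S) (h : Parses N I c a e P (fun v => onto bs (e v))) :
    Parses N I (Prog.readList a bs c) a (encList e) (fun l => ∀ v ∈ l, P v)
      (fun l => onto bs (encList e l)) := by
  refine (h.readList hS hI hb fun v => onto_eq_nil hb _).congr_out ?_
  intro l k _
  by_cases hk : k ∈ bs <;> simp [onto, hk, encList]

end Parses

theorem Nat.bits_eq_nil_or (n : ℕ) : n.bits = [] ∨ ∃ l, n.bits = l ++ [true] := by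
  induction n using Nat.binaryRec' with
  | zero => simp
  | bit b n hn ih =>
    rw [Nat.bits_append_bit n b hn]
    right
    rcases ih with h | ⟨l, h⟩
    · have : n = 0 := by
        have := Nat.size_eq_bits_len n
        rw [h] at this
        exact Nat.size_eq_zero.1 this.symm
      exact ⟨[], by simp [h, hn this]⟩
    · exact ⟨b :: l, by simp [h]⟩

theorem Nat.exists_bits_eq (l : List Bool) : ∃ n : ℕ, n.bits = l ++ [true] := by
  induction l with
  | nil => exact ⟨1, by simp⟩
  | cons b l ih =>
    obtain ⟨n, hn⟩ := ih
    refine ⟨Nat.bit b n, ?_⟩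
    rw [Nat.bits_append_bit n b, hn, List.cons_append]
    rintro rfl
    simp at hn

namespace Parses

open Prog

variable {K : Type} [DecidableEq K] {N : ℕ} {I : Store K → Prop} {a : K} {S : Set K}

theorem readNat (hS : Stable I a S) (hI : ∀ s, I s → Short N a s) {bs : List K}
    (hb : ∀ k ∈ bs, k ∈ S) :
    Parses N I (readNat a bs) a encNat (fun _ => True) (fun n => onto bs (encNat n)) := by
  have h1 : Parses N I (.seq (.shift a true bs) (Prog.readBit a bs)) a (fun b => [true, b])
      (fun _ => True) (fun b => onto bs [true, b]) :=
    ((Parses.shift (N := N) a true bs).seqS hS (readBit bs) fun _ => onto_eq_nil hb _).retype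
      Prod.snd (fun v => ⟨((), v), rfl⟩) (by simp) (by simp) (by simp [onto_append])
  have h2 := h1.many (by simp) (fun s v r hs _ hr => hS.out hs hr (onto_eq_nil hb _)) hI
  have h3 := h2.seqS hS (readStr hS hb [true, true, false]) (by
    intro l k hk; simp [onto_eq_nil hb _ k hk])
  have h4 := (Parses.shift (N := N) (I := I) a false bs).alt h3
  intro s s' hs
  rw [Prog.readNat, h4 s s' hs]
  have hout : ∀ (l : List Bool) (k : K), (l.flatMap fun b => onto bs [true, b] k) ++
      onto bs [true, true, false] k = onto bs ((l ++ [true]).flatMap (fun b => [true, b]) ++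
        [false]) k := by
    intro l k
    by_cases hk : k ∈ bs <;> simp [onto, hk]
  constructor
  · rintro ⟨(v | ⟨l, ⟨⟩⟩), r, -, hr, rfl⟩
    · exact ⟨0, r, trivial, by simpa [encNat] using hr, by simp [encNat]⟩
    · obtain ⟨n, hn⟩ := Nat.exists_bits_eq l
      refine ⟨n, r, trivial, by simpa [encNat, hn] using hr, ?_⟩
      simp only [Sum.elim_inr, hout, encNat, hn]
  · rintro ⟨n, r, -, hr, rfl⟩
    rcases n.bits_eq_nil_or with hn | ⟨l, hn⟩
    · exact ⟨.inl (), r, trivial, by simpa [encNat, hn] using hr, by simp [encNat, hn]⟩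
    · refine ⟨.inr (l, ()), r, by simp, by simpa [encNat, hn] using hr, ?_⟩
      simp only [Sum.elim_inr, hout, encNat, hn]

end Parses

namespace Prog

variable {K : Type}

/-! ### Operations on whole stacks -/

/-- Move the contents of stack `a` to the stacks `bs`, reversing it. -/
def moveAll (a : K) (bs : List K) : Prog K := seq (many (readBit a bs)) (empty a)

/-- Push a copy of stack `x` on stack `g`; the stack `x'` is used in between. -/
def copy (x x' g : K) : Prog K := seq (moveAll x [x']) (moveAll x' [x, g])

/-- Pop equal bits from `x` and `y`. -/
def syncs (x y : K) : Prog K :=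
  many (alt (seq (shift x true []) (shift y true [])) (seq (shift x false []) (shift y false [])))

/-- Check that the stacks `x` and `y` are equal, and clear them. -/
def assertEq (x y : K) : Prog K := seq (syncs x y) (seq (empty x) (empty y))

/-- Check that the tops of the stacks `x` and `y` are different. -/
def assertTopNe (x y : K) : Prog K :=
  alt (alt (seq (shift x true []) (shift y false [])) (seq (shift x false []) (shift y true [])))
    (alt (seq (empty x) (readBit y [])) (seq (empty y) (readBit x [])))

/-- Check that the stacks `x` and `y` are different, and clear them. -/
def assertNe (x y : K) : Prog K :=
  seq (syncs x y) (seq (assertTopNe x y) (seq (moveAll x []) (moveAll y [])))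

variable [DecidableEq K] {N : ℕ} {s s' : Store K}

theorem rel_seq {c d : Prog K} : (seq c d).Rel N s s' ↔ ∃ t, c.Rel N s t ∧ d.Rel N t s' := Iff.rfl

theorem rel_alt {c d : Prog K} : (alt c d).Rel N s s' ↔ c.Rel N s s' ∨ d.Rel N s s' := Iff.rfl

theorem rel_moveAll {a : K} {bs : List K} (h : Short N a s) :
    (moveAll a bs).Rel N s s' ↔ s' = s.out a [] (onto bs (s a)) := by
  have h1 := (Parses.readBit (N := N) (I := Short N a) (a := a) bs).many (by simp)
    (fun s v r hs _ hr => (stable_short N a Set.univ).out hs hr (by simp)) (fun _ h => h)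
  simp only [moveAll, Rel, h1 s _ h]
  constructor
  · rintro ⟨t, ⟨l, r, -, hr, rfl⟩, hn, rfl⟩
    rw [Store.out_self] at hn
    subst hn
    have e : s a = l := by simpa using hr
    rw [e]
    congr 1
    funext k
    by_cases hk : k ∈ bs <;> simp [onto, hk]
  · rintro rfl
    refine ⟨_, ⟨s a, [], by simp, by simp, rfl⟩, Store.out_self .., ?_⟩
    congr 1
    funext k
    by_cases hk : k ∈ bs <;> simp [onto, hk]

theorem rel_clear {a : K} (h : Short N a s) :
    (moveAll a []).Rel N s s' ↔ s' = Function.update s a [] := by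
  rw [rel_moveAll h]
  have : s.out a [] (onto [] (s a)) = Function.update s a [] := by
    funext k
    by_cases hk : k = a
    · subst hk; simp [Store.out]
    · simp [Store.out, onto, hk]
  rw [this]

/-- Moving the contents of the auxiliary stack `p'` back to `p`. -/
theorem rel_rewind {p p' : K} (hp : p ≠ p') (h : Short N p' s) :
    (moveAll p' [p]).Rel N s s' ↔
      s' = Function.update (Function.update s p ((s p').reverse ++ s p)) p' [] := by
  rw [rel_moveAll h]
  have : s.out p' [] (onto [p] (s p')) =
      Function.update (Function.update s p ((s p').reverse ++ s p)) p' [] := by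
    funext k
    by_cases hk : k = p'
    · subst hk; simp [Store.out]
    · by_cases hk' : k = p
      · subst hk'; simp [Store.out, onto, hk]
      · simp [Store.out, onto, hk, hk']
  rw [this]

theorem rel_copy {x x' g : K} (hx : x ≠ x') (hg : x ≠ g) (hg' : x' ≠ g) (h : Short N x s)
    (h' : s x' = []) :
    (copy x x' g).Rel N s s' ↔ s' = Function.update s g (s x ++ s g) := by
  simp only [copy, Rel, rel_moveAll h, exists_eq_left]
  have e : s.out x [] (onto [x'] (s x)) x' = (s x).reverse := by
    simp [Store.out, hx.symm, onto, h']
  rw [rel_moveAll (by rw [Short, e, List.length_reverse]; exact h), e]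
  have : (s.out x [] (onto [x'] (s x))).out x' [] (onto [x, g] (s x).reverse) =
      Function.update s g (s x ++ s g) := by
    funext k
    by_cases hk : k = x'
    · subst hk; simp [Store.out, h', hg']
    · by_cases hk' : k = x
      · subst hk'; simp [Store.out, onto, hk, hg]
      · by_cases hk'' : k = g
        · subst hk''; simp [Store.out, onto, hk, hk']
        · simp [Store.out, onto, hk, hk', hk'']
  rw [this]

theorem rel_shift_nil {a : K} {b : Bool} :
    (shift a b []).Rel N s s' ↔ ∃ l, s a = b :: l ∧ s' = Function.update s a l := by
  have e : s.shift a [] b = Function.update s a (s a).tail := by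
    funext k
    by_cases hk : k = a
    · subst hk; simp [Store.shift]
    · simp [Store.shift, hk]
  simp only [Rel, e]
  constructor
  · rintro ⟨h, rfl⟩
    refine ⟨(s a).tail, ?_, rfl⟩
    cases h' : s a <;> simp_all
  · rintro ⟨l, h, rfl⟩
    simp [h]

theorem rel_shift_shift {x y : K} (hxy : x ≠ y) {b b' : Bool} :
    (seq (shift x b []) (shift y b' [])).Rel N s s' ↔ ∃ l l', s x = b :: l ∧ s y = b' :: l' ∧
      s' = Function.update (Function.update s x l) y l' := by
  simp only [rel_seq, rel_shift_nil]
  constructor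
  · rintro ⟨_, ⟨l, h, rfl⟩, l', h', rfl⟩
    rw [Function.update_of_ne hxy.symm] at h'
    exact ⟨l, l', h, h', rfl⟩
  · rintro ⟨l, l', h, h', rfl⟩
    exact ⟨_, ⟨l, h, rfl⟩, l', by rwa [Function.update_of_ne hxy.symm], rfl⟩

theorem update_update_update {x y : K} (s : Store K) (l l' r r' : List Bool) :
    Function.update (Function.update (Function.update (Function.update s x l) y l') x r) y r' =
      Function.update (Function.update s x r) y r' := by
  funext k
  by_cases hk : k = y
  · subst hk; simp
  · by_cases hk' : k = x
    · subst hk'; simp [hk]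
    · simp [hk, hk']

/-- Popping equal tops removes some common prefix, not necessarily the longest one. -/
theorem rel_syncs {x y : K} (hxy : x ≠ y) (h : Short N x s) :
    (syncs x y).Rel N s s' ↔ ∃ p l l', s x = p ++ l ∧ s y = p ++ l' ∧
      s' = Function.update (Function.update s x l) y l' := by
  have hstep : ∀ s s' : Store K, (alt (seq (shift x true []) (shift y true []))
      (seq (shift x false []) (shift y false []))).Rel N s s' ↔
      ∃ b l l', s x = b :: l ∧ s y = b :: l' ∧
        s' = Function.update (Function.update s x l) y l' := by
    intro s s'
    rw [rel_alt, rel_shift_shift hxy, rel_shift_shift hxy]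
    constructor
    · rintro (h | h)
      exacts [⟨true, h⟩, ⟨false, h⟩]
    · rintro ⟨_ | _, h⟩
      exacts [.inr h, .inl h]
  rw [syncs, rel_many_iff (fun _ => True) (fun s => (s x).length) _ trivial h]
  · constructor
    · intro hr
      clear h
      induction hr using Relation.ReflTransGen.head_induction_on with
      | refl => exact ⟨[], _, _, rfl, rfl, by simp⟩
      | head h0 _ ih =>
        obtain ⟨b, l, l', h1, h2, rfl⟩ := (hstep _ _).1 h0
        obtain ⟨p, r, r', h3, h4, rfl⟩ := ih
        rw [Function.update_of_ne hxy, Function.update_self] at h3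
        rw [Function.update_self] at h4
        exact ⟨b :: p, r, r', by simp [h1, h3], by simp [h2, h4], update_update_update ..⟩
    · rintro ⟨p, l, l', h1, h2, rfl⟩
      clear h
      induction p generalizing s with
      | nil =>
        have : Function.update (Function.update s x l) y l' = s := by
          simp only [List.nil_append] at h1 h2
          rw [← h1, ← h2]; simp
        rw [this]
      | cons b p ih =>
        refine .head ((hstep _ _).2 ⟨b, _, _, h1, h2, rfl⟩) ?_
        have := ih (s := Function.update (Function.update s x (p ++ l)) y (p ++ l'))
          (by rw [Function.update_of_ne hxy, Function.update_self]) (by rw [Function.update_self])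
        rwa [update_update_update] at this
  · intro s s' _ h0
    obtain ⟨b, l, l', h1, h2, rfl⟩ := (hstep _ _).1 h0
    rw [Function.update_of_ne hxy, Function.update_self, h1]
    exact ⟨trivial, by simp⟩

theorem rel_assertEq {x y : K} (hxy : x ≠ y) (h : Short N x s) :
    (assertEq x y).Rel N s s' ↔
      s x = s y ∧ s' = Function.update (Function.update s x []) y [] := by
  simp only [assertEq, Rel, rel_syncs hxy h]
  constructor
  · rintro ⟨_, ⟨p, l, l', h1, h2, rfl⟩, _, ⟨h3, rfl⟩, h4, rfl⟩
    rw [Function.update_of_ne hxy, Function.update_self] at h3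
    rw [Function.update_self] at h4
    subst h3 h4
    exact ⟨h1.trans h2.symm, rfl⟩
  · rintro ⟨h1, rfl⟩
    refine ⟨_, ⟨s x, [], [], by simp, by simp [h1], rfl⟩, _, ⟨?_, rfl⟩, ?_, rfl⟩
    · rw [Function.update_of_ne hxy, Function.update_self]
    · rw [Function.update_self]

theorem rel_assertTopNe {x y : K} (hxy : x ≠ y) :
    (assertTopNe x y).Rel N s s' → (s x).head? ≠ (s y).head? ∧ (s' x).length ≤ (s x).length ∧
      (s' y).length ≤ (s y).length ∧ ∀ k, k ≠ x → k ≠ y → s' k = s k := by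
  have hbit : ∀ (y : K) (s s' : Store K), (readBit y []).Rel N s s' →
      ∃ b l, s y = b :: l ∧ s' = Function.update s y l := by
    intro y s s' h
    simp only [readBit, rel_alt, rel_shift_nil] at h
    rcases h with h | h
    exacts [⟨_, h⟩, ⟨_, h⟩]
  intro h
  simp only [assertTopNe, rel_alt, rel_shift_shift hxy] at h
  rcases h with (⟨l, l', h1, h2, rfl⟩ | ⟨l, l', h1, h2, rfl⟩) |
    (⟨t, ⟨h1, rfl⟩, h0⟩ | ⟨t, ⟨h1, rfl⟩, h0⟩)
  · refine ⟨by simp [h1, h2], by simp [h1, hxy], by simp [h2], fun k h h' => by simp [h, h']⟩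
  · refine ⟨by simp [h1, h2], by simp [h1, hxy], by simp [h2], fun k h h' => by simp [h, h']⟩
  · obtain ⟨b, l, h2, rfl⟩ := hbit _ _ _ h0
    refine ⟨by simp [h1, h2], by simp [hxy], by simp [h2], fun k h h' => by simp [h']⟩
  · obtain ⟨b, l, h2, rfl⟩ := hbit _ _ _ h0
    refine ⟨by simp [h1, h2], by simp [h2], by simp [hxy.symm], fun k h h' => by simp [h]⟩

theorem exists_rel_assertTopNe {x y : K} (hxy : x ≠ y) (h : (s x).head? ≠ (s y).head?) :
    ∃ s', (assertTopNe x y).Rel N s s' := by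
  have hbit : ∀ (y : K) (s : Store K) (b : Bool) (l : List Bool), s y = b :: l →
      (readBit y []).Rel N s (Function.update s y l) := by
    intro y s b l h
    simp only [readBit, rel_alt, rel_shift_nil]
    cases b
    exacts [.inr ⟨l, h, rfl⟩, .inl ⟨l, h, rfl⟩]
  simp only [assertTopNe, rel_alt, rel_shift_shift hxy]
  rcases h1 : s x with _ | ⟨b, l⟩ <;> rcases h2 : s y with _ | ⟨b', l'⟩
  · simp [h1, h2] at h
  · exact ⟨_, .inr (.inl ⟨s, ⟨h1, rfl⟩, hbit y s b' l' h2⟩)⟩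
  · exact ⟨_, .inr (.inr ⟨s, ⟨h2, rfl⟩, hbit x s b l h1⟩)⟩
  · rw [h1, h2] at h
    cases b <;> cases b'
    · simp at h
    · exact ⟨_, .inl (.inr ⟨l, l', rfl, rfl, rfl⟩)⟩
    · exact ⟨_, .inl (.inl ⟨l, l', rfl, rfl, rfl⟩)⟩
    · simp at h

theorem exists_common_prefix : ∀ {l l' : List Bool}, l ≠ l' →
    ∃ p r r', l = p ++ r ∧ l' = p ++ r' ∧ r.head? ≠ r'.head?
  | [], [], h => absurd rfl h
  | [], b :: l, _ => ⟨[], [], b :: l, rfl, rfl, by simp⟩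
  | b :: l, [], _ => ⟨[], b :: l, [], rfl, rfl, by simp⟩
  | b :: l, b' :: l', h => by
    by_cases hb : b = b'
    · subst hb
      obtain ⟨p, r, r', rfl, rfl, h'⟩ := exists_common_prefix (l := l) (l' := l')
        fun e => h (by rw [e])
      exact ⟨b :: p, r, r', rfl, rfl, h'⟩
    · exact ⟨[], b :: l, b' :: l', rfl, rfl, by simpa using hb⟩

theorem rel_assertNe {x y : K} (hxy : x ≠ y) (hx : Short N x s) (hy : Short N y s) :
    (assertNe x y).Rel N s s' ↔
      s x ≠ s y ∧ s' = Function.update (Function.update s x []) y [] := by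
  -- what remains after a common prefix has been removed and the tops have been found different
  have hlast : ∀ (t u : Store K) (p l l' : List Bool), s x = p ++ l → s y = p ++ l' →
      t = Function.update (Function.update s x l) y l' → (assertTopNe x y).Rel N t u →
      ((seq (moveAll x []) (moveAll y [])).Rel N u s' ↔
        s' = Function.update (Function.update s x []) y []) := by
    rintro t u p l l' h1 h2 rfl h
    obtain ⟨-, h3, h4, h5⟩ := rel_assertTopNe hxy h
    have h6 : Short N x u := by
      refine (h3.trans ?_).trans hx
      simp [hxy, h1]
    have h7 : Short N y (Function.update u x []) := by
      rw [Short, Function.update_of_ne hxy.symm]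
      refine (h4.trans ?_).trans hy
      simp [h2]
    simp only [Rel, rel_clear h6, exists_eq_left, rel_clear h7]
    have : Function.update (Function.update u x []) y [] =
        Function.update (Function.update s x []) y [] := by
      funext k
      by_cases hk : k = y
      · subst hk; simp
      · by_cases hk' : k = x
        · subst hk'; simp [hk]
        · simp [hk, hk', h5 k hk' hk]
    rw [this]
  simp only [assertNe, rel_seq (c := syncs x y), rel_syncs hxy hx, rel_seq (c := assertTopNe x y)]
  constructor
  · rintro ⟨t, ⟨p, l, l', h1, h2, rfl⟩, u, h3, h4⟩
    refine ⟨?_, (hlast _ u p l l' h1 h2 rfl h3).1 h4⟩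
    have := (rel_assertTopNe hxy h3).1
    rw [Function.update_of_ne hxy, Function.update_self, Function.update_self] at this
    intro e
    rw [h1, h2] at e
    rw [List.append_cancel_left e] at this
    exact this rfl
  · rintro ⟨h, h'⟩
    obtain ⟨p, l, l', h1, h2, h3⟩ := exists_common_prefix h
    obtain ⟨u, hu⟩ := exists_rel_assertTopNe (N := N)
      (s := Function.update (Function.update s x l) y l') hxy (by simpa [hxy] using h3)
    exact ⟨_, ⟨p, l, l', h1, h2, rfl⟩, u, hu, (hlast _ u p l l' h1 h2 rfl hu).2 h'⟩

end Prog

namespace Prog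

variable {K : Type}

/-! ### Membership and lookup in coded lists -/

/-- Check that the reversed code on stack `x` is that of an entry of the list on stack `p`, and
clear `x`. The program `rd` reads one entry; `p'` and `y` are auxiliary stacks. -/
def assertMem (rd : K → List K → Prog K) (p p' x y : K) : Prog K :=
  seq (seq (many (seq (shift p true [p']) (rd p [p']))) (seq (shift p true [p']) (rd p [p', y])))
    (seq (assertEq x y) (moveAll p' [p]))

/-- Check that the reversed code on stack `x` is not that of the entry on top of stack `p`, which is
moved to `p'`. -/
def assertHeadNe (rd : K → List K → Prog K) (p p' x x' y g : K) : Prog K :=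
  seq (rd p [p', y]) (seq (copy x x' g) (assertNe g y))

/-- Check that the reversed code on stack `x` is not that of an entry of the list on stack `p`, and
clear `x`. -/
def assertNotMem (rd : K → List K → Prog K) (p p' x x' y g : K) : Prog K :=
  seq (readList p [p'] (assertHeadNe rd p p' x x' y g)) (seq (moveAll p' [p]) (moveAll x []))

/-- Find the first pair in the list on stack `q` whose first component is the number with the
reversed code on stack `x`, clear `x`, and push the code of the second component on the stacks
`bs`. -/
def lookup (q q' x x' y g : K) (bs : List K) : Prog K :=
  seq (seq (many (seq (shift q true [q'])
      (seq (assertHeadNe readNat q q' x x' y g) (readNat q [q']))))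
      (seq (shift q true [q']) (readNat q [q', y])))
    (seq (assertEq x y) (seq (readNat q (q' :: bs)) (moveAll q' [q])))

/-- The program `rd a bs` takes the code of an arbitrary element from `a` and copies it to `bs`. -/
def Copies [DecidableEq K] {α : Type} (N : ℕ) (rd : K → List K → Prog K) (e : α → List Bool) :
    Prop :=
  ∀ (I : Store K → Prop) (a : K) (S : Set K) (bs : List K), Stable I a S →
    (∀ s, I s → Short N a s) → (∀ k ∈ bs, k ∈ S) →
    Parses N I (rd a bs) a e (fun _ => True) (fun v => onto bs (e v))

variable [DecidableEq K] {N : ℕ} {s s' : Store K} {α : Type} {e : α → List Bool}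
  {rd : K → List K → Prog K}

theorem copies_readNat (N : ℕ) : Copies (K := K) N readNat encNat :=
  fun _ _ _ _ hS hI hb => Parses.readNat hS hI hb

theorem _root_.PrefixFree.injective (he : PrefixFree e) : Function.Injective e := by
  intro v w h
  exact (he v w [] [] (by simpa using h)).1

theorem mem_of_encList_eq (he : PrefixFree e) {v : α} {r : List Bool} :
    ∀ {l pl : List α}, encList e pl = (l.flatMap fun w => true :: e w) ++ (true :: (e v ++ r)) →
      v ∈ pl
  | [], [], h => by simp [encList] at h
  | [], w :: pl, h => by
    simp only [encList, List.flatMap_cons, List.cons_append, List.append_assoc, List.flatMap_nil,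
      List.nil_append, List.cons.injEq, true_and] at h
    simp [(he _ _ _ _ h).1]
  | u :: l, [], h => by simp [encList] at h
  | u :: l, w :: pl, h => by
    simp only [encList, List.flatMap_cons, List.cons_append, List.append_assoc,
      List.cons.injEq, true_and] at h
    have := mem_of_encList_eq he (l := l) (pl := pl) (v := v) (r := r)
      (by simpa [encList] using (he _ _ _ _ h).2)
    simp [this]

theorem encList_append_cons (l l' : List α) (v : α) : encList e (l ++ v :: l') =
    (l.flatMap fun w => true :: e w) ++ (true :: (e v ++ encList e l')) := by
  simp [encList]

theorem rel_assertMem (hrd : Copies N rd e) (he : PrefixFree e) {p p' x y : K}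
    (hd : [p, p', x, y].Nodup) {pl : List α} (hp : s p = encList e pl) (hp' : s p' = [])
    (hy : s y = []) (hps : Short N p s) (hx : Short N x s) :
    (assertMem rd p p' x y).Rel N s s' ↔
      (∃ v ∈ pl, s x = (e v).reverse) ∧ s' = Function.update s x [] := by
  simp only [List.nodup_cons, List.mem_cons, List.not_mem_nil, or_false, not_or] at hd
  obtain ⟨⟨hpp', hpx, hpy⟩, ⟨hpx', hpy'⟩, hxy, -⟩ := hd
  have hst := stable_short N p Set.univ
  have h1 := (Parses.shift p true [p']).seqS hst (hrd _ p _ [p'] hst (fun _ h => h) (by simp))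
    (by simp)
  have h2 := h1.many (by simp) (fun s v r hs _ hr => hst.out hs hr (by simp)) (fun _ h => h)
  have h3 := (Parses.shift p true [p']).seqS hst
    (hrd _ p _ [p', y] hst (fun _ h => h) (by simp)) (by simp)
  have h4 := h2.seqS hst h3 (by simp)
  -- the store after the entry `v` that follows the entries `l`
  have hout : ∀ (l : List (Unit × α)) (v : α) (r : List Bool),
      s p = (l.flatMap fun w => true :: e w.2) ++ (true :: (e v ++ r)) →
      ∀ t, t = s.out p r (fun k => (l.flatMap fun w => onto [p'] [true] k ++ onto [p'] (e w.2) k) ++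
        (onto [p'] [true] k ++ onto [p', y] (e v) k)) →
      ((seq (assertEq x y) (moveAll p' [p])).Rel N t s' ↔
        s x = (e v).reverse ∧ s' = Function.update s x []) := by
    intro l v r hr t ht
    have tx : t x = s x := by
      simp [ht, Store.out, onto, Ne.symm hpx, Ne.symm hpx', hxy]
    have ty : t y = (e v).reverse := by
      simp [ht, Store.out, onto, Ne.symm hpy, Ne.symm hpy', hy]
    have tp : t p = r := by simp [ht]
    have tp' : (t p').reverse ++ r = s p := by
      simp [ht, Store.out, onto, Ne.symm hpp', hp', hr]
    have tk : ∀ k, k ≠ p → k ≠ p' → k ≠ x → k ≠ y → t k = s k := by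
      intro k k1 k2 k3 k4
      simp [ht, Store.out, onto, k1, k2, k4]
    rw [rel_seq]
    simp only [rel_assertEq hxy (show Short N x t by rw [Short, tx]; exact hx), tx, ty]
    have e1 : ∀ u : Store K, u = Function.update (Function.update t x []) y [] →
        ((moveAll p' [p]).Rel N u s' ↔ s' = Function.update s x []) := by
      rintro u rfl
      rw [rel_rewind hpp']
      · have : Function.update (Function.update
            (Function.update (Function.update t x []) y []) p
            ((Function.update (Function.update t x []) y [] p').reverse ++
              Function.update (Function.update t x []) y [] p)) p' [] =
            Function.update s x [] := by
          funext k
          by_cases k2 : k = p'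
          · subst k2; simp [hp', hpx']
          by_cases k1 : k = p
          · subst k1; simp [hpp', hpx, hpy, hpx', hpy', tp, tp']
          by_cases k4 : k = y
          · subst k4; simp [k1, k2, hy, Ne.symm hxy]
          by_cases k3 : k = x
          · subst k3; simp [k1, k2, k4]
          simp [k1, k2, k3, k4, tk k k1 k2 k3 k4]
        rw [this]
      · have : (t p').length ≤ (s p).length := by
          rw [← tp']; simp
        rw [Short, Function.update_of_ne hpy', Function.update_of_ne hpx']
        exact this.trans hps
    constructor
    · rintro ⟨u, ⟨h5, h6⟩, h7⟩
      exact ⟨h5, (e1 u h6).1 h7⟩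
    · rintro ⟨h5, h6⟩
      exact ⟨_, ⟨h5, rfl⟩, (e1 _ rfl).2 h6⟩
  rw [assertMem, rel_seq]
  simp only [h4 s _ hps]
  constructor
  · rintro ⟨t, ⟨⟨l, ⟨⟩, v⟩, r, -, hr, ht⟩, h5⟩
    have hr' : s p = (l.flatMap fun w => true :: e w.2) ++ (true :: (e v ++ r)) := by
      simpa using hr
    obtain ⟨h6, h7⟩ := (hout l v r hr' t ht).1 h5
    refine ⟨⟨v, ?_, h6⟩, h7⟩
    rw [hp] at hr'
    refine mem_of_encList_eq he (l := l.map Prod.snd) (r := r) ?_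
    rw [hr', List.flatMap_map]
  · rintro ⟨⟨v, hv, h6⟩, h7⟩
    obtain ⟨l, l', rfl⟩ := List.append_of_mem hv
    have hr' : s p = ((l.map (Prod.mk ())).flatMap fun w => true :: e w.2) ++
        (true :: (e v ++ encList e l')) := by
      rw [hp, encList_append_cons, List.flatMap_map]
    refine ⟨_, ⟨⟨l.map (Prod.mk ()), (), v⟩, encList e l', by simp, by simpa using hr', rfl⟩, ?_⟩
    exact (hout _ v _ hr' _ rfl).2 ⟨h6, h7⟩

/-- The condition on stores for comparing the string `X` on stack `x` with the entries of a list. -/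
def Compare (N : ℕ) (p x x' y g : K) (X : List Bool) (s : Store K) : Prop :=
  Short N p s ∧ s x = X ∧ s x' = [] ∧ s y = [] ∧ s g = []

theorem stable_compare {p p' x x' y g : K} (hd : [p, p', x, x', y, g].Nodup) (X : List Bool) :
    Stable (Compare N p x x' y g X) p {p'} := by
  simp only [List.nodup_cons, List.mem_cons, List.not_mem_nil, or_false, not_or] at hd
  intro s r o hs hr ho
  obtain ⟨h1, h2, h3, h4, h5⟩ := hs
  have key : ∀ k, k ≠ p → k ≠ p' → s.out p r o k = s k := by
    intro k k1 k2
    simp [Store.out, k1, ho k k2]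
  refine ⟨stable_short N p Set.univ s r o h1 hr (by simp), ?_, ?_, ?_, ?_⟩
  all_goals (rw [key]; assumption; all_goals (intro h; simp_all))

theorem parses_assertHeadNe (hrd : Copies N rd e) {p p' x x' y g : K}
    (hd : [p, p', x, x', y, g].Nodup) (X : List Bool) (hX : X.length ≤ N ^ 8) :
    Parses N (Compare N p x x' y g X) (assertHeadNe rd p p' x x' y g) p e
      (fun v => X ≠ (e v).reverse) (fun v => onto [p'] (e v)) := by
  simp only [List.nodup_cons, List.mem_cons, List.not_mem_nil, or_false, not_or] at hd
  obtain ⟨⟨n1, n2, n3, n4, n5⟩, ⟨n6, n7, n8, n9⟩, ⟨n10, n11, n12⟩, ⟨n13, n14⟩, n15, -⟩ := hd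
  have h1 := hrd (Short N p) p _ [p', y] (stable_short N p Set.univ) (fun _ h => h) (by simp)
  rintro s s' ⟨c1, c2, c3, c4, c5⟩
  rw [assertHeadNe, rel_seq]
  simp only [h1 s _ c1, true_and]
  have key : ∀ v r, s p = e v ++ r → ∀ t, t = s.out p r (onto [p', y] (e v)) →
      ((seq (copy x x' g) (assertNe g y)).Rel N t s' ↔
        X ≠ (e v).reverse ∧ s' = s.out p r (onto [p'] (e v))) := by
    intro v r hr t ht
    have tx : t x = X := by simp [ht, Store.out, onto, Ne.symm n2, Ne.symm n6, n11, c2]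
    have tx' : t x' = [] := by simp [ht, Store.out, onto, Ne.symm n3, Ne.symm n7, n13, c3]
    have ty : t y = (e v).reverse := by
      simp [ht, Store.out, onto, Ne.symm n4, Ne.symm n8, c4]
    have tg : t g = [] := by simp [ht, Store.out, onto, Ne.symm n5, Ne.symm n9, Ne.symm n15, c5]
    have hlen : (e v).length ≤ N ^ 8 := by
      have : (e v).length ≤ (s p).length := by simp [hr]
      exact this.trans c1
    simp only [rel_seq, rel_copy n10 n12 n14 (show Short N x t by rw [Short, tx]; exact hX) tx',
      exists_eq_left, tx, tg, List.append_nil]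
    rw [rel_assertNe (Ne.symm n15) (by simpa [Short] using hX)
      (by simpa [Short, n15, ty] using hlen)]
    have : Function.update (Function.update (Function.update t g X) g []) y [] =
        s.out p r (onto [p'] (e v)) := by
      funext k
      by_cases k1 : k = y
      · subst k1; simp [Store.out, onto, Ne.symm n4, Ne.symm n8, c4]
      by_cases k2 : k = g
      · subst k2; simp [Store.out, onto, Ne.symm n5, Ne.symm n9, c5, k1]
      simp [k1, k2, ht, Store.out, onto]
    rw [this]
    simp [ty, n15]
  constructor
  · rintro ⟨t, ⟨v, r, hr, ht⟩, h⟩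
    obtain ⟨h2, h3⟩ := (key v r hr t ht).1 h
    exact ⟨v, r, h2, hr, h3⟩
  · rintro ⟨v, r, h2, hr, h3⟩
    exact ⟨_, ⟨v, r, hr, rfl⟩, (key v r hr _ rfl).2 ⟨h2, h3⟩⟩

theorem rel_assertNotMem (hrd : Copies N rd e) (he : PrefixFree e) {p p' x x' y g : K}
    (hd : [p, p', x, x', y, g].Nodup) {pl : List α} (hp : s p = encList e pl) (hp' : s p' = [])
    (hx' : s x' = []) (hy : s y = []) (hg : s g = []) (hps : Short N p s) (hx : Short N x s) :
    (assertNotMem rd p p' x x' y g).Rel N s s' ↔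
      (∀ v ∈ pl, s x ≠ (e v).reverse) ∧ s' = Function.update s x [] := by
  have h1 := (parses_assertHeadNe hrd hd (s x) hx).readList_copy (stable_compare hd (s x))
    (fun _ h => h.1) (by simp)
  simp only [List.nodup_cons, List.mem_cons, List.not_mem_nil, or_false, not_or] at hd
  obtain ⟨⟨n1, n2, n3, n4, n5⟩, ⟨n6, n7, n8, n9⟩, -⟩ := hd
  rw [assertNotMem, rel_seq]
  simp only [h1 s _ ⟨hps, rfl, hx', hy, hg⟩]
  have key : ∀ t, t = s.out p [] (onto [p'] (encList e pl)) →
      ((seq (moveAll p' [p]) (moveAll x [])).Rel N t s' ↔ s' = Function.update s x []) := by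
    intro t ht
    have tp' : t p' = (s p).reverse := by simp [ht, Store.out, onto, Ne.symm n1, hp, hp']
    simp only [rel_seq, rel_rewind n1 (show Short N p' t by
      rw [Short, tp', List.length_reverse]; exact hps), exists_eq_left]
    have e1 : Function.update (Function.update t p ((t p').reverse ++ t p)) p' [] = s := by
      funext k
      by_cases k1 : k = p'
      · subst k1; simp [hp']
      by_cases k2 : k = p
      · subst k2; simp [k1, tp']; simp [ht]
      simp [k1, k2, ht, Store.out, onto]
    rw [e1, rel_clear hx]
  constructor
  · rintro ⟨t, ⟨l, r, hl, hr, ht⟩, h⟩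
    obtain ⟨rfl, rfl⟩ := prefixFree_encList he pl l [] r (by rw [← hr, hp, List.append_nil])
    exact ⟨hl, (key t ht).1 h⟩
  · rintro ⟨hl, h⟩
    exact ⟨_, ⟨pl, [], hl, by rw [hp, List.append_nil], rfl⟩, (key _ rfl).2 h⟩

end Prog

/-- The code of a pair of numbers. -/
def encPair (v : ℕ × ℕ) : List Bool := encNat v.1 ++ encNat v.2

theorem prefixFree_encPair : PrefixFree encPair := by
  rintro ⟨x, y⟩ ⟨x', y'⟩ s t h
  simp only [encPair, List.append_assoc] at h
  obtain ⟨h1, h2⟩ := prefixFree_encNat _ _ _ _ h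
  obtain ⟨h3, h4⟩ := prefixFree_encNat _ _ _ _ h2
  exact ⟨Prod.ext h1 h3, h4⟩

namespace Prog

variable {K : Type} [DecidableEq K] {N : ℕ} {s s' : Store K}

theorem split_of_encList_eq {α : Type} {e : α → List Bool} (he : PrefixFree e) {r : List Bool} :
    ∀ {l pl : List α}, encList e pl = (l.flatMap fun w => true :: e w) ++ (true :: r) →
      ∃ v l', pl = l ++ v :: l' ∧ r = e v ++ encList e l'
  | [], [], h => by simp [encList] at h
  | [], w :: pl, h => by
    simp only [encList, List.flatMap_cons, List.cons_append, List.append_assoc, List.flatMap_nil,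
      List.nil_append, List.cons.injEq, true_and] at h
    exact ⟨w, pl, rfl, h.symm⟩
  | u :: l, [], h => by simp [encList] at h
  | u :: l, w :: pl, h => by
    simp only [encList, List.flatMap_cons, List.cons_append, List.append_assoc,
      List.cons.injEq, true_and] at h
    obtain ⟨rfl, h⟩ := he _ _ _ _ h
    obtain ⟨v, l', rfl, h'⟩ := split_of_encList_eq he (l := l) (pl := pl) (r := r)
      (by simpa [encList] using h)
    exact ⟨v, l', rfl, h'⟩

/-- The search passes over entries with other keys only, and so it stops at the first entry with the
key `v`. -/
theorem rel_lookup {q q' x x' y g : K} {bs : List K} (hd : [q, q', x, x', y, g].Nodup)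
    (hbs : ∀ k ∈ bs, k ∉ [q, q', x, y]) {env : List (ℕ × ℕ)} {v : ℕ}
    (hq : s q = encList encPair env) (hq' : s q' = []) (hx : s x = (encNat v).reverse)
    (hx' : s x' = []) (hy : s y = []) (hg : s g = []) (hqs : Short N q s) (hxs : Short N x s) :
    (lookup q q' x x' y g bs).Rel N s s' ↔
      ∃ w, env.lookup v = some w ∧ s' = s.out x [] (onto bs (encNat w)) := by
  have hst := stable_compare (N := N) hd (s x)
  have h0 := parses_assertHeadNe (copies_readNat N) hd (s x) hxs
  simp only [List.nodup_cons, List.mem_cons, List.not_mem_nil, or_false, not_or] at hd hbs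
  obtain ⟨⟨n1, n2, n3, n4, n5⟩, ⟨n6, n7, n8, n9⟩, ⟨n10, n11, n12⟩, ⟨n13, n14⟩, n15, -⟩ := hd
  have h1 := (Parses.shift q true [q']).seqS hst (h0.seqS hst
    (Parses.readNat hst (fun _ h => h.1) (bs := [q']) (by simp)) fun _ => onto_eq_nil (by simp) _)
    fun _ => onto_eq_nil (by simp) _
  have h2 := h1.many (by simp) (fun s w r hs _ hr => hst.out hs hr fun k hk => by
    simp [onto_eq_nil (bs := [q']) (S := {q'}) (by simp) _ k hk]) (fun _ h => h.1)
  have h3 := h2.seqS hst ((Parses.shift q true [q']).seqS hst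
    (((copies_readNat N) _ q _ [q', y] (stable_short N q Set.univ) (fun _ h => h)
      (by simp)).mono fun _ h => h.1) fun _ => onto_eq_nil (by simp) _) fun l k hk => by
    simp [onto_eq_nil (bs := [q']) (S := {q'}) (by simp) _ k hk]
  rw [lookup, rel_seq]
  simp only [h3 s _ ⟨hqs, rfl, hx', hy, hg⟩]
  -- the part of the program after the entries `l` and the next key `v'` have been read
  have key : ∀ (l : List (ℕ × ℕ)) (v' : ℕ) (r : List Bool),
      s q = (l.flatMap fun w => true :: encPair w) ++ (true :: (encNat v' ++ r)) →
      ∀ t, t = s.out q r (fun k => (l.flatMap fun w => onto [q'] [true] k ++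
        (onto [q'] (encNat w.1) k ++ onto [q'] (encNat w.2) k)) ++
        (onto [q'] [true] k ++ onto [q', y] (encNat v') k)) →
      ((seq (assertEq x y) (seq (readNat q (q' :: bs)) (moveAll q' [q]))).Rel N t s' ↔
        v = v' ∧ ∃ w r', r = encNat w ++ r' ∧ s' = s.out x [] (onto bs (encNat w))) := by
    intro l v' r hr t ht
    have tx : t x = s x := by
      simp [ht, Store.out, onto, Ne.symm n2, Ne.symm n6, n11]
    have ty : t y = (encNat v').reverse := by
      simp [ht, Store.out, onto, Ne.symm n4, Ne.symm n8, hy]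
    have tq : t q = r := by simp [ht]
    have tq' : (t q').reverse ++ r = s q := by
      simp [ht, Store.out, onto, Ne.symm n1, hq', hr, encPair]
    have tk : ∀ k, k ≠ q → k ≠ q' → k ≠ x → k ≠ y → t k = s k := by
      intro k k1 k2 k3 k4
      simp [ht, Store.out, onto, k1, k2, k4]
    have hxv : s x = (encNat v').reverse ↔ v = v' := by
      rw [hx, List.reverse_inj]
      exact ⟨fun h => prefixFree_encNat.injective h, fun h => by rw [h]⟩
    rw [rel_seq]
    simp only [rel_assertEq n11 (show Short N x t by rw [Short, tx]; exact hxs), tx, ty, hxv]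
    have e1 : ∀ u : Store K, u = Function.update (Function.update t x []) y [] →
        ((seq (readNat q (q' :: bs)) (moveAll q' [q])).Rel N u s' ↔
          ∃ w r', r = encNat w ++ r' ∧ s' = s.out x [] (onto bs (encNat w))) := by
      rintro u hu
      have uq : u q = r := by rw [hu]; simp [n2, n4, tq]
      have uq' : u q' = t q' := by rw [hu]; simp [n6, n8]
      have hrs : r.length ≤ (s q).length := by rw [← tq']; simp
      have h5 := copies_readNat N (Short N q) q _ (q' :: bs) (stable_short N q Set.univ)
        (fun _ h => h) (by simp)
      rw [rel_seq]
      simp only [h5 u _ (by rw [Short, uq]; exact hrs.trans hqs), uq, true_and]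
      have e2 : ∀ w r' u', r = encNat w ++ r' → u' = u.out q r' (onto (q' :: bs) (encNat w)) →
          ((moveAll q' [q]).Rel N u' s' ↔ s' = s.out x [] (onto bs (encNat w))) := by
        intro w r' u' hw hu'
        have uq2 : u' q = r' := by rw [hu']; simp
        have uq3 : (u' q').reverse ++ r' = s q := by
          rw [← tq', hu']
          simp [Store.out, Ne.symm n1, onto, uq', hw]
        rw [rel_rewind n1]
        · have : Function.update (Function.update u' q ((u' q').reverse ++ u' q)) q' [] =
              s.out x [] (onto bs (encNat w)) := by
            funext k
            by_cases k2 : k = q'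
            · subst k2
              have : k ∉ bs := fun h => (hbs k h).2.1 rfl
              simp [Store.out, n6, onto, this, hq']
            by_cases k1 : k = q
            · subst k1
              have : k ∉ bs := fun h => (hbs k h).1 rfl
              simp [k2, uq2, uq3, Store.out, n2, onto, this]
            by_cases k3 : k = x
            · subst k3
              have : k ∉ bs := fun h => (hbs k h).2.2.1 rfl
              simp [k1, k2, hu', Store.out, onto, this, hu, n11]
            by_cases k4 : k = y
            · subst k4
              have : k ∉ bs := fun h => (hbs k h).2.2.2 rfl
              simp [k1, k2, hu', Store.out, onto, this, hu, k3, hy]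
            simp [k1, k2, hu', Store.out, onto, hu, k3, k4, tk k k1 k2 k3 k4]
          rw [this]
        · have : (u' q').length ≤ (s q).length := by rw [← uq3]; simp
          exact this.trans hqs
      constructor
      · rintro ⟨u', ⟨w, r', hw, hu'⟩, h6⟩
        exact ⟨w, r', hw, (e2 w r' u' hw hu').1 h6⟩
      · rintro ⟨w, r', hw, h6⟩
        exact ⟨_, ⟨w, r', hw, rfl⟩, (e2 w r' _ hw rfl).2 h6⟩
    constructor
    · rintro ⟨u, ⟨h5, hu⟩, h6⟩
      exact ⟨h5, (e1 u hu).1 h6⟩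
    · rintro ⟨h5, h6⟩
      exact ⟨_, ⟨h5, rfl⟩, (e1 _ rfl).2 h6⟩
  have hne : ∀ v', s x ≠ (encNat v').reverse ↔ v ≠ v' := by
    intro v'
    rw [hx, ne_eq, List.reverse_inj]
    exact not_congr ⟨fun h => prefixFree_encNat.injective h, fun h => by rw [h]⟩
  simp only [List.lookup_eq_some_iff]
  constructor
  · rintro ⟨t, ⟨⟨l, ⟨⟩, v'⟩, r, ⟨hl, -⟩, hr, ht⟩, h5⟩
    have hr' : s q = ((l.map Prod.snd).flatMap fun w => true :: encPair w) ++
        (true :: (encNat v' ++ r)) := by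
      simpa [encPair, List.flatMap_map] using hr
    obtain ⟨rfl, w, r', rfl, h7⟩ := (key (l.map Prod.snd) v' r hr' t (by
      rw [ht]; simp [List.flatMap_map])).1 h5
    refine ⟨w, ?_, h7⟩
    rw [hq] at hr'
    obtain ⟨⟨v', w'⟩, l', rfl, h8⟩ := split_of_encList_eq prefixFree_encPair hr'
    simp only [encPair, List.append_assoc] at h8
    obtain ⟨h9, h10⟩ := prefixFree_encNat _ _ _ _ h8
    obtain ⟨h11, -⟩ := prefixFree_encNat _ _ _ _ h10
    obtain rfl : v = v' := h9
    obtain rfl : w = w' := h11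
    refine ⟨_, _, rfl, ?_⟩
    intro p hp
    obtain ⟨p', hp', rfl⟩ := List.mem_map.1 hp
    have := (hl _ hp').2.1
    rw [hne] at this
    simpa using this
  · rintro ⟨w, ⟨l, l', rfl, hl⟩, h7⟩
    have hr' : s q = (l.flatMap fun w => true :: encPair w) ++
        (true :: (encNat v ++ (encNat w ++ encList encPair l'))) := by
      rw [hq, encList_append_cons]; simp [encPair]
    refine ⟨_, ⟨⟨l.map (Prod.mk ()), (), v⟩, encNat w ++ encList encPair l', ?_, ?_, rfl⟩, ?_⟩
    · refine ⟨?_, trivial, trivial⟩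
      intro p hp
      obtain ⟨p, hp', rfl⟩ := List.mem_map.1 hp
      refine ⟨trivial, ?_, trivial⟩
      rw [hne]
      simpa using hl p hp'
    · rw [hr']; simp [encPair, List.flatMap_map]
    · exact (key l v _ hr' _ (by simp [List.flatMap_map])).2 ⟨rfl, w, _, rfl, h7⟩

end Prog

section

variable {K : Type} [DecidableEq K] {N : ℕ} {α β : Type} {I I' : Store K → Prop} {c d : Prog K}
  {a : K} {e : α → List Bool} {P : α → Prop} {o : α → K → List Bool}

/-- The stores that agree with `s₀` outside stack `a` and the stacks in `S`, and whose stack `a` is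
short. -/
def Agree (N : ℕ) (s₀ : Store K) (a : K) (S : Set K) (s : Store K) : Prop :=
  Short N a s ∧ ∀ k, k ≠ a → k ∉ S → s k = s₀ k

theorem stable_agree (N : ℕ) (s₀ : Store K) (a : K) (S : Set K) : Stable (Agree N s₀ a S) a S := by
  refine fun s r o hs hr ho => ⟨stable_short N a S s r o hs.1 hr ho, fun k hk hS => ?_⟩
  rw [Store.out_of_ne s hk, ho k hS, hs.2 k hk hS]
  rfl

namespace Parses

/-- After a value has been read, a program `d` may check a condition on it and change what is left
on the other stacks. -/
theorem check (h : Parses N I c a e P o) {Q : α → Prop} {o' : α → K → List Bool}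
    (hd : ∀ s v r s', I s → P v → s a = e v ++ r →
      (d.Rel N (s.out a r (o v)) s' ↔ Q v ∧ s' = s.out a r (o' v))) :
    Parses N I (.seq c d) a e (fun v => P v ∧ Q v) o' := by
  intro s s' hs
  constructor
  · rintro ⟨t, h1, h2⟩
    obtain ⟨v, r, hv, hr, rfl⟩ := (h s t hs).1 h1
    obtain ⟨hq, h3⟩ := (hd s v r s' hs hv hr).1 h2
    exact ⟨v, r, ⟨hv, hq⟩, hr, h3⟩
  · rintro ⟨v, r, ⟨hv, hq⟩, hr, h3⟩
    exact ⟨_, (h s _ hs).2 ⟨v, r, hv, hr, rfl⟩, (hd s v r s' hs hv hr).2 ⟨hq, h3⟩⟩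

theorem congr_pred {P'' : α → Prop} (h : Parses N I c a e P o) (hP : ∀ v, P'' v ↔ P v) :
    Parses N I c a e P'' o :=
  h.retype id Function.surjective_id (fun _ => rfl) hP (fun _ _ _ => rfl)

end Parses

end

namespace Prog

variable {K : Type} {σ : Schema}

/-! ### Reading facts, and guessing -/

/-- Pop the code of a fact. -/
def readFact (σ : Schema) (a : K) (bs : List K) : Prog K :=
  altFin fun R : Fin σ.numRel => seq (readStr a bs (encNat R)) (rep (σ.arity R) (readNat a bs))

/-- Pop the code of a pair of numbers. -/
def readPair (a : K) (bs : List K) : Prog K := seq (readNat a bs) (readNat a bs)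

/-- Push an arbitrary string on each of the stacks `bs`. -/
def guess (bs : List K) (j : ℕ) : Prog K := nestedStar (alt (emit true bs) (emit false bs)) j

variable [DecidableEq K] {N : ℕ} {s s' : Store K}

theorem flatMap_onto {α : Type} (bs : List K) (e : α → List Bool) (l : List α) (k : K) :
    (l.flatMap fun v => onto bs (e v) k) = onto bs (l.flatMap e) k := by
  by_cases hk : k ∈ bs <;> simp [onto, hk]

theorem copies_readFact (σ : Schema) (N : ℕ) :
    Copies (K := K) N (readFact σ) (encFact (σ := σ)) := by
  intro I a S bs hS hI hb
  refine (Parses.altFin fun R : Fin σ.numRel => (Parses.readStr hS hb (encNat R)).seqS hS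
    (Parses.rep hS (Parses.readNat hS hI hb) (fun _ => onto_eq_nil hb _) (σ.arity R))
    (fun _ => onto_eq_nil hb _)).retype (fun v => ⟨v.1, v.2.2⟩)
    (fun v => ⟨⟨v.1, (), v.2⟩, rfl⟩) (fun v => rfl) (by simp) ?_
  intro v k _
  simp only [flatMap_onto, onto_append]
  rfl

theorem copies_readPair (N : ℕ) : Copies (K := K) N readPair encPair := by
  intro I a S bs hS hI hb
  have h := Parses.readNat (N := N) hS hI hb
  exact (h.seqS hS h fun _ => onto_eq_nil hb _).retype id Function.surjective_id
    (fun _ => rfl) (by simp) fun v k _ => (onto_append ..).symm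

/-- The store in which the string `l` has been put on top of each of the stacks `bs`. -/
def _root_.Store.push (s : Store K) (bs : List K) (l : List Bool) : Store K :=
  fun k => if k ∈ bs then l ++ s k else s k

theorem push_push (bs : List K) (l l' : List Bool) :
    (s.push bs l).push bs l' = s.push bs (l' ++ l) := by
  funext k
  by_cases hk : k ∈ bs <;> simp [Store.push, hk]

/-- In `j + 1` nested loops any string of length at most `N ^ (j + 1)` can be guessed. -/
theorem rel_guess {bs : List K} {j : ℕ} :
    (guess bs j).Rel N s s' ↔ ∃ l : List Bool, l.length ≤ N ^ (j + 1) ∧ s' = s.push bs l := by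
  have h1 : ∀ s s' : Store K, (alt (emit true bs) (emit false bs)).Rel N s s' ↔
      ∃ b, s' = s.push bs [b] := by
    intro s s'
    have e : ∀ b, s.emit bs b = s.push bs [b] := by
      intro b
      funext k
      by_cases hk : k ∈ bs <;> simp [Store.emit, Store.push, hk]
    simp only [Rel, e, Bool.exists_bool]
    exact or_comm
  have hnil : s.push bs [] = s := by
    funext k
    simp [Store.push]
  constructor
  · suffices H : ∀ (j : ℕ) (s s' : Store K),
        (nestedStar (alt (emit true bs) (emit false bs)) j).Rel N s s' →
        ∃ l : List Bool, l.length ≤ N ^ (j + 1) ∧ s' = s.push bs l from H j s s'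
    have step : ∀ (R : Store K → Store K → Prop) (B : ℕ),
        (∀ s s', R s s' → ∃ l : List Bool, l.length ≤ B ∧ s' = s.push bs l) →
        ∀ (m : ℕ) (s s' : Store K), Iter R m s s' →
          ∃ l : List Bool, l.length ≤ m * B ∧ s' = s.push bs l := by
      intro R B hR m
      induction m with
      | zero =>
        intro s s' h
        obtain rfl := h
        exact ⟨[], by simp, by funext k; simp [Store.push]⟩
      | succ m ih =>
        rintro s s' ⟨t, h2, h3⟩
        obtain ⟨l, hl, rfl⟩ := hR _ _ h2
        obtain ⟨l', hl', rfl⟩ := ih _ _ h3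
        refine ⟨l' ++ l, ?_, push_push ..⟩
        rw [List.length_append, Nat.succ_mul]
        omega
    intro j
    induction j with
    | zero =>
      rintro s s' ⟨m, hm, h⟩
      obtain ⟨l, hl, rfl⟩ := step _ 1 (fun s s' h => by
        obtain ⟨b, rfl⟩ := (h1 s s').1 h
        exact ⟨[b], by simp, rfl⟩) m s s' h
      exact ⟨l, by simp; omega, rfl⟩
    | succ j ih =>
      rintro s s' ⟨m, hm, h⟩
      obtain ⟨l, hl, rfl⟩ := step _ _ ih m s s' h
      refine ⟨l, ?_, rfl⟩
      rw [pow_succ']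
      exact hl.trans (Nat.mul_le_mul_right _ hm)
  · rintro ⟨l, hl, rfl⟩
    refine rel_nestedStar l.length hl ?_
    induction l using List.reverseRecOn generalizing s with
    | nil => exact hnil.symm
    | append_singleton l b ih =>
      rw [List.length_append, List.length_singleton, ← push_push]
      refine ⟨_, (h1 _ _).2 ⟨b, rfl⟩, ih ?_ ?_⟩
      · funext k
        simp [Store.push]
      · rw [List.length_append] at hl
        exact le_trans (Nat.le_add_right _ _) hl

theorem rel_rep_guess {bs : List K} {j m : ℕ} :
    (rep m (guess bs j)).Rel N s s' ↔
      ∃ l : List Bool, l.length ≤ m * N ^ (j + 1) ∧ s' = s.push bs l := by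
  induction m generalizing s with
  | zero =>
    have : s.push bs [] = s := by
      funext k
      simp [Store.push]
    simp [rep, this]
  | succ m ih =>
    simp only [rep, rel_seq, ih, rel_guess]
    constructor
    · rintro ⟨_, ⟨l, hl, rfl⟩, l', hl', rfl⟩
      refine ⟨l' ++ l, ?_, push_push ..⟩
      rw [List.length_append, Nat.succ_mul]
      omega
    · rintro ⟨l, hl, rfl⟩
      refine ⟨_, ⟨l.drop (m * N ^ (j + 1)), ?_, rfl⟩, l.take (m * N ^ (j + 1)), ?_, ?_⟩
      · rw [Nat.succ_mul] at hl
        rw [List.length_drop]; omega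
      · simp
      · rw [push_push, List.take_append_drop]

/-! ### A binary counter -/

/-- The successor of a number written in binary, least significant bit first. -/
def _root_.binSucc : List Bool → List Bool
  | [] => [true]
  | false :: l => true :: l
  | true :: l => false :: binSucc l

theorem _root_.binVal_binSucc : ∀ l, binVal (binSucc l) = binVal l + 1
  | [] => rfl
  | false :: l => by simp [binSucc, binVal, Nat.bit]
  | true :: l => by
    have := binVal_binSucc l
    simp only [binVal] at this
    simp only [binSucc, binVal, List.foldr_cons, this]
    simp [Nat.bit]
    omega

theorem _root_.length_binSucc_le : ∀ l, (binSucc l).length ≤ l.length + 1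
  | [] => by simp [binSucc]
  | false :: l => by simp [binSucc]
  | true :: l => by
    have := length_binSucc_le l
    simp only [binSucc, List.length_cons]
    omega

theorem _root_.binSucc_replicate_false (i : ℕ) (l : List Bool) :
    binSucc (List.replicate i true ++ false :: l) = List.replicate i false ++ true :: l := by
  induction i with
  | zero => rfl
  | succ i ih => simp [List.replicate_succ, binSucc, ih]

theorem _root_.binSucc_replicate (i : ℕ) :
    binSucc (List.replicate i true) = List.replicate i false ++ [true] := by
  induction i with
  | zero => rfl
  | succ i ih => simp [List.replicate_succ, binSucc, ih]

theorem _root_.eq_replicate_true_append : ∀ l : List Bool,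
    (∃ i, l = List.replicate i true) ∨ ∃ i l', l = List.replicate i true ++ false :: l'
  | [] => .inl ⟨0, rfl⟩
  | false :: l => .inr ⟨0, l, rfl⟩
  | true :: l => by
    rcases eq_replicate_true_append l with ⟨i, h⟩ | ⟨i, l', h⟩
    · exact .inl ⟨i + 1, by rw [h, List.replicate_succ]⟩
    · exact .inr ⟨i + 1, l', by rw [h, List.replicate_succ, List.cons_append]⟩

/-- Add one to the binary number on stack `b`; `c` is an auxiliary stack. -/
def increment (b c : K) : Prog K :=
  seq (many (shift b true [c]))
    (seq (alt (shift b false []) (empty b))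
      (seq (emit true [b]) (seq (many (seq (shift c true []) (emit false [b]))) (empty c))))

theorem rel_many_shift {b : K} {bs : List K} (hb : Short N b s) :
    (many (shift b true bs)).Rel N s s' ↔ ∃ i r, s b = List.replicate i true ++ r ∧
      s' = s.out b r (onto bs (List.replicate i true)) := by
  have h := (Parses.shift (N := N) b true bs).many (by simp)
    (fun s v r hs _ hr => (stable_short N b Set.univ).out hs hr (by simp)) (fun _ h => h)
  have e : ∀ l : List Unit, (l.flatMap fun _ => [true]) = List.replicate l.length true := by
    intro l
    induction l with
    | nil => rfl
    | cons _ l ih => simp [List.replicate_succ, ih]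
  have e' : ∀ (l : List Unit) k, (l.flatMap fun _ => onto bs [true] k) =
      onto bs (List.replicate l.length true) k := by
    intro l k
    rw [flatMap_onto, e]
  rw [h s s' hb]
  simp only [e, e']
  constructor
  · rintro ⟨l, r, -, h1, h2⟩
    exact ⟨_, r, h1, h2⟩
  · rintro ⟨i, r, h1, h2⟩
    exact ⟨List.replicate i (), r, by simp, by simpa using h1, by simpa using h2⟩

theorem rel_increment {b c : K} (hbc : b ≠ c) (hb : Short N b s) (hc : s c = []) :
    (increment b c).Rel N s s' ↔ s' = Function.update s b (binSucc (s b)) := by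
  have hemit : ∀ (b' : Bool) (t : Store K), t.emit [b] b' = Function.update t b (b' :: t b) := by
    intro b' t
    funext k
    by_cases hk : k = b
    · subst hk; simp [Store.emit]
    · simp [Store.emit, hk]
  -- the second half of the program turns the ones moved to `c` into zeros on `b`
  have hflip : ∀ (i : ℕ) (t : Store K), t c = List.replicate i true → (t c).length ≤ N ^ 8 →
      ∀ t', ((seq (many (seq (shift c true []) (emit false [b]))) (empty c)).Rel N t t' ↔
        t' = Function.update (Function.update t c []) b (List.replicate i false ++ t b)) := by
    intro i t ht hl t'
    have h := ((Parses.shift (N := N) c true []).seqS (stable_short N c Set.univ)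
      (Parses.emit false (bs := [b]) (by simpa using hbc.symm)) (by simp)).many (by simp)
      (fun s v r hs _ hr => (stable_short N c Set.univ).out hs hr (by simp)) (fun _ h => h)
    have e : ∀ l : List (Unit × Unit), (l.flatMap fun _ => [true]) =
        List.replicate l.length true := by
      intro l
      induction l with
      | nil => rfl
      | cons _ l ih => simp [List.replicate_succ, ih]
    have e' : ∀ (l : List (Unit × Unit)) k, (l.flatMap fun _ => onto [b] [false] k) =
        onto [b] (List.replicate l.length false) k := by
      intro l k
      rw [flatMap_onto]
      congr 1
      induction l with
      | nil => rfl
      | cons _ l ih => simp [List.replicate_succ, ih]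
    have e0 : ∀ k, onto ([] : List K) [true] k = [] := by simp [onto]
    rw [rel_seq]
    simp only [h t _ hl, e0, List.nil_append, List.append_nil, e, e', Rel]
    have hfin : t.out c [] (onto [b] (List.replicate i false)) =
        Function.update (Function.update t c []) b (List.replicate i false ++ t b) := by
      funext k
      by_cases hk : k = b
      · subst hk; simp [Store.out, hbc, onto]
      · by_cases hk' : k = c
        · subst hk'; simp [Store.out, hk]
        · simp [Store.out, hk, hk', onto]
    constructor
    · rintro ⟨u, ⟨l, r, -, h1, rfl⟩, h2, rfl⟩
      rw [Store.out_self] at h2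
      subst h2
      obtain rfl : i = l.length := by
        have := congrArg List.length h1
        simpa [ht] using this
      exact hfin
    · rintro rfl
      refine ⟨_, ⟨List.replicate i ((), ()), [], by simp, by simp [ht], rfl⟩, ?_, ?_⟩
      · simp
      · simpa using hfin.symm
  simp only [increment, rel_seq, rel_many_shift hb, rel_alt, rel_shift_nil]
  simp only [Rel, hemit]
  have hlen : ∀ i r, s b = List.replicate i true ++ r → i ≤ N ^ 8 := by
    intro i r h
    have := congrArg List.length h
    rw [List.length_append, List.length_replicate] at this
    rw [Short] at hb
    omega
  have hfl : ∀ i r l, s b = List.replicate i true ++ r → ∀ t : Store K,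
      t = s.out b r (onto [c] (List.replicate i true)) → ∀ u, u = Function.update t b (true :: l) →
      ((∃ v, (many (seq (shift c true []) (emit false [b]))).Rel N u v ∧ v c = [] ∧ s' = v) ↔
        s' = Function.update s b (List.replicate i false ++ (true :: l))) := by
    intro i r l hi t ht u hu
    have uc : u c = List.replicate i true := by
      rw [hu, Function.update_of_ne hbc.symm, ht, Store.out_of_ne _ hbc.symm]
      simp [onto, hc]
    have := hflip i u uc (by rw [uc, List.length_replicate]; exact hlen i r hi) s'
    rw [rel_seq] at this
    simp only [Rel] at this
    rw [this]
    have e : Function.update (Function.update u c []) b (List.replicate i false ++ u b) =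
        Function.update s b (List.replicate i false ++ (true :: l)) := by
      funext k
      by_cases hk : k = b
      · subst hk; simp [hu]
      · by_cases hk' : k = c
        · subst hk'; simp [hk, hc]
        · simp [hk, hk', hu, ht, Store.out, onto]
    rw [e]
  constructor
  · rintro ⟨t, ⟨i, r, hi, ht⟩, u, hu, v, hv, h⟩
    have tb : t b = r := by rw [ht, Store.out_self]
    rcases hu with ⟨l, h1, h2⟩ | ⟨h1, h2⟩
    · have hv' : v = Function.update t b (true :: l) := by rw [hv, h2]; simp
      rw [(hfl i r l hi t ht v hv').1 h, hi, ← tb, h1, binSucc_replicate_false]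
    · have hv' : v = Function.update t b [true] := by rw [hv, h2, h1]
      rw [(hfl i r [] hi t ht v hv').1 h, hi, ← tb, h1, List.append_nil, binSucc_replicate]
  · intro h
    rcases eq_replicate_true_append (s b) with ⟨i, hi⟩ | ⟨i, l, hi⟩
    · have hi' : s b = List.replicate i true ++ [] := by rw [hi, List.append_nil]
      refine ⟨_, ⟨i, [], hi', rfl⟩, _, .inr ⟨Store.out_self .., rfl⟩, _, rfl, ?_⟩
      refine (hfl i [] [] hi' _ rfl _ (by rw [Store.out_self])).2 ?_
      rw [h, hi, binSucc_replicate]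
    · refine ⟨_, ⟨i, _, hi, rfl⟩, _, .inl ⟨l, Store.out_self .., rfl⟩, _, rfl, ?_⟩
      refine (hfl i _ l hi _ rfl _ (by simp)).2 ?_
      rw [h, hi, binSucc_replicate_false]

end Prog

/-! ### The registers of the machine, and the evaluation of a body -/

/-- The stacks of the machine: the input, the prefix, a work stack of the loops, the output; the
guess and its copy, two unary counters; the insertions, the deletions, the assignment, the head, a
body, the facts and the tuple; the variables of positive and of negative literals; and auxiliary
stacks. -/
inductive Reg where
  | inp | pre | tmp | out | z | z2 | cnt | u | a | a' | d | d' | e | e' | h | h' | bd | bd' | c | c'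
  | t' | p | p' | n | n' | x | x' | y | g | f | v | q
  deriving DecidableEq

instance : Fintype Reg where
  elems := {.inp, .pre, .tmp, .out, .z, .z2, .cnt, .u, .a, .a', .d, .d', .e, .e', .h, .h', .bd,
    .bd', .c, .c', .t', .p, .p', .n, .n', .x, .x', .y, .g, .f, .v, .q}
  complete k := by cases k <;> simp

/-- The value of a variable under an assignment given by a list of pairs. -/
def assign (env : List (ℕ × ℕ)) (x : ℕ) : ℕ := (env.lookup x).getD 0

/-- The variable has a value. -/
def Assigned (env : List (ℕ × ℕ)) (x : ℕ) : Prop := ∃ w, env.lookup x = some w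

/-- All variables of the term have a value. -/
def Term.Assigned (env : List (ℕ × ℕ)) : Term → Prop
  | .var x => _root_.Assigned env x
  | .const _ => True

namespace Literal

variable {σ : Schema}

/-- All variables of the literal have a value. -/
def Assigned (env : List (ℕ × ℕ)) : Literal σ → Prop
  | rel _ _ args => ∀ i, (args i).Assigned env
  | eq _ s t => s.Assigned env ∧ t.Assigned env

/-- The literal is true under the assignment in the instance that is obtained from the facts `I` by
inserting `A` and then deleting `B`. -/
def HoldsIn (I A B : List (DBFact σ)) (env : List (ℕ × ℕ)) (α : Literal σ) : Prop :=
  α.Assigned env ∧ α.Holds ((I.toFinset ∪ A.toFinset) \ B.toFinset) (assign env)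

end Literal

namespace Prog

variable {σ : Schema} {N : ℕ} {s s' s₀ : Store Reg} {env : List (ℕ × ℕ)}
  {I A B : List (DBFact σ)}

/-- Read a variable from stack `bd` and push the code of its value on stack `b`. -/
def evalVar (b : Reg) : Prog Reg :=
  seq (readNat .bd [.x]) (lookup .e .e' .x .x' .y .g [b])

/-- Read a term from stack `bd` and push the code of its value on stack `b`. -/
def evalArg (b : Reg) : Prog Reg :=
  alt (seq (shift .bd false []) (evalVar b)) (seq (shift .bd true []) (readNat .bd [b]))

/-- Read an atom from stack `bd` and push the code of its value, a fact, on stack `f`. -/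
def evalAtom (σ : Schema) : Prog Reg :=
  altFin fun R : Fin σ.numRel => seq (readStr .bd [.f] (encNat R)) (rep (σ.arity R) (evalArg .f))

/-- Check that the fact on stack `f` is true in the updated instance. -/
def assertTrue (σ : Schema) : Prog Reg :=
  seq (copy .f .x' .v) (seq (assertNotMem (readFact σ) .d .q .v .x' .y .g)
    (alt (assertMem (readFact σ) .c .q .f .y) (assertMem (readFact σ) .a .q .f .y)))

/-- Check that the fact on stack `f` is false in the updated instance. -/
def assertFalse (σ : Schema) : Prog Reg :=
  alt (assertMem (readFact σ) .d .q .f .y)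
    (seq (copy .f .x' .v) (seq (assertNotMem (readFact σ) .c .q .v .x' .y .g)
      (assertNotMem (readFact σ) .a .q .f .x' .y .g)))

/-- Read a literal from stack `bd` and check that it is true. -/
def evalLiteral (σ : Schema) : Prog Reg :=
  alt
    (seq (shift .bd false [])
      (alt (seq (shift .bd true []) (seq (evalAtom σ) (assertTrue σ)))
        (seq (shift .bd false []) (seq (evalAtom σ) (assertFalse σ)))))
    (seq (shift .bd true [])
      (alt (seq (shift .bd true []) (seq (seq (evalArg .f) (evalArg .v)) (assertEq .f .v)))
        (seq (shift .bd false []) (seq (seq (evalArg .f) (evalArg .v)) (assertNe .f .v)))))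

/-- The store is prepared for the evaluation of a body. -/
structure Ready (N : ℕ) (env : List (ℕ × ℕ)) (I A B : List (DBFact σ)) (s : Store Reg) : Prop where
  e : s .e = encList encPair env
  c : s .c = encList encFact I
  a : s .a = encList encFact A
  d : s .d = encList encFact B
  length_e : (s .e).length ≤ N ^ 4
  short_c : Short N .c s
  short_a : Short N .a s
  short_d : Short N .d s
  e' : s .e' = []
  x : s .x = []
  x' : s .x' = []
  y : s .y = []
  g : s .g = []
  f : s .f = []
  v : s .v = []
  q : s .q = []

theorem Ready.short_e (h₀ : Ready N env I A B s₀) : Short N .e s₀ := by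
  rcases Nat.eq_zero_or_pos N with rfl | hN
  · exact h₀.length_e
  · exact h₀.length_e.trans (Nat.pow_le_pow_right hN (by norm_num))

theorem parses_evalVar (h₀ : Ready N env I A B s₀) {b : Reg} (hb : b = .f ∨ b = .v) :
    Parses N (Agree N s₀ .bd {.f, .v}) (evalVar b) .bd encNat (Assigned env)
      (fun x => onto [b] (encNat (assign env x))) := by
  have h1 := (Parses.readNat (N := N) (stable_agree N s₀ .bd {.f, .v, .x}) (fun _ h => h.1)
    (bs := [.x]) (by simp)).mono (I' := Agree N s₀ .bd {.f, .v})
    fun s hs => ⟨hs.1, fun k h1 h2 => hs.2 k h1 (by simp at h2 ⊢; tauto)⟩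
  refine (h1.check (Q := Assigned env) ?_).congr_pred (by simp)
  intro s v r s' hs _ hr
  have hk : ∀ k, k ≠ .bd → k ≠ .f → k ≠ .v → k ≠ .x →
      (s.out .bd r (onto [.x] (encNat v))) k = s₀ k := by
    intro k k1 k2 k3 k4
    rw [Store.out_of_ne _ k1, hs.2 k k1 (by simp [k2, k3])]
    simp [onto, k4]
  have hx : (s.out .bd r (onto [.x] (encNat v))) .x = (encNat v).reverse := by
    rw [Store.out_of_ne _ (by simp), hs.2 .x (by simp) (by simp), h₀.x]
    simp [onto]
  rw [rel_lookup (env := env) (v := v) (by decide) (by rcases hb with rfl | rfl <;> simp)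
    (by rw [hk _ (by simp) (by simp) (by simp) (by simp), h₀.e])
    (by rw [hk _ (by simp) (by simp) (by simp) (by simp), h₀.e']) hx
    (by rw [hk _ (by simp) (by simp) (by simp) (by simp), h₀.x'])
    (by rw [hk _ (by simp) (by simp) (by simp) (by simp), h₀.y])
    (by rw [hk _ (by simp) (by simp) (by simp) (by simp), h₀.g])
    (by rw [Short, hk _ (by simp) (by simp) (by simp) (by simp)]; exact h₀.short_e)
    (by
      have := hs.1
      rw [Short, hr, List.length_append] at this
      rw [Short, hx, List.length_reverse]; omega)]
  have e : ∀ w, (s.out .bd r (onto [.x] (encNat v))).out .x [] (onto [b] (encNat w)) =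
      s.out .bd r (onto [b] (encNat w)) := by
    intro w
    have hx' : s .x = [] := by rw [hs.2 .x (by simp) (by simp), h₀.x]
    funext k
    by_cases k1 : k = .x
    · subst k1
      rcases hb with rfl | rfl <;> simp [Store.out, onto, hx']
    by_cases k2 : k = .bd
    · subst k2
      rcases hb with rfl | rfl <;> simp [Store.out, onto]
    simp [Store.out, onto, k1, k2]
  simp only [e, Assigned, assign]
  constructor
  · rintro ⟨w, hw, rfl⟩
    exact ⟨⟨w, hw⟩, by simp [hw]⟩
  · rintro ⟨⟨w, hw⟩, rfl⟩
    exact ⟨w, hw, by simp [hw]⟩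

theorem parses_evalArg (h₀ : Ready N env I A B s₀) {b : Reg} (hb : b = .f ∨ b = .v) :
    Parses N (Agree N s₀ .bd {.f, .v}) (evalArg b) .bd encTerm (Term.Assigned env)
      (fun t => onto [b] (encNat (t.eval (assign env)))) := by
  have hst := stable_agree N s₀ .bd {.f, .v}
  have h1 := (Parses.shift Reg.bd false []).seqS hst (parses_evalVar h₀ hb)
    fun _ => onto_eq_nil (by simp) _
  have h2 := (Parses.shift Reg.bd true []).seqS hst (Parses.readNat (N := N) hst (fun _ h => h.1)
    (bs := [b]) (by rcases hb with rfl | rfl <;> simp)) fun _ => onto_eq_nil (by simp) _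
  refine (h1.alt h2).retype (Sum.elim (fun v => .var v.2) fun v => .const v.2) ?_ ?_ ?_ ?_
  · rintro (x | a)
    exacts [⟨.inl ((), x), rfl⟩, ⟨.inr ((), a), rfl⟩]
  · rintro (v | v) <;> rfl
  · rintro (v | v) <;> simp [Term.Assigned]
  · rintro (v | v) k - <;> simp [Term.eval, onto]

/-- The value of an atom. -/
def evalFact (env : List (ℕ × ℕ)) (v : Σ R : Fin σ.numRel, (Fin (σ.arity R) → Term)) :
    DBFact σ :=
  ⟨v.1, fun i => (v.2 i).eval (assign env)⟩

theorem parses_evalAtom (h₀ : Ready N env I A B s₀) :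
    Parses N (Agree N s₀ .bd {.f, .v}) (evalAtom σ) .bd
      (fun v : Σ R : Fin σ.numRel, (Fin (σ.arity R) → Term) => encNat v.1 ++ encTuple encTerm v.2)
      (fun v => ∀ i, (v.2 i).Assigned env) (fun v => onto [.f] (encFact (evalFact env v))) := by
  have hst := stable_agree N s₀ .bd {.f, .v}
  refine (Parses.altFin fun R : Fin σ.numRel => (Parses.readStr hst (bs := [.f]) (by simp)
    (encNat R)).seqS hst (Parses.rep hst (parses_evalArg h₀ (.inl rfl))
      (fun _ => onto_eq_nil (by simp) _) (σ.arity R)) (fun _ => onto_eq_nil (by simp) _)).retype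
    (fun v => ⟨v.1, v.2.2⟩) (fun v => ⟨⟨v.1, (), v.2⟩, rfl⟩) (fun v => rfl) (by simp) ?_
  rintro ⟨R, ⟨⟩, t⟩ k -
  simp only [flatMap_onto, onto_append, evalFact, encFact, encTuple]
  have : (List.ofFn fun i => (t i).eval (assign env)).flatMap encNat =
      (List.ofFn t).flatMap fun v => encNat (v.eval (assign env)) := by
    rw [show (fun i => (t i).eval (assign env)) =
        (fun v : Term => v.eval (assign env)) ∘ t from rfl,
      ← List.map_ofFn, List.flatMap_map]
  rw [this]

theorem exists_mem_reverse_eq {l : List (DBFact σ)} {F : DBFact σ} :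
    (∃ v ∈ l, (encFact F).reverse = (encFact v).reverse) ↔ F ∈ l := by
  simp only [List.reverse_inj, prefixFree_encFact.injective.eq_iff]
  simp

theorem forall_mem_reverse_ne {l : List (DBFact σ)} {F : DBFact σ} :
    (∀ v ∈ l, (encFact F).reverse ≠ (encFact v).reverse) ↔ F ∉ l := by
  rw [← exists_mem_reverse_eq]
  push Not
  rfl

theorem rel_assertMem_fact (h₀ : Ready N env I A B s₀) {F : DBFact σ} {L : List (DBFact σ)}
    {r w : Reg} (hs : ∀ k, k ≠ .bd → k ≠ .f → k ≠ .v → s k = s₀ k)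
    (hd : [r, .q, w, .y, .bd].Nodup) (hrf : r ≠ .f) (hrv : r ≠ .v)
    (hr : s₀ r = encList encFact L) (hrs : Short N r s₀) (hw : s w = (encFact F).reverse)
    (hws : Short N w s) :
    (assertMem (readFact σ) r .q w .y).Rel N s s' ↔ F ∈ L ∧ s' = Function.update s w [] := by
  simp only [List.nodup_cons, List.mem_cons, List.not_mem_nil, or_false, not_or] at hd
  obtain ⟨⟨n1, n2, n3, n4⟩, ⟨n5, -⟩, ⟨n6, n7⟩, -⟩ := hd
  have hrr := hs r n4 hrf hrv
  rw [rel_assertMem (copies_readFact σ N) prefixFree_encFact (by simp [n1, n2, n3, n5, n6])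
    (pl := L) (by rw [hrr, hr]) (by rw [hs _ (by simp) (by simp) (by simp), h₀.q])
    (by rw [hs _ (by simp) (by simp) (by simp), h₀.y]) (by rw [Short, hrr]; exact hrs) hws, hw,
    exists_mem_reverse_eq]

theorem rel_assertNotMem_fact (h₀ : Ready N env I A B s₀) {F : DBFact σ} {L : List (DBFact σ)}
    {r w : Reg} (hs : ∀ k, k ≠ .bd → k ≠ .f → k ≠ .v → s k = s₀ k)
    (hd : [r, .q, w, .x', .y, .g, .bd].Nodup) (hrf : r ≠ .f) (hrv : r ≠ .v)
    (hr : s₀ r = encList encFact L) (hrs : Short N r s₀) (hw : s w = (encFact F).reverse)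
    (hws : Short N w s) :
    (assertNotMem (readFact σ) r .q w .x' .y .g).Rel N s s' ↔
      F ∉ L ∧ s' = Function.update s w [] := by
  have hd' : [r, .q, w, .x', .y, .g].Nodup :=
    List.Nodup.sublist (List.sublist_append_left [r, .q, w, .x', .y, .g] [.bd]) hd
  have hrb : r ≠ .bd := by
    simp only [List.nodup_cons, List.mem_cons, not_or] at hd
    exact hd.1.2.2.2.2.2.1
  have hrr := hs r hrb hrf hrv
  rw [rel_assertNotMem (copies_readFact σ N) prefixFree_encFact hd'
    (pl := L) (by rw [hrr, hr]) (by rw [hs _ (by simp) (by simp) (by simp), h₀.q])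
    (by rw [hs _ (by simp) (by simp) (by simp), h₀.x'])
    (by rw [hs _ (by simp) (by simp) (by simp), h₀.y])
    (by rw [hs _ (by simp) (by simp) (by simp), h₀.g]) (by rw [Short, hrr]; exact hrs) hws, hw,
    forall_mem_reverse_ne]

/-- The fact on stack `f` is copied to stack `v` for the first of two tests. -/
theorem rel_copy_fact (h₀ : Ready N env I A B s₀) (hs : ∀ k, k ≠ .bd → k ≠ .f → s k = s₀ k)
    (hF : Short N .f s) {c : Prog Reg} :
    (seq (copy .f .x' .v) c).Rel N s s' ↔ c.Rel N (Function.update s .v (s .f)) s' := by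
  rw [rel_seq]
  simp only [rel_copy (by decide : Reg.f ≠ .x')
    (by decide : Reg.f ≠ .v) (by decide : Reg.x' ≠ .v) hF
    (show s .x' = [] by rw [hs _ (by simp) (by simp), h₀.x']), exists_eq_left]
  rw [hs .v (by simp) (by simp), h₀.v, List.append_nil]

theorem rel_assertTrue (h₀ : Ready N env I A B s₀) {F : DBFact σ}
    (hs : ∀ k, k ≠ .bd → k ≠ .f → s k = s₀ k) (hf : s .f = (encFact F).reverse)
    (hF : Short N .f s) :
    (assertTrue σ).Rel N s s' ↔
      F ∈ (I.toFinset ∪ A.toFinset) \ B.toFinset ∧ s' = Function.update s .f [] := by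
  have hs' : ∀ k, k ≠ .bd → k ≠ .f → k ≠ .v → s k = s₀ k := fun k h1 h2 _ => hs k h1 h2
  have hk : ∀ k, k ≠ .bd → k ≠ .f → k ≠ .v → (Function.update s .v (s .f)) k = s₀ k := by
    intro k k1 k2 k3
    rw [Function.update_of_ne k3, hs k k1 k2]
  have hu : Function.update (Function.update s .v (s .f)) .v [] = s := by
    rw [Function.update_idem, ← h₀.v, ← hs .v (by simp) (by simp), Function.update_eq_self]
  rw [assertTrue, rel_copy_fact h₀ hs hF, rel_seq]
  simp only [rel_assertNotMem_fact h₀ hk (w := .v) (by decide) (by decide) (by decide) h₀.d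
    h₀.short_d (F := F) (by simp [hf]) (by simpa [Short] using hF), hu, rel_alt, Finset.mem_sdiff,
    Finset.mem_union, List.mem_toFinset]
  constructor
  · rintro ⟨t, ⟨h1, rfl⟩, h2⟩
    rw [rel_assertMem_fact h₀ hs' (w := .f) (r := .c) (by decide) (by decide) (by decide) h₀.c
      h₀.short_c hf hF, rel_assertMem_fact h₀ hs' (w := .f) (r := .a) (by decide) (by decide)
      (by decide) h₀.a h₀.short_a hf hF] at h2
    tauto
  · rintro ⟨h1, h2⟩
    refine ⟨s, ⟨h1.2, rfl⟩, ?_⟩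
    rw [rel_assertMem_fact h₀ hs' (w := .f) (r := .c) (by decide) (by decide) (by decide) h₀.c
      h₀.short_c hf hF, rel_assertMem_fact h₀ hs' (w := .f) (r := .a) (by decide) (by decide)
      (by decide) h₀.a h₀.short_a hf hF]
    tauto

theorem rel_assertFalse (h₀ : Ready N env I A B s₀) {F : DBFact σ}
    (hs : ∀ k, k ≠ .bd → k ≠ .f → s k = s₀ k) (hf : s .f = (encFact F).reverse)
    (hF : Short N .f s) :
    (assertFalse σ).Rel N s s' ↔
      F ∉ (I.toFinset ∪ A.toFinset) \ B.toFinset ∧ s' = Function.update s .f [] := by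
  have hs' : ∀ k, k ≠ .bd → k ≠ .f → k ≠ .v → s k = s₀ k := fun k h1 h2 _ => hs k h1 h2
  have hk : ∀ k, k ≠ .bd → k ≠ .f → k ≠ .v → (Function.update s .v (s .f)) k = s₀ k := by
    intro k k1 k2 k3
    rw [Function.update_of_ne k3, hs k k1 k2]
  have hu : Function.update (Function.update s .v (s .f)) .v [] = s := by
    rw [Function.update_idem, ← h₀.v, ← hs .v (by simp) (by simp), Function.update_eq_self]
  rw [assertFalse, rel_alt, rel_copy_fact h₀ hs hF, rel_seq,
    rel_assertMem_fact h₀ hs' (w := .f) (r := .d) (by decide) (by decide) (by decide) h₀.d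
      h₀.short_d hf hF]
  simp only [rel_assertNotMem_fact h₀ hk (w := .v) (by decide) (by decide) (by decide) h₀.c
    h₀.short_c (F := F) (by simp [hf]) (by simpa [Short] using hF), hu, Finset.mem_sdiff,
    Finset.mem_union, List.mem_toFinset]
  constructor
  · rintro (h1 | ⟨t, ⟨h1, rfl⟩, h2⟩)
    · tauto
    · rw [rel_assertNotMem_fact h₀ hs' (w := .f) (r := .a) (by decide) (by decide) (by decide) h₀.a
        h₀.short_a hf hF] at h2
      tauto
  · rintro ⟨h1, h2⟩
    by_cases hB : F ∈ B
    · exact .inl ⟨hB, h2⟩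
    · refine .inr ⟨s, ⟨by tauto, rfl⟩, ?_⟩
      rw [rel_assertNotMem_fact h₀ hs' (w := .f) (r := .a) (by decide) (by decide) (by decide) h₀.a
        h₀.short_a hf hF]
      tauto

end Prog

/-! ### Satisfaction of a body -/

namespace Prog

variable {σ : Schema} {N : ℕ} {s s' s₀ : Store Reg} {env : List (ℕ × ℕ)}
  {I A B : List (DBFact σ)}

theorem flatMap_nil_fun {α β : Type} (l : List α) : (l.flatMap fun _ => ([] : List β)) = [] := by
  simp

theorem length_le_of_mem {α : Type} {e : α → List Bool} {v : α} {l : List α} (h : v ∈ l) :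
    (e v).length < (encList e l).length := by
  obtain ⟨l₁, l₂, rfl⟩ := List.append_of_mem h
  simp [encList]
  omega

theorem length_encNat_assign_le (env : List (ℕ × ℕ)) (x : ℕ) :
    (encNat (assign env x)).length ≤ (encList encPair env).length := by
  rcases h : env.lookup x with _ | w
  · simp [assign, h, encNat, encList]
  · obtain ⟨l₁, l₂, rfl, -⟩ := List.lookup_eq_some_iff.1 h
    have := length_le_of_mem (e := encPair) (v := (x, w)) (l := l₁ ++ (x, w) :: l₂) (by simp)
    simp only [assign, h, Option.getD_some]
    simp only [encPair, List.length_append] at this ⊢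
    omega

theorem length_encNat_eval_le (env : List (ℕ × ℕ)) (t : Term) :
    (encNat (t.eval (assign env))).length ≤ (encTerm t).length * (encList encPair env).length := by
  have he : 1 ≤ (encList encPair env).length := by simp [encList]
  cases t with
  | var x =>
    refine (length_encNat_assign_le env x).trans (Nat.le_mul_of_pos_left _ ?_)
    simp [encTerm]
  | const a =>
    refine le_trans ?_ (Nat.le_mul_of_pos_right _ he)
    simp [encTerm, Term.eval]

theorem length_flatMap_le {α : Type} (e e' : α → List Bool) (m : ℕ) (l : List α)
    (h : ∀ v ∈ l, (e v).length ≤ (e' v).length * m) :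
    (l.flatMap e).length ≤ (l.flatMap e').length * m := by
  induction l with
  | nil => simp
  | cons v l ih =>
    simp only [List.flatMap_cons, List.length_append, Nat.add_mul]
    exact Nat.add_le_add (h v (by simp)) (ih fun v hv => h v (by simp [hv]))

theorem length_encFact_evalFact_le (env : List (ℕ × ℕ))
    (v : Σ R : Fin σ.numRel, (Fin (σ.arity R) → Term)) :
    (encFact (evalFact env v)).length ≤
      (encNat v.1 ++ encTuple encTerm v.2).length * (encList encPair env).length := by
  have he : 1 ≤ (encList encPair env).length := by simp [encList]
  have h1 : (evalFact env v).2 = (fun t : Term => t.eval (assign env)) ∘ v.2 := rfl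
  simp only [encFact, List.length_append, Nat.add_mul]
  refine Nat.add_le_add (Nat.le_mul_of_pos_right _ he) ?_
  have h2 : encTuple encNat (evalFact env v).2 = (List.ofFn v.2).flatMap
      fun t => encNat (t.eval (assign env)) := by
    rw [h1]
    unfold encTuple
    exact (congrArg (List.flatMap encNat) (List.map_ofFn ..).symm).trans (List.flatMap_map ..)
  rw [h2]
  exact length_flatMap_le _ _ _ _ fun t _ => length_encNat_eval_le env t

theorem le_pow_eight {m n : ℕ} (hm : m ≤ N) (hn : n ≤ N ^ 4) : m * n ≤ N ^ 8 := by
  rcases Nat.eq_zero_or_pos N with rfl | hN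
  · simp at hm; simp [hm]
  · calc m * n ≤ N * N ^ 4 := Nat.mul_le_mul hm hn
      _ = N ^ 5 := by ring
      _ ≤ N ^ 8 := Nat.pow_le_pow_right hN (by norm_num)

/-- The stores that agree with `s₀` except on stack `bd`, which is no longer than the input. -/
def AgreeBody (N : ℕ) (s₀ : Store Reg) (s : Store Reg) : Prop :=
  (s .bd).length ≤ N ∧ ∀ k, k ≠ .bd → s k = s₀ k

theorem stable_agreeBody (N : ℕ) (s₀ : Store Reg) : Stable (AgreeBody N s₀) .bd ∅ := by
  refine fun s r o hs hr ho => ⟨by rw [Store.out_self]; exact hr.trans hs.1, fun k hk => ?_⟩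
  rw [Store.out_of_ne s hk, ho k (by simp), hs.2 k hk]
  rfl

theorem AgreeBody.agree (S : Set Reg) (h : AgreeBody N s₀ s) : Agree N s₀ .bd S s := by
  refine ⟨?_, fun k hk _ => h.2 k hk⟩
  rcases Nat.eq_zero_or_pos N with rfl | hN
  · simpa [Short] using h.1
  · exact h.1.trans (by simpa using Nat.pow_le_pow_right hN (show 1 ≤ 8 by norm_num))

theorem out_update_nil (hs : AgreeBody N s₀ s) (h : s₀ .f = []) (r l : List Bool) :
    Function.update (s.out .bd r (onto [.f] l)) .f [] = s.out .bd r (fun _ => []) := by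
  funext k
  by_cases k1 : k = .f
  · subst k1; simp [Store.out, hs.2, h]
  · simp [k1, Store.out, onto]

theorem parses_evalAtom_true (h₀ : Ready N env I A B s₀) :
    Parses N (AgreeBody N s₀) (seq (evalAtom σ) (assertTrue σ)) .bd
      (fun v : Σ R : Fin σ.numRel, (Fin (σ.arity R) → Term) => encNat v.1 ++ encTuple encTerm v.2)
      (fun v => (∀ i, (v.2 i).Assigned env) ∧
        evalFact env v ∈ (I.toFinset ∪ A.toFinset) \ B.toFinset) (fun _ _ => []) := by
  refine ((parses_evalAtom h₀).mono fun s hs => hs.agree _).check ?_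
  intro s v r s' hs _ hr
  have hf : (s.out .bd r (onto [.f] (encFact (evalFact env v)))) .f =
      (encFact (evalFact env v)).reverse := by
    simp [Store.out, onto, hs.2 .f (by simp), h₀.f]
  rw [rel_assertTrue h₀ (F := evalFact env v) _ hf, out_update_nil hs h₀.f]
  · rw [Short, hf, List.length_reverse]
    have := hs.1
    rw [hr, List.length_append] at this
    exact (length_encFact_evalFact_le env v).trans
      (le_pow_eight (le_of_add_le_left this) (h₀.e ▸ h₀.length_e))
  · intro k k1 k2
    simp [Store.out, onto, k1, k2, hs.2 k k1]

theorem parses_evalAtom_false (h₀ : Ready N env I A B s₀) :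
    Parses N (AgreeBody N s₀) (seq (evalAtom σ) (assertFalse σ)) .bd
      (fun v : Σ R : Fin σ.numRel, (Fin (σ.arity R) → Term) => encNat v.1 ++ encTuple encTerm v.2)
      (fun v => (∀ i, (v.2 i).Assigned env) ∧
        evalFact env v ∉ (I.toFinset ∪ A.toFinset) \ B.toFinset) (fun _ _ => []) := by
  refine ((parses_evalAtom h₀).mono fun s hs => hs.agree _).check ?_
  intro s v r s' hs _ hr
  have hf : (s.out .bd r (onto [.f] (encFact (evalFact env v)))) .f =
      (encFact (evalFact env v)).reverse := by
    simp [Store.out, onto, hs.2 .f (by simp), h₀.f]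
  rw [rel_assertFalse h₀ (F := evalFact env v) _ hf, out_update_nil hs h₀.f]
  · rw [Short, hf, List.length_reverse]
    have := hs.1
    rw [hr, List.length_append] at this
    exact (length_encFact_evalFact_le env v).trans
      (le_pow_eight (le_of_add_le_left this) (h₀.e ▸ h₀.length_e))
  · intro k k1 k2
    simp [Store.out, onto, k1, k2, hs.2 k k1]

/-- The common part of the evaluation of equalities and inequalities. -/
theorem parses_evalArg_check (h₀ : Ready N env I A B s₀) {c : Prog Reg} {C : ℕ → ℕ → Prop}
    (hc : ∀ s s' m n, Short N .f s → Short N .v s → s .f = (encNat m).reverse →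
      s .v = (encNat n).reverse →
      (c.Rel N s s' ↔ C m n ∧ s' = Function.update (Function.update s .f []) .v [])) :
    Parses N (AgreeBody N s₀) (seq (seq (evalArg .f) (evalArg .v)) c) .bd
      (fun v : Term × Term => encTerm v.1 ++ encTerm v.2)
      (fun v => (v.1.Assigned env ∧ v.2.Assigned env) ∧
        C (v.1.eval (assign env)) (v.2.eval (assign env))) (fun _ _ => []) := by
  have hst := stable_agree N s₀ .bd {.f, .v}
  refine (((parses_evalArg h₀ (.inl rfl)).seqS hst (parses_evalArg h₀ (.inr rfl))
    fun _ => onto_eq_nil (by simp) _).mono fun s hs => hs.agree _).check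
    (Q := fun v => C (v.1.eval (assign env)) (v.2.eval (assign env))) ?_
  rintro s ⟨t, t'⟩ r s' hs - hr
  have hs1 := hs.1
  rw [hr, List.length_append, List.length_append] at hs1
  dsimp only at hs1
  have h1 := (length_encNat_eval_le env t).trans
    (le_pow_eight (by omega) (h₀.e ▸ h₀.length_e))
  have h2 := (length_encNat_eval_le env t').trans
    (le_pow_eight (by omega) (h₀.e ▸ h₀.length_e))
  have hf : (s.out .bd r fun k => onto [.f] (encNat (t.eval (assign env))) k ++
      onto [.v] (encNat (t'.eval (assign env))) k) .f = (encNat (t.eval (assign env))).reverse := by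
    simp [Store.out, onto, hs.2 .f (by simp), h₀.f]
  have hv : (s.out .bd r fun k => onto [.f] (encNat (t.eval (assign env))) k ++
      onto [.v] (encNat (t'.eval (assign env))) k) .v =
        (encNat (t'.eval (assign env))).reverse := by
    simp [Store.out, onto, hs.2 .v (by simp), h₀.v]
  rw [hc _ _ _ _ (by rw [Short, hf, List.length_reverse]; exact h1)
    (by rw [Short, hv, List.length_reverse]; exact h2) hf hv]
  have : Function.update (Function.update (s.out .bd r fun k =>
      onto [.f] (encNat (t.eval (assign env))) k ++
        onto [.v] (encNat (t'.eval (assign env))) k) .f []) .v [] = s.out .bd r (fun _ => []) := by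
    funext k
    by_cases k1 : k = .f
    · subst k1; simp [Store.out, hs.2, h₀.f]
    by_cases k2 : k = .v
    · subst k2; simp [Store.out, hs.2, h₀.v]
    simp [k1, k2, Store.out, onto]
  rw [this]

theorem parses_evalLiteral (h₀ : Ready N env I A B s₀) :
    Parses N (AgreeBody N s₀) (evalLiteral σ) .bd encLiteral
      (Literal.HoldsIn I A B env) (fun _ _ => []) := by
  have hst := stable_agreeBody N s₀
  have hE : ∀ m n : ℕ, (encNat m).reverse = (encNat n).reverse ↔ m = n := by
    intro m n
    rw [List.reverse_inj, prefixFree_encNat.injective.eq_iff]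
  have h1 := parses_evalAtom_true h₀
  have h2 := parses_evalAtom_false h₀
  have h3 := parses_evalArg_check h₀ (c := assertEq .f .v) (C := fun m n => m = n)
    fun s s' m n hf _ e1 e2 => by rw [rel_assertEq (by decide) hf, e1, e2, hE]
  have h4 := parses_evalArg_check h₀ (c := assertNe .f .v) (C := fun m n => m ≠ n)
    fun s s' m n hf hv e1 e2 => by rw [rel_assertNe (by decide) hf hv, e1, e2, ne_eq, hE]
  have hn : ∀ l : List Bool, ∀ k ∉ (∅ : Set Reg), onto [] l k = [] :=
    fun l => onto_eq_nil (by simp) l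
  have hsh := fun b => Parses.shift (N := N) (I := AgreeBody N s₀) Reg.bd b []
  have h5 := ((hsh false).seqS hst (((hsh true).seqS hst h1 fun _ => hn _).alt
    ((hsh false).seqS hst h2 fun _ => hn _)) fun _ => hn _).alt
    ((hsh true).seqS hst (((hsh true).seqS hst h3 fun _ => hn _).alt
    ((hsh false).seqS hst h4 fun _ => hn _)) fun _ => hn _)
  refine h5.retype
    (Sum.elim
      (fun v => Sum.elim (fun v => .rel true v.2.1 v.2.2) (fun v => .rel false v.2.1 v.2.2) v.2)
      (fun v => Sum.elim (fun v => .eq true v.2.1 v.2.2) (fun v => .eq false v.2.1 v.2.2) v.2))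
    ?_ ?_ ?_ ?_
  · rintro (⟨b, R, t⟩ | ⟨b, t, t'⟩) <;> cases b
    exacts [⟨.inl ((), .inr ((), ⟨R, t⟩)), rfl⟩, ⟨.inl ((), .inl ((), ⟨R, t⟩)), rfl⟩,
      ⟨.inr ((), .inr ((), (t, t'))), rfl⟩, ⟨.inr ((), .inl ((), (t, t'))), rfl⟩]
  · rintro (⟨-, ⟨-, v⟩ | ⟨-, v⟩⟩ | ⟨-, ⟨-, v⟩ | ⟨-, v⟩⟩) <;> rfl
  · rintro (⟨-, ⟨-, v⟩ | ⟨-, v⟩⟩ | ⟨-, ⟨-, v⟩ | ⟨-, v⟩⟩) <;>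
      simp [Literal.HoldsIn, Literal.Assigned, Literal.Holds, evalFact]
  · rintro (⟨-, ⟨-, v⟩ | ⟨-, v⟩⟩ | ⟨-, ⟨-, v⟩ | ⟨-, v⟩⟩) k - <;> simp [onto]

/-- Evaluate the head on stack `bd`, compare the result with the tuple on stack `t'`, and check the
literals that follow on stack `bd`. -/
def evaluate (σ : Schema) : Prog Reg :=
  seq (seq (readList .bd [.v] (evalVar .v)) (assertEq .t' .v))
    (seq (readList .bd [] (evalLiteral σ)) (empty .bd))

theorem Ready.congr (h₀ : Ready N env I A B s₀) (h : ∀ k, k ≠ .bd → k ≠ .t' → s k = s₀ k) :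
    Ready N env I A B s := by
  constructor
  all_goals try unfold Short
  all_goals rw [h _ (by simp) (by simp)]
  exacts [h₀.e, h₀.c, h₀.a, h₀.d, h₀.length_e, h₀.short_c, h₀.short_a, h₀.short_d, h₀.e', h₀.x,
    h₀.x', h₀.y, h₀.g, h₀.f, h₀.v, h₀.q]

theorem short_of_le {k : Reg} (h : (s k).length ≤ N) : Short N k s := by
  rcases Nat.eq_zero_or_pos N with rfl | hN
  · simpa [Short] using h
  · exact h.trans (by simpa using Nat.pow_le_pow_right hN (show 1 ≤ 8 by norm_num))

/-- The program accepts if the assignment maps the head to the tuple and satisfies the body in the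
updated instance. -/
theorem rel_evaluate (h₀ : Ready N env I A B s) {head tuple : List ℕ} {body : List (Literal σ)}
    (hbd : s .bd = encList encNat head ++ encList encLiteral body) (hlen : (s .bd).length ≤ N)
    (ht : s .t' = (encList encNat tuple).reverse) (hts : (s .t').length ≤ N) :
    (evaluate σ).Rel N s s' ↔ ((∀ x ∈ head, Assigned env x) ∧ head.map (assign env) = tuple ∧
      ∀ α ∈ body, α.HoldsIn I A B env) ∧
      s' = Function.update (Function.update s .bd []) .t' [] := by
  have hs : AgreeBody N s s := ⟨hlen, fun _ _ => rfl⟩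
  have h1 := (parses_evalVar h₀ (.inr rfl)).readList (stable_agree N s .bd {.f, .v})
    (fun _ h => h.1) (bs := [.v]) (by simp) fun _ => onto_eq_nil (by simp) _
  -- the part of the program after the head has been evaluated
  have key : ∀ (l : List ℕ) (t : Store Reg), t = s.out .bd (encList encLiteral body)
      (fun k => (l.flatMap fun v => onto [.v] [true] k ++ onto [.v] (encNat (assign env v)) k) ++
        onto [.v] [false] k) →
      ((seq (assertEq .t' .v) (seq (readList .bd [] (evalLiteral σ)) (empty .bd))).Rel N t s' ↔
        (l.map (assign env) = tuple ∧ ∀ α ∈ body, α.HoldsIn I A B env) ∧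
          s' = Function.update (Function.update s .bd []) .t' []) := by
    intro l t h
    have tv : t .v = (encList encNat (l.map (assign env))).reverse := by
      rw [h]
      simp [Store.out, onto, h₀.v, encList, List.flatMap_map]
    have tt : t .t' = (encList encNat tuple).reverse := by
      rw [h]
      simp [Store.out, onto, ht]
    have tb : t .bd = encList encLiteral body := by rw [h, Store.out_self]
    have hE : (encList encNat tuple).reverse = (encList encNat (l.map (assign env))).reverse ↔
        l.map (assign env) = tuple := by
      rw [List.reverse_inj, (prefixFree_encList prefixFree_encNat).injective.eq_iff, eq_comm]
    rw [rel_seq]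
    simp only [rel_assertEq (by decide : Reg.t' ≠ .v)
      (short_of_le (show (t .t').length ≤ N by rw [tt, ← ht]; exact hts)), tv, tt, hE]
    -- the part of the program after the head has been compared with the tuple
    have key' : ∀ u : Store Reg, u = Function.update (Function.update t .t' []) .v [] →
        ((seq (readList .bd [] (evalLiteral σ)) (empty .bd)).Rel N u s' ↔
          (∀ α ∈ body, α.HoldsIn I A B env) ∧
            s' = Function.update (Function.update s .bd []) .t' []) := by
      intro u hu
      have ub : u .bd = encList encLiteral body := by rw [hu]; simp [tb]
      have h₁ : Ready N env I A B u := by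
        refine h₀.congr fun k k1 k2 => ?_
        by_cases k3 : k = .v
        · subst k3; simp [hu, h₀.v]
        · simp [hu, k1, k2, k3, h, Store.out, onto]
      have hu' : AgreeBody N u u := by
        refine ⟨?_, fun _ _ => rfl⟩
        rw [hbd, List.length_append] at hlen
        rw [ub]; omega
      have h2 := (parses_evalLiteral h₁).readList (stable_agreeBody N u)
        (fun s h => (h.agree ∅).1) (bs := []) (by simp) (by simp)
      rw [rel_seq]
      simp only [h2 u _ hu', Rel]
      have hn : ∀ (l : List (Literal σ)) r, u.out .bd r (fun k =>
          (l.flatMap fun v => onto [] [true] k ++ []) ++ onto [] [false] k) =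
          Function.update (Function.update (Function.update s .bd []) .t' []) .bd r := by
        intro l r
        funext k
        by_cases k1 : k = .bd
        · subst k1; simp
        by_cases k2 : k = .t'
        · subst k2; simp [Store.out, onto, hu]
        by_cases k3 : k = .v
        · subst k3; simp [Store.out, onto, hu, h₀.v]
        simp [Store.out, onto, hu, k1, k2, k3, h, flatMap_nil_fun]
      have hb : Function.update (Function.update (Function.update s .bd []) .t' []) .bd [] =
          Function.update (Function.update s .bd []) .t' [] := by
        rw [Function.update_comm (by decide), Function.update_idem,
          Function.update_comm (by decide)]
      simp only [hn]
      constructor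
      · rintro ⟨w, ⟨l, r, hl, hr, rfl⟩, hw, rfl⟩
        rw [Function.update_self] at hw
        subst hw
        rw [ub, List.append_nil] at hr
        obtain rfl := (prefixFree_encList prefixFree_encLiteral).injective hr
        exact ⟨hl, hb⟩
      · rintro ⟨hl, rfl⟩
        exact ⟨_, ⟨body, [], hl, by rw [ub, List.append_nil], rfl⟩, by simp, hb.symm⟩
    constructor
    · rintro ⟨u, ⟨e1, hu⟩, h3⟩
      exact ⟨⟨e1, ((key' u hu).1 h3).1⟩, ((key' u hu).1 h3).2⟩
    · rintro ⟨⟨e1, e2⟩, h3⟩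
      exact ⟨_, ⟨e1, rfl⟩, (key' _ rfl).2 ⟨e2, h3⟩⟩
  rw [evaluate, rel_seq]
  simp only [rel_seq, h1 s _ (hs.agree _)]
  constructor
  · rintro ⟨t, ⟨t₁, ⟨l, r, hl, hr, rfl⟩, h2⟩, h3⟩
    rw [hbd] at hr
    obtain ⟨rfl, rfl⟩ := prefixFree_encList prefixFree_encNat _ _ _ _ hr
    obtain ⟨⟨h4, h5⟩, h6⟩ := (key head _ rfl).1 ⟨t, h2, h3⟩
    exact ⟨⟨hl, h4, h5⟩, h6⟩
  · rintro ⟨⟨hl, h4, h5⟩, h6⟩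
    obtain ⟨t, h2, h3⟩ := (key head _ rfl).2 ⟨⟨h4, h5⟩, h6⟩
    exact ⟨t, ⟨_, ⟨head, _, hl, hbd, rfl⟩, h2⟩, h3⟩

end Prog

/-! ### Parsing terms, literals and safe bodies -/

/-- The variables of a term, as a list. -/
def Term.varList : Term → List ℕ
  | .var x => [x]
  | .const _ => []

theorem Term.mem_varList {t : Term} {x : ℕ} : x ∈ t.varList ↔ x ∈ t.vars := by
  cases t <;> simp [varList, vars]

namespace Literal

variable {σ : Schema}

/-- The variables of a literal, as a list. -/
def varList : Literal σ → List ℕ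
  | rel _ _ args => (List.ofFn args).flatMap Term.varList
  | eq _ s t => s.varList ++ t.varList

theorem mem_varList {α : Literal σ} {x : ℕ} : x ∈ α.varList ↔ x ∈ α.vars := by
  cases α with
  | rel b R args => simp [varList, vars, Term.mem_varList, List.mem_ofFn]
  | eq b s t => simp [varList, vars, Term.mem_varList]

/-- Whether the literal is positive. -/
def sign : Literal σ → Bool
  | rel b _ _ => b
  | eq b _ _ => b

theorem positive_iff_sign {α : Literal σ} : α.Positive ↔ α.sign = true := by
  cases α <;> rfl

/-- The variables of the literals of sign `b` in a body. -/
def signVars (b : Bool) (body : List (Literal σ)) : List ℕ :=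
  body.flatMap fun α => if α.sign = b then α.varList else []

theorem mem_signVars {b : Bool} {body : List (Literal σ)} {x : ℕ} :
    x ∈ signVars b body ↔ ∃ α ∈ body, α.sign = b ∧ x ∈ α.vars := by
  simp only [signVars, List.mem_flatMap]
  refine exists_congr fun α => and_congr_right fun _ => ?_
  split_ifs with h <;> simp [h, mem_varList]

/-- A rule with the given head and body is safe. -/
def Safe (head : List ℕ) (body : List (Literal σ)) : Prop :=
  ∀ x : ℕ, (x ∈ head ∨ ∃ α ∈ body, x ∈ α.vars) → ∃ α ∈ body, α.Positive ∧ x ∈ α.vars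

theorem safe_iff {head : List ℕ} {body : List (Literal σ)} :
    Safe head body ↔
      (∀ x ∈ signVars false body, x ∈ signVars true body) ∧ ∀ x ∈ head, x ∈ signVars true body := by
  simp only [Safe, mem_signVars, positive_iff_sign]
  constructor
  · intro h
    exact ⟨fun x ⟨α, hα, _, hx⟩ => h x (.inr ⟨α, hα, hx⟩), fun x hx => h x (.inl hx)⟩
  · rintro ⟨h1, h2⟩ x (hx | ⟨α, hα, hx⟩)
    · exact h2 x hx
    · by_cases hs : α.sign = true
      · exact ⟨α, hα, hs, hx⟩
      · exact h1 x ⟨α, hα, by simpa using hs, hx⟩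

end Literal

/-- The codes of the entries of a list, each preceded by `1`. -/
def encEntries {α : Type} (e : α → List Bool) (l : List α) : List Bool :=
  l.flatMap fun a => true :: e a

theorem encEntries_append {α : Type} (e : α → List Bool) (l l' : List α) :
    encEntries e (l ++ l') = encEntries e l ++ encEntries e l' := by
  simp [encEntries]

theorem encEntries_flatMap {α β : Type} (e : α → List Bool) (f : β → List α) (l : List β) :
    encEntries e (l.flatMap f) = l.flatMap fun b => encEntries e (f b) := by
  induction l with
  | nil => rfl
  | cons b l ih => simp [encEntries_append, ih]

theorem encList_eq_encEntries {α : Type} (e : α → List Bool) (l : List α) :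
    encList e l = encEntries e l ++ [false] := rfl

namespace Prog

variable {σ : Schema} {N : ℕ} {s s' s₀ : Store Reg}

/-- Copy a term from the input to the stacks `bs`, and its variable to stack `r`. -/
def readTerm (r : Reg) (bs : List Reg) : Prog Reg :=
  alt (seq (shift .inp false bs) (seq (emit true [r]) (readNat .inp (r :: bs))))
    (seq (shift .inp true bs) (readNat .inp bs))

/-- Copy an atom, without its sign, from the input to the stacks `bs`, and its variables to
stack `r`. -/
def readAtom (σ : Schema) (r : Reg) (bs : List Reg) : Prog Reg :=
  altFin fun R : Fin σ.numRel =>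
    seq (readStr .inp bs (encNat R)) (rep (σ.arity R) (readTerm r bs))

/-- Copy a literal from the input to the stacks `bs`, and its variables to stack `p'` if it is
positive and to stack `n'` otherwise. -/
def readLiteral (σ : Schema) (bs : List Reg) : Prog Reg :=
  alt
    (seq (shift .inp false bs)
      (alt (seq (shift .inp true bs) (readAtom σ .p' bs))
        (seq (shift .inp false bs) (readAtom σ .n' bs))))
    (seq (shift .inp true bs)
      (alt (seq (shift .inp true bs) (seq (readTerm .p' bs) (readTerm .p' bs)))
        (seq (shift .inp false bs) (seq (readTerm .n' bs) (readTerm .n' bs)))))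

/-- Check that the entries of the list of numbers on stack `r`, which is moved to `bs`, are entries
of the list on stack `p`. -/
def assertSubset (r : Reg) (bs : List Reg) : Prog Reg :=
  readList r bs (seq (readNat r (.x :: bs)) (assertMem readNat .p .q .x .y))

/-- Check that the rule is safe whose variables are found on stacks `p'`, `n'` and `h`. -/
def assertSafe : Prog Reg :=
  seq (emit false [.p']) (seq (emit false [.n']) (seq (moveAll .p' [.p]) (seq (moveAll .n' [.n])
    (seq (assertSubset .n []) (seq (seq (assertSubset .h [.h']) (moveAll .h' [.h]))
      (moveAll .p []))))))

/-- Copy a body from the input to the stacks `bs`, and check that it is safe. -/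
def readBody (σ : Schema) (bs : List Reg) : Prog Reg :=
  seq (readList .inp bs (readLiteral σ bs)) assertSafe

theorem parses_readTerm {I : Store Reg → Prop} {S : Set Reg} (hS : Stable I .inp S)
    (hI : ∀ s, I s → Short N .inp s) {r : Reg} (hr : r ≠ .inp) {bs : List Reg}
    (hb : ∀ k ∈ r :: bs, k ∈ S) (hrb : r ∉ bs) :
    Parses N I (readTerm r bs) .inp encTerm (fun _ => True)
      (fun t k => onto bs (encTerm t) k ++ onto [r] (encEntries encNat t.varList) k) := by
  have hb' : ∀ k ∈ bs, k ∈ S := fun k hk => hb k (by simp [hk])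
  have h1 := (Parses.shift Reg.inp false bs).seqS hS ((Parses.emit true (bs := [r])
    (by simpa using hr.symm)).seqS hS (Parses.readNat (N := N) hS hI hb)
      fun _ => onto_eq_nil (fun k hk => hb k (by simp at hk; simp [hk])) _)
    fun _ => onto_eq_nil hb' _
  have h2 := (Parses.shift Reg.inp true bs).seqS hS (Parses.readNat (N := N) hS hI hb')
    fun _ => onto_eq_nil hb' _
  refine (h1.alt h2).retype (Sum.elim (fun v => .var v.2.2) fun v => .const v.2) ?_ ?_ ?_ ?_
  · rintro (x | a)
    exacts [⟨.inl ((), (), x), rfl⟩, ⟨.inr ((), a), rfl⟩]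
  · rintro (v | v) <;> rfl
  · rintro (v | v) <;> simp
  · rintro (v | v) k -
    · by_cases k1 : k = r
      · subst k1; simp [onto, hrb, Term.varList, encEntries]
      · by_cases k2 : k ∈ bs <;> simp [onto, k1, k2, encTerm]
    · by_cases k2 : k ∈ bs <;> simp [onto, k2, encTerm, Term.varList, encEntries]

theorem parses_readAtom {I : Store Reg → Prop} {S : Set Reg} (hS : Stable I .inp S)
    (hI : ∀ s, I s → Short N .inp s) {r : Reg} (hr : r ≠ .inp) {bs : List Reg}
    (hb : ∀ k ∈ r :: bs, k ∈ S) (hrb : r ∉ bs) :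
    Parses N I (readAtom σ r bs) .inp
      (fun v : Σ R : Fin σ.numRel, (Fin (σ.arity R) → Term) => encNat v.1 ++ encTuple encTerm v.2)
      (fun _ => True) (fun v k => onto bs (encNat v.1 ++ encTuple encTerm v.2) k ++
        onto [r] (encEntries encNat ((List.ofFn v.2).flatMap Term.varList)) k) := by
  have hb' : ∀ k ∈ bs, k ∈ S := fun k hk => hb k (by simp [hk])
  have hb'' : ∀ k ∈ [r], k ∈ S := fun k hk => hb k (by simp at hk; simp [hk])
  refine (Parses.altFin fun R : Fin σ.numRel => (Parses.readStr hS hb' (encNat R)).seqS hS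
    (Parses.rep hS (parses_readTerm hS hI hr hb hrb)
      (fun v k hk => by rw [onto_eq_nil hb' _ k hk, onto_eq_nil hb'' _ k hk]; rfl)
      (σ.arity R)) (fun _ => onto_eq_nil hb' _)).retype
    (fun v => ⟨v.1, v.2.2⟩) (fun v => ⟨⟨v.1, (), v.2⟩, rfl⟩) (fun v => rfl) (by simp) ?_
  rintro ⟨R, ⟨⟩, t⟩ k -
  simp only [encTuple]
  by_cases k1 : k = r
  · subst k1
    simp [onto, hrb, encEntries_flatMap]
  · by_cases k2 : k ∈ bs <;> simp [onto, k1, k2]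

/-- The stack for the variables of literals of a sign. -/
def signReg : Bool → Reg
  | true => .p'
  | false => .n'

theorem parses_readLiteral {I : Store Reg → Prop} {S : Set Reg} (hS : Stable I .inp S)
    (hI : ∀ s, I s → Short N .inp s) {bs : List Reg} (hp : .p' ∈ S) (hn : .n' ∈ S)
    (hb : ∀ k ∈ bs, k ∈ S) (hpb : .p' ∉ bs) (hnb : .n' ∉ bs) :
    Parses N I (readLiteral σ bs) .inp (encLiteral (σ := σ)) (fun _ => True)
      (fun α k => onto bs (encLiteral α) k ++
        onto [signReg α.sign] (encEntries encNat α.varList) k) := by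
  have hbp : ∀ k ∈ Reg.p' :: bs, k ∈ S := by simpa using ⟨hp, hb⟩
  have hbn : ∀ k ∈ Reg.n' :: bs, k ∈ S := by simpa using ⟨hn, hb⟩
  have ho : ∀ b (l : List Bool), ∀ k ∉ S, onto [signReg b] l k = [] := by
    intro b l
    refine onto_eq_nil ?_ l
    cases b <;> simpa [signReg]
  have ha := fun (r : Reg) (h : r ≠ .inp) h' h'' => parses_readAtom (σ := σ) (N := N) hS hI
    (r := r) h (bs := bs) h' h''
  have ht := fun (r : Reg) (h : r ≠ .inp) h' h'' => parses_readTerm (N := N) hS hI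
    (r := r) h (bs := bs) h' h''
  have hpp := ht .p' (by decide) hbp hpb
  have hnn := ht .n' (by decide) hbn hnb
  have h3 := hpp.seqS hS hpp fun v k hk => by
    rw [onto_eq_nil hb _ k hk, onto_eq_nil (by simpa using hp) _ k hk]; rfl
  have h4 := hnn.seqS hS hnn fun v k hk => by
    rw [onto_eq_nil hb _ k hk, onto_eq_nil (by simpa using hn) _ k hk]; rfl
  have hsh := fun b => Parses.shift (N := N) (I := I) Reg.inp b bs
  have hn' : ∀ l : List Bool, ∀ k ∉ S, onto bs l k = [] := fun l => onto_eq_nil hb l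
  have h5 := ((hsh false).seqS hS
    (((hsh true).seqS hS (ha .p' (by decide) hbp hpb) fun _ => hn' _).alt
      ((hsh false).seqS hS (ha .n' (by decide) hbn hnb) fun _ => hn' _)) fun _ => hn' _).alt
    ((hsh true).seqS hS (((hsh true).seqS hS h3 fun _ => hn' _).alt
      ((hsh false).seqS hS h4 fun _ => hn' _)) fun _ => hn' _)
  refine h5.retype
    (Sum.elim
      (fun v => Sum.elim (fun v => .rel true v.2.1 v.2.2) (fun v => .rel false v.2.1 v.2.2) v.2)
      (fun v => Sum.elim (fun v => .eq true v.2.1 v.2.2) (fun v => .eq false v.2.1 v.2.2) v.2))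
    ?_ ?_ ?_ ?_
  · rintro (⟨b, R, t⟩ | ⟨b, t, t'⟩) <;> cases b
    exacts [⟨.inl ((), .inr ((), ⟨R, t⟩)), rfl⟩, ⟨.inl ((), .inl ((), ⟨R, t⟩)), rfl⟩,
      ⟨.inr ((), .inr ((), (t, t'))), rfl⟩, ⟨.inr ((), .inl ((), (t, t'))), rfl⟩]
  · rintro (⟨-, ⟨-, v⟩ | ⟨-, v⟩⟩ | ⟨-, ⟨-, v⟩ | ⟨-, v⟩⟩) <;> rfl
  · rintro (⟨-, ⟨-, v⟩ | ⟨-, v⟩⟩ | ⟨-, ⟨-, v⟩ | ⟨-, v⟩⟩) <;> simp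
  · rintro v k -
    by_cases k1 : k ∈ bs
    · have k2 : k ≠ .p' := fun h => hpb (h ▸ k1)
      have k3 : k ≠ .n' := fun h => hnb (h ▸ k1)
      rcases v with (⟨-, ⟨-, v⟩ | ⟨-, v⟩⟩ | ⟨-, ⟨-, v⟩ | ⟨-, v⟩⟩) <;>
        simp [onto, encLiteral, Literal.sign, signReg, k1, k2, k3]
    · rcases v with (⟨-, ⟨-, v⟩ | ⟨-, v⟩⟩ | ⟨-, ⟨-, v⟩ | ⟨-, v⟩⟩) <;>
        simp [onto, Literal.sign, signReg, k1, Literal.varList, encEntries_append] <;>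
        split_ifs <;> rfl

theorem length_encEntries_varList_le (α : Literal σ) :
    (encEntries encNat α.varList).length ≤ (encLiteral α).length := by
  have ht : ∀ t : Term, (encEntries encNat t.varList).length ≤ (encTerm t).length * 1 := by
    intro t
    cases t <;> simp [Term.varList, encEntries, encTerm]
  cases α with
  | rel b R args =>
    have := length_flatMap_le (fun t : Term => encEntries encNat t.varList) encTerm 1
      (List.ofFn args) fun t _ => ht t
    simp only [Literal.varList, encEntries_flatMap, encLiteral, List.length_cons,
      List.length_append, encTuple]
    omega
  | eq b t t' =>
    have h1 := ht t
    have h2 := ht t'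
    simp only [Literal.varList, encEntries_append, encLiteral, List.length_cons,
      List.length_append]
    omega

theorem length_encEntries_signVars_lt (b : Bool) (body : List (Literal σ)) :
    (encEntries encNat (Literal.signVars b body)).length < (encList encLiteral body).length := by
  rw [encList_eq_encEntries, Literal.signVars, encEntries_flatMap, List.length_append,
    List.length_singleton, Nat.lt_succ_iff]
  have := length_flatMap_le (fun α : Literal σ => encEntries encNat
    (if α.sign = b then α.varList else [])) (fun α => true :: encLiteral α) 1 body (by
      intro α _
      have := length_encEntries_varList_le α
      split_ifs
      · simp; omega
      · simp [encEntries])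
  simpa [encEntries] using this

theorem parses_assertSubset {r : Reg} {bs : List Reg}
    (h : (r = .n ∧ bs = []) ∨ (r = .h ∧ bs = [.h'])) {pl : List ℕ}
    (hp : s₀ .p = encList encNat pl) (hps : Short N .p s₀) (hq : s₀ .q = []) (hx : s₀ .x = [])
    (hy : s₀ .y = []) :
    Parses N (Agree N s₀ r {k | k ∈ bs}) (assertSubset r bs) r (encList encNat)
      (fun l => ∀ v ∈ l, v ∈ pl) (fun l => onto bs (encList encNat l)) := by
  have h1 := (Parses.readNat (N := N) (stable_agree N s₀ r {k | k ∈ Reg.x :: bs}) (fun _ h => h.1)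
    (bs := .x :: bs) (fun k hk => hk)).mono (I' := Agree N s₀ r {k | k ∈ bs})
    fun s hs => ⟨hs.1, fun k h1 h2 => hs.2 k h1 (by simp at h2 ⊢; tauto)⟩
  have h2 := (h1.check (d := assertMem readNat .p .q .x .y) (Q := fun v => v ∈ pl)
    (o' := fun v => onto bs (encNat v)) ?_).congr_pred (P'' := fun v => v ∈ pl) (by simp)
  · exact h2.readList_copy (stable_agree N s₀ r {k | k ∈ bs}) (fun _ h => h.1) (fun k hk => hk)
  intro s v a s' hs _ hr
  have tk : ∀ k, k ≠ r → k ∉ bs → k ≠ .x → (s.out r a (onto (.x :: bs) (encNat v))) k = s₀ k := by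
    intro k k1 k2 k3
    rw [Store.out_of_ne _ k1, hs.2 k k1 k2]
    simp [onto, k2, k3]
  have tx : (s.out r a (onto (.x :: bs) (encNat v))) .x = (encNat v).reverse := by
    have k1 : Reg.x ≠ r := by rcases h with ⟨rfl, rfl⟩ | ⟨rfl, rfl⟩ <;> simp
    have k2 : Reg.x ∉ bs := by rcases h with ⟨rfl, rfl⟩ | ⟨rfl, rfl⟩ <;> simp
    rw [Store.out_of_ne _ k1, hs.2 .x k1 k2, hx]
    simp [onto]
  have tk' : ∀ k, k = .p ∨ k = .q ∨ k = .y →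
      (s.out r a (onto (.x :: bs) (encNat v))) k = s₀ k := by
    intro k hk
    apply tk <;> rcases h with ⟨rfl, rfl⟩ | ⟨rfl, rfl⟩ <;> rcases hk with rfl | rfl | rfl <;> simp
  rw [rel_assertMem (copies_readNat N) prefixFree_encNat (by decide) (pl := pl)
    (by rw [tk' _ (by simp), hp]) (by rw [tk' _ (by simp), hq]) (by rw [tk' _ (by simp), hy])
    (by rw [Short, tk' _ (by simp)]; exact hps)
    (by
      have := hs.1
      rw [Short, hr, List.length_append] at this
      rw [Short, tx, List.length_reverse]; omega), tx]
  have hE : (∃ w ∈ pl, (encNat v).reverse = (encNat w).reverse) ↔ v ∈ pl := by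
    simp only [List.reverse_inj, prefixFree_encNat.injective.eq_iff]
    simp
  have : Function.update (s.out r a (onto (.x :: bs) (encNat v))) .x [] =
      s.out r a (onto bs (encNat v)) := by
    have hx' : s .x = [] := by
      rw [hs.2 .x, hx] <;> rcases h with ⟨rfl, rfl⟩ | ⟨rfl, rfl⟩ <;> simp
    funext k
    by_cases k1 : k = .x
    · subst k1
      rcases h with ⟨rfl, rfl⟩ | ⟨rfl, rfl⟩ <;> simp [Store.out, onto, hx']
    · simp [Store.out, onto, k1]
  rw [hE, this]

theorem rel_emit_singleton {b : Bool} {k : Reg} :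
    (emit b [k]).Rel N s s' ↔ s' = Function.update s k (b :: s k) := by
  have : s.emit [k] b = Function.update s k (b :: s k) := by
    funext k'
    by_cases hk : k' = k
    · subst hk; simp [Store.emit]
    · simp [Store.emit, hk]
  rw [Rel, this]

theorem rel_seq_emit {b : Bool} {k : Reg} {c : Prog Reg} :
    (seq (emit b [k]) c).Rel N s s' ↔ c.Rel N (Function.update s k (b :: s k)) s' := by
  simp only [rel_seq, rel_emit_singleton, exists_eq_left]

theorem rel_seq_rewind {k l : Reg} (hp : k ≠ l) (h : Short N l s) {c : Prog Reg} :
    (seq (moveAll l [k]) c).Rel N s s' ↔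
      c.Rel N (Function.update (Function.update s k ((s l).reverse ++ s k)) l []) s' := by
  simp only [rel_seq, rel_rewind hp h, exists_eq_left]

theorem rel_assertSafe {pv nv head : List ℕ} (hp' : s .p' = (encEntries encNat pv).reverse)
    (hn' : s .n' = (encEntries encNat nv).reverse) (hh : s .h = encList encNat head)
    (hp : s .p = []) (hn : s .n = []) (hh' : s .h' = []) (hq : s .q = []) (hx : s .x = [])
    (hy : s .y = []) (hps : (encList encNat pv).length ≤ N ^ 8)
    (hns : (encList encNat nv).length ≤ N ^ 8) (hhs : Short N .h s) :
    assertSafe.Rel N s s' ↔ ((∀ x ∈ nv, x ∈ pv) ∧ ∀ x ∈ head, x ∈ pv) ∧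
      s' = Function.update (Function.update s .p' []) .n' [] := by
  let t : Store Reg := Function.update (Function.update (Function.update (Function.update s .p' [])
    .n' []) .p (encList encNat pv)) .n (encList encNat nv)
  rw [assertSafe, rel_seq_emit, rel_seq_emit, rel_seq_rewind (by decide),
    rel_seq_rewind (by decide)]
  rotate_left
  · rw [Short]
    simp only [ne_eq, reduceCtorEq, not_false_eq_true, Function.update_of_ne, Function.update_self,
      hn']
    simpa [encList_eq_encEntries] using hns
  · rw [Short]
    simp only [ne_eq, reduceCtorEq, not_false_eq_true, Function.update_of_ne, Function.update_self,
      hp']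
    simpa [encList_eq_encEntries] using hps
  have ht : ∀ u : Store Reg, (∀ k, u k = t k) → u = t := fun u h => funext h
  rw [ht (Function.update _ _ _)]
  rotate_left
  · intro k
    by_cases k1 : k = .n
    · subst k1; simp [t, hn', hn, encList_eq_encEntries]
    by_cases k2 : k = .p
    · subst k2; simp [t, hp', hp, encList_eq_encEntries]
    by_cases k3 : k = .n'
    · subst k3; simp [t]
    by_cases k4 : k = .p'
    · subst k4; simp [t]
    simp [t, k1, k2, k3, k4]
  rw [rel_seq]
  have h2 := parses_assertSubset (N := N) (s₀ := t) (r := .n) (bs := []) (.inl ⟨rfl, rfl⟩)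
    (pl := pv) (by simp [t]) (by simpa [t, Short] using hps) (by simp [t, hq]) (by simp [t, hx])
    (by simp [t, hy])
  simp only [h2 t _ ⟨by simpa [t, Short] using hns, fun _ _ _ => rfl⟩]
  have h3 : ∀ u : Store Reg, u = Function.update t .n [] →
      ((seq (seq (assertSubset .h [.h']) (moveAll .h' [.h])) (moveAll .p [])).Rel N u s' ↔
        (∀ x ∈ head, x ∈ pv) ∧ s' = Function.update (Function.update s .p' []) .n' []) := by
    intro u hu
    have h4 := parses_assertSubset (N := N) (s₀ := u) (r := .h) (bs := [.h']) (.inr ⟨rfl, rfl⟩)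
      (pl := pv) (by simp [hu, t]) (by simpa [hu, t, Short] using hps) (by simp [hu, t, hq])
      (by simp [hu, t, hx]) (by simp [hu, t, hy])
    have uh : u .h = encList encNat head := by simp [hu, t, hh]
    have uh' : u .h' = [] := by simp [hu, t, hh']
    simp only [rel_seq, h4 u _ ⟨by rw [Short, uh, ← hh]; exact hhs, fun _ _ _ => rfl⟩, uh]
    have h5 : ∀ w : Store Reg, w = u.out .h [] (onto [.h'] (encList encNat head)) →
        ((∃ v, (moveAll .h' [.h]).Rel N w v ∧ (moveAll .p []).Rel N v s') ↔
          s' = Function.update (Function.update s .p' []) .n' []) := by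
      intro w hw
      have wh : w .h' = (encList encNat head).reverse := by simp [hw, Store.out, onto, uh']
      have wp : w .p = encList encNat pv := by simp [hw, Store.out, onto, hu, t]
      simp only [rel_rewind (by decide : Reg.h ≠ .h') (show Short N .h' w by
        rw [Short, wh, List.length_reverse, ← hh]; exact hhs), exists_eq_left]
      rw [rel_clear (by rw [Short]; simpa [wp] using hps)]
      refine Eq.congr_right ?_
      funext k
      by_cases k1 : k = .n
      · subst k1; simp [hn, hw, Store.out, hu, onto]
      by_cases k2 : k = .p
      · subst k2; simp [hp]
      by_cases k3 : k = .h
      · subst k3; simp [wh, hh, show w .h = [] by simp [hw]]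
      by_cases k4 : k = .h'
      · subst k4; simp [hh']
      simp [hw, hu, t, k1, k2, k3, k4, Store.out, onto]
    constructor
    · rintro ⟨v, ⟨w, ⟨l, r, hl, hr, hw⟩, h6⟩, h7⟩
      obtain ⟨rfl, rfl⟩ := prefixFree_encList prefixFree_encNat head l [] r
        (by rw [List.append_nil, hr])
      exact ⟨hl, (h5 w hw).1 ⟨v, h6, h7⟩⟩
    · rintro ⟨hl, h6⟩
      obtain ⟨v, h7, h8⟩ := (h5 _ rfl).2 h6
      exact ⟨v, ⟨_, ⟨head, [], hl, by rw [List.append_nil], rfl⟩, h7⟩, h8⟩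
  have tn : t .n = encList encNat nv := by simp [t]
  have hout : ∀ (l : List ℕ) r, t.out .n r (onto [] (encList encNat l)) =
      Function.update t .n r := by
    intro l r
    funext k
    by_cases hk : k = .n
    · subst hk; simp
    · simp [Store.out, onto, hk]
  simp only [hout, tn]
  constructor
  · rintro ⟨u, ⟨l, r, hl, hr, hu⟩, h6⟩
    obtain ⟨rfl, rfl⟩ := prefixFree_encList prefixFree_encNat nv l [] r
      (by rw [List.append_nil, hr])
    obtain ⟨h7, h8⟩ := (h3 u hu).1 h6
    exact ⟨⟨hl, h7⟩, h8⟩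
  · rintro ⟨⟨hl, h7⟩, h8⟩
    exact ⟨_, ⟨nv, [], hl, by rw [List.append_nil], rfl⟩, (h3 _ rfl).2 ⟨h7, h8⟩⟩

end Prog

/-! ### Parsing the input -/

namespace Prog

variable {σ : Schema} {N : ℕ} {s s' s₀ : Store Reg}

/-- Read the bodies of the rules from the input, check that the rules are safe, and copy one of the
bodies to stack `bd'`. -/
def readBodies (σ : Schema) : Prog Reg :=
  seq (many (seq (shift .inp true []) (readBody σ [])))
    (seq (shift .inp true []) (seq (readBody σ [.bd'])
      (seq (many (seq (shift .inp true []) (readBody σ []))) (shift .inp false []))))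

/-- Read the input. The head and one of the bodies are left on stack `bd`, the facts on stack `c`,
and the reversed code of the tuple on stack `t'`. -/
def readInput (σ : Schema) : Prog Reg :=
  seq (readList .inp [.h'] (readNat .inp [.h'])) (seq (moveAll .h' [.h])
    (seq (seq (readBodies σ) (seq (readList .inp [.c'] (readFact σ .inp [.c']))
      (readList .inp [.t'] (readNat .inp [.t']))))
      (seq (empty .inp) (seq (moveAll .c' [.c]) (seq (moveAll .bd' [.bd])
        (seq (moveAll .h [.h']) (moveAll .h' [.bd])))))))

/-- The stores that agree with `s₀` except on the input, which has length at most `N`, and on the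
stacks to which it is copied. -/
def AgreeInput (N : ℕ) (s₀ : Store Reg) (s : Store Reg) : Prop :=
  (s .inp).length ≤ N ∧ ∀ k, k ≠ .inp → k ∉ ({.bd', .c', .t'} : Set Reg) → s k = s₀ k

theorem stable_agreeInput (N : ℕ) (s₀ : Store Reg) :
    Stable (AgreeInput N s₀) .inp {.bd', .c', .t'} := by
  refine fun s r o hs hr ho => ⟨by rw [Store.out_self]; exact hr.trans hs.1, fun k hk hS => ?_⟩
  rw [Store.out_of_ne s hk, ho k hS, hs.2 k hk hS]
  rfl

theorem AgreeInput.short (h : AgreeInput N s₀ s) : Short N .inp s := short_of_le h.1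

/-- The store is prepared for checking that the rules are safe. -/
structure HeadReady (N : ℕ) (head : List ℕ) (s : Store Reg) : Prop where
  h : s .h = encList encNat head
  length_h : (s .h).length ≤ N
  p : s .p = []
  p' : s .p' = []
  n : s .n = []
  n' : s .n' = []
  h' : s .h' = []
  q : s .q = []
  x : s .x = []
  y : s .y = []

theorem pow_one_le_pow_eight {m : ℕ} (h : m ≤ N) : m ≤ N ^ 8 := by
  rcases Nat.eq_zero_or_pos N with rfl | hN
  · simpa using h
  · exact h.trans (by simpa using Nat.pow_le_pow_right hN (show 1 ≤ 8 by norm_num))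

theorem parses_readBody {head : List ℕ} (h₀ : HeadReady N head s₀) {bs : List Reg}
    (hbs : bs = [] ∨ bs = [.bd']) :
    Parses N (AgreeInput N s₀) (readBody σ bs) .inp (encList (encLiteral (σ := σ)))
      (Literal.Safe head) (fun body => onto bs (encList encLiteral body)) := by
  have hb : ∀ k ∈ bs, k = .bd' := by rcases hbs with rfl | rfl <;> simp
  let S : Set Reg := {.bd', .c', .t', .p', .n'}
  have hst := stable_agree N s₀ .inp S
  have hS : ∀ k ∈ bs, k ∈ S := fun k hk => by simp [S, hb k hk]
  have hbk : ∀ k, k ≠ .bd' → k ∉ bs := fun k hk hk' => hk (hb k hk')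
  have h1 := (parses_readLiteral (σ := σ) hst (fun _ h => h.1) (bs := bs) (by simp [S])
    (by simp [S]) hS (hbk _ (by simp)) (hbk _ (by simp))).readList hst (fun _ h => h.1) hS
    fun α k hk => by
      rw [onto_eq_nil hS _ k hk, onto_eq_nil _ _ k hk, List.nil_append]
      cases α.sign <;> simp [signReg, S]
  refine ((h1.mono (I' := AgreeInput N s₀) fun s hs => ⟨hs.short, fun k h1 h2 =>
    hs.2 k h1 (by simp [S] at h2 ⊢; tauto)⟩).check (Q := Literal.Safe head) ?_).congr_pred (by simp)
  intro s body r s' hs _ hr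
  have hlen : (encList encLiteral body).length ≤ N := by
    have := hs.1
    rw [hr, List.length_append] at this
    omega
  generalize ht : (s.out .inp r fun k => (body.flatMap fun v => onto bs [true] k ++
    (onto bs (encLiteral v) k ++ onto [signReg v.sign] (encEntries encNat v.varList) k)) ++
      onto bs [false] k) = t
  have tk : ∀ k, k ≠ .inp → k ≠ .p' → k ≠ .n' → t k = (onto bs (encList encLiteral body) k).reverse
      ++ s k := by
    intro k k1 k2 k3
    have hn : ∀ (α : Literal σ) l, onto [signReg α.sign] l k = [] := by
      intro α l
      cases α.sign <;> simp [onto, signReg, k2, k3]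
    rw [← ht, Store.out_of_ne _ k1]
    congr 2
    simp only [hn, List.append_nil]
    by_cases hk : k ∈ bs <;> simp [onto, hk, encList]
  have tk' : ∀ k, k ≠ .inp → k ≠ .p' → k ≠ .n' → k ≠ .bd' → k ≠ .c' → k ≠ .t' → t k = s₀ k := by
    intro k k1 k2 k3 k4 k5 k6
    rw [tk k k1 k2 k3, hs.2 k k1 (by simp [k4, k5, k6])]
    simp [onto, hbk k k4]
  have tv : ∀ b, s (signReg b) = [] →
      t (signReg b) = (encEntries encNat (Literal.signVars b body)).reverse := by
    intro b hsb
    have k1 : signReg b ≠ .inp := by cases b <;> simp [signReg]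
    have k2 : signReg b ∉ bs := hbk _ (by cases b <;> simp [signReg])
    rw [← ht, Store.out_of_ne _ k1, hsb, List.append_nil, Literal.signVars, encEntries_flatMap]
    congr 1
    simp only [onto, k2, if_false, List.nil_append, List.append_nil]
    congr 1
    funext α
    cases α.sign <;> cases b <;> simp [signReg, encEntries]
  have sp : s .p' = [] := by rw [hs.2 _ (by simp) (by simp), h₀.p']
  have sn : s .n' = [] := by rw [hs.2 _ (by simp) (by simp), h₀.n']
  have hv : ∀ b, (encList encNat (Literal.signVars b body)).length ≤ N ^ 8 := by
    intro b
    have := length_encEntries_signVars_lt b body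
    rw [encList_eq_encEntries, List.length_append, List.length_singleton]
    exact pow_one_le_pow_eight (by omega)
  have th : t .h = encList encNat head := by
    rw [tk' _ (by simp) (by simp) (by simp) (by simp) (by simp) (by simp), h₀.h]
  rw [rel_assertSafe (tv true sp) (tv false sn) th
    (by rw [tk' _ (by simp) (by simp) (by simp) (by simp) (by simp) (by simp), h₀.p])
    (by rw [tk' _ (by simp) (by simp) (by simp) (by simp) (by simp) (by simp), h₀.n])
    (by rw [tk' _ (by simp) (by simp) (by simp) (by simp) (by simp) (by simp), h₀.h'])
    (by rw [tk' _ (by simp) (by simp) (by simp) (by simp) (by simp) (by simp), h₀.q])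
    (by rw [tk' _ (by simp) (by simp) (by simp) (by simp) (by simp) (by simp), h₀.x])
    (by rw [tk' _ (by simp) (by simp) (by simp) (by simp) (by simp) (by simp), h₀.y])
    (hv true) (hv false) (short_of_le (by rw [th, ← h₀.h]; exact h₀.length_h)),
    Literal.safe_iff]
  have : Function.update (Function.update t .p' []) .n' [] =
      s.out .inp r (onto bs (encList encLiteral body)) := by
    funext k
    by_cases k1 : k = .n'
    · subst k1; simp [Store.out, onto, hbk, sn]
    by_cases k2 : k = .p'
    · subst k2; simp [Store.out, onto, hbk, sp]
    by_cases k3 : k = .inp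
    · subst k3; simp [← ht]
    simp [k1, k2, tk, k3, Store.out]
  rw [this]

/-- The body to be satisfied is chosen nondeterministically; all bodies are checked to be safe. -/
theorem parses_readBodies {head : List ℕ} (h₀ : HeadReady N head s₀) :
    Parses N (AgreeInput N s₀) (readBodies σ) .inp
      (fun v : List (List (Literal σ)) × List (Literal σ) × List (List (Literal σ)) =>
        encList (encList encLiteral) (v.1 ++ v.2.1 :: v.2.2))
      (fun v => ∀ b ∈ v.1 ++ v.2.1 :: v.2.2, Literal.Safe head b)
      (fun v => onto [.bd'] (encList encLiteral v.2.1)) := by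
  have hst := stable_agreeInput N s₀
  have hn : ∀ l : List Bool, ∀ k ∉ ({.bd', .c', .t'} : Set Reg), onto [] l k = [] :=
    fun l => onto_eq_nil (by simp) l
  have hb : ∀ l : List Bool, ∀ k ∉ ({.bd', .c', .t'} : Set Reg), onto [.bd'] l k = [] :=
    fun l => onto_eq_nil (by simp) l
  have h1 : Parses N (AgreeInput N s₀) (seq (shift .inp true []) (readBody σ [])) .inp
      (fun b => true :: encList (encLiteral (σ := σ)) b) (Literal.Safe head) (fun _ _ => []) :=
    ((Parses.shift Reg.inp true []).seqS hst (parses_readBody h₀ (.inl rfl))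
      fun _ => hn _).retype Prod.snd (fun v => ⟨((), v), rfl⟩) (by simp) (by simp) (by simp [onto])
  have h2 : Parses N (AgreeInput N s₀) (many (seq (shift .inp true []) (readBody σ []))) .inp
      (encEntries (encList (encLiteral (σ := σ)))) (fun l => ∀ b ∈ l, Literal.Safe head b)
      (fun _ _ => []) :=
    (h1.many (by simp) (fun s v r hs _ hr => hst.out hs hr (by simp))
      (fun _ h => h.short)).congr_out (by simp)
  have h3 := h2.seqS hst ((Parses.shift Reg.inp true []).seqS hst
    ((parses_readBody (σ := σ) h₀ (.inr rfl)).seqS hst (h2.seqS hst (Parses.shift Reg.inp false [])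
      (by simp)) fun _ => hb _) fun _ => hn _) (by simp)
  refine h3.retype (fun v => (v.1, v.2.2.1, v.2.2.2.1))
    (fun v => ⟨(v.1, (), v.2.1, v.2.2, ()), rfl⟩) ?_ ?_ ?_
  · rintro ⟨l, -, b, l', -⟩
    simp [encEntries, encList]
  · rintro ⟨l, -, b, l', -⟩
    simp only [List.mem_append, List.mem_cons, true_and, and_true]
    constructor
    · exact fun h => ⟨fun b hb => h b (.inl hb), h b (.inr (.inl rfl)),
        fun b hb => h b (.inr (.inr hb))⟩
    · rintro ⟨h1, h2, h3⟩ b (hb | rfl | hb)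
      exacts [h1 b hb, h2, h3 b hb]
  · rintro ⟨l, -, b, l', -⟩ k -
    simp [onto]

/-- The program accepts exactly the codes of inputs, and leaves the facts, one of the rules and the
tuple on their stacks. -/
theorem rel_readInput (hlen : (s .inp).length ≤ N)
    (hs : ∀ k ∈ [Reg.h, .h', .p, .p', .n, .n', .q, .x, .y, .c, .c', .bd, .bd', .t'], s k = []) :
    (readInput σ).Rel N s s' ↔ ∃ (head : List ℕ) (L : List (List (Literal σ)))
      (body : List (Literal σ)) (R : List (List (Literal σ))) (facts : List (DBFact σ))
      (tuple : List ℕ), (∀ b ∈ L ++ body :: R, Literal.Safe head b) ∧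
      s .inp = encList encNat head ++ (encList (encList encLiteral) (L ++ body :: R) ++
        (encList encFact facts ++ encList encNat tuple)) ∧
      s' = Function.update (Function.update (Function.update (Function.update s .inp []) .c
        (encList encFact facts)) .bd (encList encNat head ++ encList encLiteral body)) .t'
        (encList encNat tuple).reverse := by
  have hlen' := short_of_le hlen
  have h1 := (Parses.readNat (N := N) (stable_short N Reg.inp Set.univ) (fun _ h => h)
    (bs := [.h']) (by simp)).readList_copy (stable_short N Reg.inp Set.univ) (fun _ h => h)
    (bs := [.h']) (by simp)
  -- the part of the program after the head has been read
  have key : ∀ head r, s .inp = encList encNat head ++ r → ∀ t : Store Reg,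
      t = s.out .inp r (onto [.h'] (encList encNat head)) →
      ((seq (moveAll .h' [.h])
        (seq (seq (readBodies σ) (seq (readList .inp [.c'] (readFact σ .inp [.c']))
          (readList .inp [.t'] (readNat .inp [.t']))))
          (seq (empty .inp) (seq (moveAll .c' [.c]) (seq (moveAll .bd' [.bd])
            (seq (moveAll .h [.h']) (moveAll .h' [.bd]))))))).Rel N t s' ↔
      ∃ (L : List (List (Literal σ)))
        (body : List (Literal σ)) (R : List (List (Literal σ))) (facts : List (DBFact σ))
        (tuple : List ℕ), (∀ b ∈ L ++ body :: R, Literal.Safe head b) ∧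
        r = encList (encList encLiteral) (L ++ body :: R) ++
          (encList encFact facts ++ encList encNat tuple) ∧
        s' = Function.update (Function.update (Function.update (Function.update s .inp []) .c
          (encList encFact facts)) .bd (encList encNat head ++ encList encLiteral body)) .t'
          (encList encNat tuple).reverse) := by
    intro head r hr t ht
    have hrl : (encList encNat head).length + r.length ≤ N := by
      rw [hr, List.length_append] at hlen
      exact hlen
    have th' : t .h' = (encList encNat head).reverse := by
      rw [ht]; simp [Store.out, onto, hs]
    rw [rel_seq_rewind (by decide) (short_of_le (by rw [th', List.length_reverse]; omega))]
    obtain ⟨u, hu⟩ : ∃ u : Store Reg,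
        Function.update (Function.update t .h ((t .h').reverse ++ t .h)) .h' [] = u := ⟨_, rfl⟩
    rw [hu]
    have uh : u .h = encList encNat head := by
      rw [← hu]; simp [ht, Store.out, onto, hs]
    have uk : ∀ k, k ≠ .h → k ≠ .h' → k ≠ .inp → u k = s k := by
      intro k k1 k2 k3
      rw [← hu]; simp [k1, k2, k3, ht, Store.out, onto]
    have ui : u .inp = r := by rw [← hu]; simp [ht]
    have h₀ : HeadReady N head u := by
      constructor
      · exact uh
      · rw [uh]; omega
      case h' => rw [← hu]; simp
      all_goals rw [uk _ (by simp) (by simp) (by simp)]; exact hs _ (by simp)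
    have hst := stable_agreeInput N u
    have hc : ∀ l : List Bool, ∀ k ∉ ({.bd', .c', .t'} : Set Reg), onto [.c'] l k = [] :=
      fun l => onto_eq_nil (by simp) l
    have hb : ∀ l : List Bool, ∀ k ∉ ({.bd', .c', .t'} : Set Reg), onto [.bd'] l k = [] :=
      fun l => onto_eq_nil (by simp) l
    have h2 := (copies_readFact σ N _ Reg.inp _ [.c'] hst (fun _ h => h.short)
      (by simp)).readList_copy hst (fun _ h => h.short) (by simp)
    have h3 := (copies_readNat N _ Reg.inp _ [.t'] hst (fun _ h => h.short)
      (by simp)).readList_copy hst (fun _ h => h.short) (by simp)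
    have h4 := (parses_readBodies (σ := σ) h₀).seqS hst (h2.seqS hst h3 fun _ => hc _) fun _ => hb _
    rw [rel_seq]
    simp only [h4 u _ ⟨by rw [ui]; omega, fun _ _ _ => rfl⟩, ui]
    have key' : ∀ (body : List (Literal σ)) (facts : List (DBFact σ)) (tuple : List ℕ),
        (encList encLiteral body).length ≤ N → (encList encFact facts).length ≤ N →
        ∀ r' v, v = u.out .inp r' (fun k => onto [.bd'] (encList encLiteral body) k ++
          (onto [.c'] (encList encFact facts) k ++ onto [.t'] (encList encNat tuple) k)) →
        ((seq (empty .inp) (seq (moveAll .c' [.c]) (seq (moveAll .bd' [.bd])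
            (seq (moveAll .h [.h']) (moveAll .h' [.bd]))))).Rel N v s' ↔ r' = [] ∧
        s' = Function.update (Function.update (Function.update (Function.update s .inp []) .c
          (encList encFact facts)) .bd (encList encNat head ++ encList encLiteral body)) .t'
          (encList encNat tuple).reverse) := by
      intro body facts tuple hbl hfl r' v hv
      have vk : ∀ k, k ≠ .inp → k ≠ .bd' → k ≠ .c' → k ≠ .t' → v k = u k := by
        intro k k1 k2 k3 k4
        rw [hv]; simp [Store.out, onto, k1, k2, k3, k4]
      have vb : v .bd' = (encList encLiteral body).reverse := by
        rw [hv]; simp [Store.out, onto, uk, hs]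
      have vc : v .c' = (encList encFact facts).reverse := by
        rw [hv]; simp [Store.out, onto, uk, hs]
      have vt : v .t' = (encList encNat tuple).reverse := by
        rw [hv]; simp [Store.out, onto, uk, hs]
      have vi : v .inp = r' := by rw [hv, Store.out_self]
      have vh : v .h = encList encNat head := by
        rw [vk _ (by simp) (by simp) (by simp) (by simp), uh]
      have vh' : v .h' = [] := by
        rw [vk _ (by simp) (by simp) (by simp) (by simp), h₀.h']
      have e1 : ∀ c : Prog Reg, (seq (empty .inp) c).Rel N v s' ↔ r' = [] ∧ c.Rel N v s' := by
        intro c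
        rw [rel_seq]
        simp only [Rel, vi]
        constructor
        · rintro ⟨_, ⟨h5, rfl⟩, h6⟩
          exact ⟨h5, h6⟩
        · rintro ⟨h5, h6⟩
          exact ⟨v, ⟨h5, rfl⟩, h6⟩
      rw [e1]
      refine and_congr_right fun h5 => ?_
      rw [rel_seq_rewind (by decide) (short_of_le (by rw [vc, List.length_reverse]; exact hfl)),
        rel_seq_rewind (by decide) (short_of_le (by simp [vb]; exact hbl)),
        rel_seq_rewind (by decide) (short_of_le (by simp [vh]; omega)),
        rel_rewind (by decide) (short_of_le (by simp [vh, vh']; omega))]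
      refine Eq.congr_right (funext fun k => ?_)
      by_cases k1 : k = .inp
      · subst k1; simp [vi, h5]
      by_cases k2 : k = .c
      · subst k2; simp [vc, vk, uk, hs]
      by_cases k3 : k = .bd
      · subst k3; simp [vb, vk, uk, hs, uh, h₀.h']
      by_cases k4 : k = .t'
      · subst k4; simp [vt]
      by_cases k5 : k = .h
      · subst k5; simp [hs]
      by_cases k6 : k = .h'
      · subst k6; simp [hs]
      by_cases k7 : k = .c'
      · subst k7; simp [hs]
      by_cases k8 : k = .bd'
      · subst k8; simp [hs]
      simp [k1, k2, k3, k4, k5, k6, k7, k8, vk, uk]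
    have hL : ∀ (L : List (List (Literal σ))) (body : List (Literal σ))
        (R : List (List (Literal σ))) (facts : List (DBFact σ)) (l : List Bool),
        r = encList (encList encLiteral) (L ++ body :: R) ++ (encList encFact facts ++ l) →
        (encList encLiteral body).length ≤ N ∧ (encList encFact facts).length ≤ N := by
      intro L body R facts l h
      have h5 := length_le_of_mem (e := encList encLiteral) (v := body) (l := L ++ body :: R)
        (by simp)
      rw [h, List.length_append, List.length_append] at hrl
      omega
    constructor
    · rintro ⟨v, ⟨⟨⟨L, body, R⟩, facts, tuple⟩, r', ⟨hsafe, -⟩, hr', hv⟩, h5⟩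
      have hr'' : r = encList (encList encLiteral) (L ++ body :: R) ++ (encList encFact facts ++
          (encList encNat tuple ++ r')) := by
        rw [hr']; simp
      obtain ⟨hbl, hfl⟩ := hL _ _ _ _ _ hr''
      obtain ⟨rfl, h6⟩ := (key' body facts tuple hbl hfl r' v hv).1 h5
      exact ⟨L, body, R, facts, tuple, hsafe, by rw [hr'', List.append_nil], h6⟩
    · rintro ⟨L, body, R, facts, tuple, hsafe, hr', h6⟩
      obtain ⟨hbl, hfl⟩ := hL _ _ _ _ _ hr'
      refine ⟨_, ⟨⟨⟨L, body, R⟩, facts, tuple⟩, [], ⟨hsafe, by simp, by simp⟩, ?_, rfl⟩,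
        (key' body facts tuple hbl hfl [] _ rfl).2 ⟨rfl, h6⟩⟩
      rw [hr', List.append_nil]
  rw [readInput, rel_seq]
  simp only [h1 s _ hlen']
  constructor
  · rintro ⟨t, ⟨head, r, -, hr, ht⟩, h2⟩
    obtain ⟨L, body, R, facts, tuple, h3, h4, h5⟩ := (key head r hr t ht).1 h2
    exact ⟨head, L, body, R, facts, tuple, h3, by rw [hr, h4], h5⟩
  · rintro ⟨head, L, body, R, facts, tuple, h3, h4, h5⟩
    exact ⟨_, ⟨head, _, by simp, h4, rfl⟩, (key head _ h4 _ rfl).2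
      ⟨L, body, R, facts, tuple, h3, rfl, h5⟩⟩

end Prog

/-! ### The program that accepts certificates -/

/-- A string that describes an update with `k` facts: `k` in unary, and then the code of the
update. -/
def certificate {σ : Schema} (k : ℕ) (A B : List (DBFact σ)) : List Bool :=
  List.replicate k true ++ false :: true :: (encList encFact A ++ encList encFact B)

/-- The string `w` is the code of an input, and some assignment of length at most `m` satisfies one
of the rules after the insertion of `A` and the deletion of `B`. -/
def Accepted {σ : Schema} (m : ℕ) (w : List Bool) (A B : List (DBFact σ)) : Prop :=
  ∃ (head : List ℕ) (L : List (List (Literal σ))) (body : List (Literal σ))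
    (R : List (List (Literal σ))) (facts : List (DBFact σ)) (tuple : List ℕ)
    (env : List (ℕ × ℕ)), (∀ b ∈ L ++ body :: R, Literal.Safe head b) ∧
    w = encList encNat head ++ (encList (encList encLiteral) (L ++ body :: R) ++
      (encList encFact facts ++ encList encNat tuple)) ∧
    (encList encPair env).length ≤ m ∧ (∀ x ∈ head, Assigned env x) ∧
    head.map (assign env) = tuple ∧ ∀ α ∈ body, α.HoldsIn facts A B env

namespace Prog

variable {σ : Schema} {N : ℕ} {s s' s₀ : Store Reg}

/-- Guess a certificate that continues the string on stack `pre`. -/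
def guessCert : Prog Reg :=
  seq (rep 4 (guess [.z, .z2] 1)) (seq (syncs .z2 .pre) (seq (empty .pre) (moveAll .z2 [])))

/-- Split the certificate on stack `z`: its unary number goes to stack `cnt`, and the reversed codes
of the two lists of facts go to stacks `a'` and `d'`; stack `u` counts the facts. -/
def readCert (σ : Schema) : Prog Reg :=
  seq (many (shift .z true [.cnt])) (seq (shift .z false []) (seq (shift .z true [])
    (seq (readList .z [.a'] (seq (emit true [.u]) (readFact σ .z [.a'])))
      (readList .z [.d'] (seq (emit true [.u]) (readFact σ .z [.d']))))))

/-- Check that the numbers on stacks `cnt` and `u`, in unary, are equal, and write this number in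
binary. -/
def count : Prog Reg :=
  seq (many (seq (shift .cnt true []) (seq (shift .u true []) (increment .out .q))))
    (seq (empty .cnt) (empty .u))

/-- Guess an assignment. -/
def guessEnv : Prog Reg :=
  seq (guess [.e] 2) (seq (readList .e [.e'] (readPair .e [.e'])) (seq (empty .e)
    (moveAll .e' [.e])))

/-- Guess a certificate and an assignment, and check that they are correct. The number of facts of
the update is written on stack `out`. -/
def solve (σ : Schema) : Prog Reg :=
  seq guessCert (seq (readCert σ) (seq (empty .z) (seq (moveAll .a' [.a]) (seq (moveAll .d' [.d])
    (seq count (seq guessEnv (seq (readInput σ) (evaluate σ))))))))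

theorem rel_seq_empty {k : Reg} {c : Prog Reg} :
    (seq (empty k) c).Rel N s s' ↔ s k = [] ∧ c.Rel N s s' := by
  rw [rel_seq]
  constructor
  · rintro ⟨_, ⟨h1, rfl⟩, h2⟩
    exact ⟨h1, h2⟩
  · rintro ⟨h1, h2⟩
    exact ⟨s, ⟨h1, rfl⟩, h2⟩

/-- Any string of length at most `4 * N ^ 2` that continues the given prefix can be guessed. -/
theorem rel_guessCert (hN : 2 ≤ N) (hz : s .z = []) (hz2 : s .z2 = []) :
    guessCert.Rel N s s' ↔ ∃ Z : List Bool, (Z.length ≤ 4 * N ^ 2 ∧ s .pre <+: Z) ∧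
      s' = Function.update (Function.update s .z Z) .pre [] := by
  have h8 : 4 * N ^ 2 ≤ N ^ 8 := by
    calc 4 * N ^ 2 ≤ N ^ 2 * N ^ 2 := Nat.mul_le_mul_right _ (by nlinarith)
      _ = N ^ 4 := by ring
      _ ≤ N ^ 8 := Nat.pow_le_pow_right (by omega) (by norm_num)
  have key : ∀ Z : List Bool, Z.length ≤ 4 * N ^ 2 → ∀ t, t = s.push [.z, .z2] Z →
      ((seq (syncs .z2 .pre) (seq (empty .pre) (moveAll .z2 []))).Rel N t s' ↔
        s .pre <+: Z ∧ s' = Function.update (Function.update s .z Z) .pre []) := by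
    intro Z hZ t ht
    have t2 : t .z2 = Z := by simp [ht, Store.push, hz2]
    have tp : t .pre = s .pre := by simp [ht, Store.push]
    rw [rel_seq]
    simp only [rel_syncs (by decide : Reg.z2 ≠ .pre)
      (show Short N .z2 t by rw [Short, t2]; exact hZ.trans h8), rel_seq_empty, t2, tp]
    have hfin : ∀ l u, l.length ≤ Z.length →
        u = Function.update (Function.update t .z2 l) .pre [] → ((moveAll .z2 []).Rel N u s' ↔
        s' = Function.update (Function.update s .z Z) .pre []) := by
      intro l u hl hu
      rw [rel_clear (by rw [Short, hu]; simpa using hl.trans (hZ.trans h8))]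
      refine Eq.congr_right (funext fun k => ?_)
      by_cases k1 : k = .z2
      · subst k1; simp [hz2]
      by_cases k2 : k = .pre
      · subst k2; simp [hu]
      by_cases k3 : k = .z
      · subst k3; simp [hu, ht, Store.push, hz]
      simp [hu, ht, Store.push, k1, k2, k3]
    constructor
    · rintro ⟨u, ⟨q, l, l', h1, h2, hu⟩, h3, h4⟩
      obtain rfl : l' = [] := by rw [hu, Function.update_self] at h3; exact h3
      rw [List.append_nil] at h2
      exact ⟨⟨l, by rw [h2, h1]⟩, (hfin l u (by rw [h1]; simp) hu).1 h4⟩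
    · rintro ⟨⟨l, h1⟩, h2⟩
      refine ⟨_, ⟨s .pre, l, [], h1.symm, by simp, rfl⟩, by simp, ?_⟩
      exact (hfin l _ (by rw [← h1]; simp) rfl).2 h2
  rw [guessCert, rel_seq]
  simp only [rel_rep_guess]
  constructor
  · rintro ⟨t, ⟨Z, hZ, ht⟩, h⟩
    obtain ⟨h1, h2⟩ := (key Z hZ t ht).1 h
    exact ⟨Z, ⟨hZ, h1⟩, h2⟩
  · rintro ⟨Z, ⟨hZ, h1⟩, h2⟩
    exact ⟨_, ⟨Z, hZ, rfl⟩, (key Z hZ _ rfl).2 ⟨h1, h2⟩⟩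

theorem flatMap_const_singleton {α β : Type} (b : β) (l : List α) :
    (l.flatMap fun _ => [b]) = List.replicate l.length b := by
  induction l with
  | nil => rfl
  | cons _ l ih => simp [List.replicate_succ, ih]

theorem parses_readCert :
    Parses N (Short N .z) (readCert σ) .z
      (fun v : ℕ × List (DBFact σ) × List (DBFact σ) => certificate v.1 v.2.1 v.2.2)
      (fun _ => True) (fun v k => onto [.cnt] (List.replicate v.1 true) k ++
        (onto [.a'] (encList encFact v.2.1) k ++ (onto [.d'] (encList encFact v.2.2) k ++
        onto [.u] (List.replicate (v.2.1.length + v.2.2.length) true) k))) := by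
  have hst := stable_short N Reg.z Set.univ
  have h0 := fun (r : Reg) => (copies_readFact σ N _ Reg.z _ [r] hst (fun _ h => h) (by simp))
  have h1 := fun (r : Reg) => ((((Parses.emit (N := N) (I := Short N .z) (a := Reg.z) true
    (bs := [.u]) (by simp)).seqS hst (h0 r) (by simp)).retype (e' := encFact) (P' := fun _ => True)
    (o' := fun v k => onto [.u] [true] k ++ onto [r] (encFact v) k) Prod.snd
    (fun v => ⟨((), v), rfl⟩) (by simp) (by simp) (by simp)).readList hst (fun _ h => h)
    (bs := [r]) (by simp) (by simp)).congr_out (o'' := fun l k =>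
      if k = r then encList encFact l else onto [.u] (List.replicate l.length true) k)
  have h1a := h1 .a' (by
    intro l k _
    by_cases k1 : k = .a'
    · subst k1; simp [onto, encList]
    · by_cases k2 : k = .u
      · subst k2; simp [onto, flatMap_const_singleton]
      · simp [onto, k1, k2])
  have h1d := h1 .d' (by
    intro l k _
    by_cases k1 : k = .d'
    · subst k1; simp [onto, encList]
    · by_cases k2 : k = .u
      · subst k2; simp [onto, flatMap_const_singleton]
      · simp [onto, k1, k2])
  have h2 := (Parses.shift (N := N) Reg.z true [.cnt]).many (by simp)
    (fun s v r hs _ hr => hst.out hs hr (by simp)) (fun _ h => h)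
  have h3 := h2.seqS hst ((Parses.shift Reg.z false []).seqS hst
    ((Parses.shift Reg.z true []).seqS hst (h1a.seqS hst h1d (by simp)) (by simp)) (by simp))
    (by simp)
  refine h3.retype (fun v => (v.1.length, v.2.2.2.1, v.2.2.2.2))
    (fun v => ⟨(List.replicate v.1 (), (), (), v.2.1, v.2.2), by simp⟩) ?_ ?_ ?_
  · rintro ⟨l, -, -, A, B⟩
    simp [certificate, flatMap_const_singleton]
  · simp
  · rintro ⟨l, -, -, A, B⟩ k -
    by_cases k1 : k = .cnt
    · subst k1; simp [onto, flatMap_const_singleton]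
    by_cases k2 : k = .a'
    · subst k2; simp [onto]
    by_cases k3 : k = .d'
    · subst k3; simp [onto]
    by_cases k4 : k = .u
    · subst k4; simp [onto]
    simp [onto, k1, k2, k3, k4]

theorem length_iterate_binSucc_le (j : ℕ) (l : List Bool) :
    (binSucc^[j] l).length ≤ l.length + j := by
  induction j generalizing l with
  | zero => simp
  | succ j ih =>
    have := ih (binSucc l)
    have := length_binSucc_le l
    rw [Function.iterate_succ_apply]
    omega

/-- The program accepts if the numbers agree. Its loop runs exactly that many times, because both
stacks are empty at its end. -/
theorem rel_count {m n : ℕ} (hc : s .cnt = List.replicate m true)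
    (hu : s .u = List.replicate n true) (ho : s .out = []) (hq : s .q = []) (hm : m ≤ N ^ 8) :
    count.Rel N s s' ↔ m = n ∧ s' = Function.update (Function.update (Function.update s .cnt [])
      .u []) .out (binSucc^[n] []) := by
  -- the store after `j` iterations
  let t : ℕ → Store Reg := fun j => Function.update (Function.update (Function.update s .cnt
    (List.replicate (m - j) true)) .u (List.replicate (n - j) true)) .out (binSucc^[j] [])
  let I : Store Reg → Prop := fun u => ∃ j ≤ m, j ≤ n ∧ u = t j
  have hstep : ∀ j ≤ m, j ≤ n → ∀ u, ((seq (shift .cnt true []) (seq (shift .u true [])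
      (increment .out .q))).Rel N (t j) u ↔ j < m ∧ j < n ∧ u = t (j + 1)) := by
    intro j hj hj' u
    simp only [rel_seq, rel_shift_nil]
    have e1 : ∀ l l' v, v = Function.update (Function.update (t j) .cnt l) .u l' →
        ((increment .out .q).Rel N v u ↔ u = Function.update v .out (binSucc^[j + 1] [])) := by
      intro l l' v hv
      have vo : v .out = binSucc^[j] [] := by simp [hv, t]
      rw [rel_increment (by decide), vo, Function.iterate_succ_apply']
      · rw [Short, vo]
        have := length_iterate_binSucc_le j []
        simp only [List.length_nil] at this
        omega
      · simp [hv, t, hq]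
    have e2 : ∀ l l' v, List.replicate (m - j) true = true :: l →
        List.replicate (n - j) true = true :: l' →
        v = Function.update (Function.update (t j) .cnt l) .u l' →
        j < m ∧ j < n ∧ Function.update v .out (binSucc^[j + 1] []) = t (j + 1) := by
      intro l l' v h1 h2 hv
      obtain ⟨a, ha⟩ : ∃ a, m - j = a + 1 := by
        rcases Nat.eq_zero_or_pos (m - j) with h | h
        · simp [h] at h1
        · exact ⟨m - j - 1, by omega⟩
      obtain ⟨b, hb⟩ : ∃ b, n - j = b + 1 := by
        rcases Nat.eq_zero_or_pos (n - j) with h | h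
        · simp [h] at h2
        · exact ⟨n - j - 1, by omega⟩
      rw [ha, List.replicate_succ, List.cons.injEq] at h1
      rw [hb, List.replicate_succ, List.cons.injEq] at h2
      refine ⟨by omega, by omega, funext fun k => ?_⟩
      have ha' : m - (j + 1) = a := by omega
      have hb' : n - (j + 1) = b := by omega
      by_cases k1 : k = .out
      · subst k1; simp [t]
      by_cases k2 : k = .u
      · subst k2; simp [t, hv, hb', h2.2]
      by_cases k3 : k = .cnt
      · subst k3; simp [t, hv, ha', h1.2]
      simp [t, hv, k1, k2, k3]
    have tc : t j .cnt = List.replicate (m - j) true := by simp [t]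
    have tu : t j .u = List.replicate (n - j) true := by simp [t]
    constructor
    · rintro ⟨v, ⟨l, h1, hv⟩, v', ⟨l', h2, hv'⟩, h3⟩
      rw [tc] at h1
      rw [hv, Function.update_of_ne (by decide), tu] at h2
      rw [hv] at hv'
      obtain ⟨h4, h5, h6⟩ := e2 l l' v' h1 h2 hv'
      exact ⟨h4, h5, ((e1 l l' v' hv').1 h3).trans h6⟩
    · rintro ⟨h4, h5, h6⟩
      have h1 : List.replicate (m - j) true = true :: List.replicate (m - j - 1) true := by
        rw [← List.replicate_succ]; congr 1; omega
      have h2 : List.replicate (n - j) true = true :: List.replicate (n - j - 1) true := by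
        rw [← List.replicate_succ]; congr 1; omega
      refine ⟨_, ⟨_, tc.trans h1, rfl⟩, _, ⟨List.replicate (n - j - 1) true, ?_, rfl⟩, ?_⟩
      · rw [Function.update_of_ne (by decide), tu, h2]
      · refine (e1 _ _ _ rfl).2 (h6.trans ?_)
        exact (e2 _ _ _ h1 h2 rfl).2.2.symm
  have ht0 : t 0 = s := by
    funext k
    by_cases k1 : k = .out
    · subst k1; simp [t, ho]
    by_cases k2 : k = .u
    · subst k2; simp [t, hu]
    by_cases k3 : k = .cnt
    · subst k3; simp [t, hc]
    simp [t, k1, k2, k3]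
  have hloop : ∀ u, (many (seq (shift .cnt true []) (seq (shift .u true [])
      (increment .out .q)))).Rel N s u ↔ ∃ j ≤ m, j ≤ n ∧ u = t j := by
    intro u
    rw [rel_many_iff I (fun u => (u .cnt).length) _ ⟨0, by simp, by simp, ht0.symm⟩
      (by simpa [hc] using hm)]
    · constructor
      · intro h
        induction h with
        | refl => exact ⟨0, by simp, by simp, ht0.symm⟩
        | tail _ h1 ih =>
          obtain ⟨j, hj, hj', rfl⟩ := ih
          obtain ⟨h2, h3, rfl⟩ := (hstep j hj hj' _).1 h1
          exact ⟨j + 1, h2, h3, rfl⟩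
      · rintro ⟨j, hj, hj', rfl⟩
        induction j with
        | zero => rw [ht0]
        | succ j ih =>
          exact (ih (by omega) (by omega)).tail
            ((hstep j (by omega) (by omega) _).2 ⟨by omega, by omega, rfl⟩)
    · rintro u v ⟨j, hj, hj', rfl⟩ h
      obtain ⟨h2, h3, rfl⟩ := (hstep j hj hj' _).1 h
      refine ⟨⟨j + 1, h2, h3, rfl⟩, ?_⟩
      simp [t]
      omega
  have htn : t n = Function.update (Function.update (Function.update s .cnt
      (List.replicate (m - n) true)) .u []) .out (binSucc^[n] []) := by simp [t]
  rw [count, rel_seq]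
  simp only [hloop, rel_seq_empty]
  constructor
  · rintro ⟨u, ⟨j, hj, hj', rfl⟩, h1, h2, rfl⟩
    have h3 : m - j = 0 := by simpa [t] using h1
    have h4 : n - j = 0 := by simpa [t] using h2
    obtain rfl : j = n := by omega
    obtain rfl : j = m := by omega
    refine ⟨rfl, ?_⟩
    rw [htn]; simp
  · rintro ⟨rfl, rfl⟩
    refine ⟨_, ⟨m, le_rfl, le_rfl, rfl⟩, by simp [t], by simp [t], ?_⟩
    rw [htn]; simp

theorem rel_guessEnv (hN : 2 ≤ N) (he : s .e = []) (he' : s .e' = []) :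
    guessEnv.Rel N s s' ↔ ∃ env, (encList encPair env).length ≤ N ^ 3 ∧
      s' = Function.update s .e (encList encPair env) := by
  have h8 : N ^ 3 ≤ N ^ 8 := Nat.pow_le_pow_right (by omega) (by norm_num)
  have h1 := (copies_readPair N _ Reg.e _ [.e'] (stable_short N Reg.e Set.univ) (fun _ h => h)
    (by simp)).readList_copy (stable_short N Reg.e Set.univ) (fun _ h => h) (by simp)
  have key : ∀ l : List Bool, l.length ≤ N ^ 3 → ∀ t, t = s.push [.e] l →
      ((seq (readList .e [.e'] (readPair .e [.e'])) (seq (empty .e) (moveAll .e' [.e]))).Rel N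
        t s' ↔ ∃ env, l = encList encPair env ∧
          s' = Function.update s .e (encList encPair env)) := by
    intro l hl t ht
    have te : t .e = l := by simp [ht, Store.push, he]
    rw [rel_seq]
    simp only [h1 t _ (show Short N .e t by rw [Short, te]; exact hl.trans h8), te, rel_seq_empty]
    have key' : ∀ env r, l = encList encPair env ++ r →
        ∀ u, u = t.out .e r (onto [.e'] (encList encPair env)) →
        (u .e = [] ∧ (moveAll .e' [.e]).Rel N u s' ↔
          r = [] ∧ s' = Function.update s .e (encList encPair env)) := by
      intro env r hr u hu
      have ue : u .e = r := by rw [hu, Store.out_self]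
      have ue' : u .e' = (encList encPair env).reverse := by
        rw [hu]; simp [Store.out, onto, ht, Store.push, he']
      rw [ue]
      refine and_congr_right fun h => ?_
      rw [rel_rewind (by decide)]
      · refine Eq.congr_right (funext fun k => ?_)
        by_cases k1 : k = .e
        · subst k1; simp [ue, ue', h]
        by_cases k2 : k = .e'
        · subst k2; simp [he']
        simp [k1, k2, hu, Store.out, onto, ht, Store.push]
      · rw [Short, ue', List.length_reverse]
        rw [hr, List.length_append] at hl
        exact (Nat.le_of_add_right_le hl).trans h8
    constructor
    · rintro ⟨u, ⟨env, r, -, hr, hu⟩, h2⟩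
      obtain ⟨rfl, h3⟩ := (key' env r hr u hu).1 h2
      exact ⟨env, by rw [hr, List.append_nil], h3⟩
    · rintro ⟨env, hr, h3⟩
      have hr' : l = encList encPair env ++ [] := by rw [hr, List.append_nil]
      exact ⟨_, ⟨env, [], by simp, hr', rfl⟩, (key' env [] hr' _ rfl).2 ⟨rfl, h3⟩⟩
  rw [guessEnv, rel_seq]
  simp only [rel_guess]
  constructor
  · rintro ⟨t, ⟨l, hl, ht⟩, h⟩
    obtain ⟨env, rfl, h2⟩ := (key l hl t ht).1 h
    exact ⟨env, hl, h2⟩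
  · rintro ⟨env, hl, h2⟩
    exact ⟨_, ⟨_, hl, rfl⟩, (key _ hl _ rfl).2 ⟨env, rfl, h2⟩⟩

theorem rel_seq_of {δ : Type} {c d : Prog Reg} {C : δ → Prop} {F : δ → Store Reg}
    (h : ∀ t, c.Rel N s t ↔ ∃ v, C v ∧ t = F v) :
    (seq c d).Rel N s s' ↔ ∃ v, C v ∧ d.Rel N (F v) s' := by
  rw [rel_seq]
  simp only [h]
  constructor
  · rintro ⟨_, ⟨v, hv, rfl⟩, h1⟩
    exact ⟨v, hv, h1⟩
  · rintro ⟨v, hv, h1⟩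
    exact ⟨_, ⟨v, hv, rfl⟩, h1⟩

/-- The store after the certificate has been read. -/
def loaded (w : List Bool) (A B : List (DBFact σ)) (y : List Bool) : Store Reg
  | .inp => w
  | .a => encList encFact A
  | .d => encList encFact B
  | .out => y
  | _ => []

/-- The program accepts exactly the certificates whose number is that of the facts listed, and
leaves these facts and the number in binary on their stacks. -/
theorem rel_readCert_count {p w Z : List Bool} (hZ : Z.length ≤ N ^ 8) {c : Prog Reg} :
    (seq (readCert σ) (seq (empty .z) (seq (moveAll .a' [.a]) (seq (moveAll .d' [.d])
      (seq count c))))).Rel N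
        (Function.update (Function.update (Ctrl.initStore .inp .pre p w) .z Z) .pre []) s' ↔
      ∃ A B : List (DBFact σ), Z = certificate (A.length + B.length) A B ∧
        c.Rel N (loaded w A B (binSucc^[A.length + B.length] [])) s' := by
  obtain ⟨s, hs⟩ : ∃ s : Store Reg, Function.update (Function.update
    (Ctrl.initStore Reg.inp Reg.pre p w) .z Z) .pre [] = s := ⟨_, rfl⟩
  rw [hs]
  have sz : s .z = Z := by simp [← hs]
  have si : s .inp = w := by simp [← hs, Ctrl.initStore]
  have sk : ∀ k, k ≠ .z → k ≠ .inp → s k = [] := by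
    intro k k1 k2
    by_cases k3 : k = .pre
    · subst k3; simp [← hs]
    · simp [← hs, k1, k2, k3, Ctrl.initStore]
  -- the part of the program after the certificate has been split
  have key : ∀ (k : ℕ) (A B : List (DBFact σ)) (r : List Bool), Z = certificate k A B ++ r →
      ∀ t, t = s.out .z r (fun j => onto [.cnt] (List.replicate k true) j ++
        (onto [.a'] (encList encFact A) j ++ (onto [.d'] (encList encFact B) j ++
          onto [.u] (List.replicate (A.length + B.length) true) j))) →
      ((seq (empty .z) (seq (moveAll .a' [.a]) (seq (moveAll .d' [.d]) (seq count c)))).Rel N t s' ↔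
        r = [] ∧ k = A.length + B.length ∧
          c.Rel N (loaded w A B (binSucc^[A.length + B.length] [])) s') := by
    intro k A B r hr t ht
    have tz : t .z = r := by rw [ht, Store.out_self]
    have ta : t .a' = (encList encFact A).reverse := by
      rw [ht]; simp [Store.out, onto, sk]
    have td : t .d' = (encList encFact B).reverse := by
      rw [ht]; simp [Store.out, onto, sk]
    have tc : t .cnt = List.replicate k true := by
      rw [ht]; simp [Store.out, onto, sk]
    have tu : t .u = List.replicate (A.length + B.length) true := by
      rw [ht]; simp [Store.out, onto, sk]
    have tk : ∀ j, j ≠ .z → j ≠ .a' → j ≠ .d' → j ≠ .cnt → j ≠ .u → t j = s j := by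
      intro j h1 h2 h3 h4 h5
      rw [ht]; simp [Store.out, onto, h1, h2, h3, h4, h5]
    have hlen : k + (encList encFact A).length + (encList encFact B).length ≤ N ^ 8 := by
      rw [hr] at hZ
      simp [certificate] at hZ
      omega
    rw [rel_seq_empty, tz]
    refine and_congr_right fun h0 => ?_
    rw [rel_seq_rewind (by decide) (by rw [Short, ta, List.length_reverse]; omega),
      rel_seq_rewind (by decide) (by
        rw [Short, Function.update_of_ne (by decide), Function.update_of_ne (by decide), td,
          List.length_reverse]
        omega)]
    have h1 := fun v => rel_count (N := N) (m := k) (n := A.length + B.length) (s := Function.update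
      (Function.update (Function.update (Function.update t .a ((t .a').reverse ++ t .a)) .a' [])
        .d ((Function.update (Function.update t .a ((t .a').reverse ++ t .a)) .a' [] .d').reverse ++
          Function.update (Function.update t .a ((t .a').reverse ++ t .a)) .a' [] .d)) .d' [])
      (s' := v) (by simp [tc]) (by simp [tu]) (by simp [tk, sk]) (by simp [tk, sk]) (by omega)
    rw [rel_seq]
    simp only [h1]
    have h2 : (Function.update (Function.update (Function.update (Function.update
      (Function.update (Function.update (Function.update t .a ((t .a').reverse ++ t .a)) .a' [])
        .d ((Function.update (Function.update t .a ((t .a').reverse ++ t .a)) .a' [] .d').reverse ++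
          Function.update (Function.update t .a ((t .a').reverse ++ t .a)) .a' [] .d)) .d' [])
        .cnt []) .u []) .out (binSucc^[A.length + B.length] []) : Store Reg) =
        loaded w A B (binSucc^[A.length + B.length] []) := by
      funext j
      cases j <;> simp [loaded, ta, td, tk, sk, si, tz, h0]
    simp only [h2]
    constructor
    · rintro ⟨_, ⟨h3, rfl⟩, h4⟩
      exact ⟨h3, h4⟩
    · rintro ⟨h3, h4⟩
      exact ⟨_, ⟨h3, rfl⟩, h4⟩
  rw [rel_seq]
  simp only [parses_readCert s _ (show Short N .z s by rw [Short, sz]; exact hZ), sz]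
  constructor
  · rintro ⟨t, ⟨⟨k, A, B⟩, r, -, hr, ht⟩, h⟩
    obtain ⟨rfl, rfl, h1⟩ := (key k A B r hr t ht).1 h
    exact ⟨A, B, by rw [hr, List.append_nil], h1⟩
  · rintro ⟨A, B, hr, h1⟩
    have hr' : Z = certificate (A.length + B.length) A B ++ [] := by rw [hr, List.append_nil]
    exact ⟨_, ⟨⟨_, A, B⟩, [], trivial, hr', rfl⟩, (key _ A B [] hr' _ rfl).2 ⟨rfl, rfl, h1⟩⟩

/-- An assignment of length at most `N ^ 3` is guessed, and then the input is read and the rule is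
evaluated. -/
theorem exists_rel_check {w y y' : List Bool} {A B : List (DBFact σ)} (hN : 2 ≤ N)
    (hw : w.length ≤ N) (hA : (encList encFact A).length ≤ N ^ 8)
    (hB : (encList encFact B).length ≤ N ^ 8) :
    (∃ s', (seq guessEnv (seq (readInput σ) (evaluate σ))).Rel N (loaded w A B y) s' ∧
      s' .out = y') ↔ Accepted (N ^ 3) w A B ∧ y' = y := by
  have h1 : ∀ env, (encList encPair env).length ≤ N ^ 3 → ∀ s' t,
      t = Function.update (loaded w A B y) .e (encList encPair env) →
      ((seq (readInput σ) (evaluate σ)).Rel N t s' ↔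
        ∃ v : List ℕ × List (List (Literal σ)) × List (Literal σ) × List (List (Literal σ)) ×
          List (DBFact σ) × List ℕ,
        ((∀ b ∈ v.2.1 ++ v.2.2.1 :: v.2.2.2.1, Literal.Safe v.1 b) ∧
        w = encList encNat v.1 ++ (encList (encList encLiteral) (v.2.1 ++ v.2.2.1 :: v.2.2.2.1) ++
          (encList encFact v.2.2.2.2.1 ++ encList encNat v.2.2.2.2.2))) ∧
        (evaluate σ).Rel N (Function.update (Function.update (Function.update (Function.update t
          .inp []) .c (encList encFact v.2.2.2.2.1)) .bd (encList encNat v.1 ++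
            encList encLiteral v.2.2.1)) .t' (encList encNat v.2.2.2.2.2).reverse) s') := by
    intro env _ s' t ht
    have ti : t .inp = w := by simp [ht, loaded]
    refine rel_seq_of fun u => ?_
    rw [rel_readInput (by rw [ti]; exact hw) (by simp [ht, loaded]), ti]
    constructor
    · rintro ⟨head, L, body, R, facts, tuple, h2, h3, h4⟩
      exact ⟨(head, L, body, R, facts, tuple), ⟨h2, h3⟩, h4⟩
    · rintro ⟨⟨head, L, body, R, facts, tuple⟩, ⟨h2, h3⟩, h4⟩
      exact ⟨head, L, body, R, facts, tuple, h2, h3, h4⟩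
  have h2 : ∀ env, (encList encPair env).length ≤ N ^ 3 → ∀ (head : List ℕ)
      (L : List (List (Literal σ))) (body : List (Literal σ)) (R : List (List (Literal σ)))
      (facts : List (DBFact σ)) (tuple : List ℕ),
      w = encList encNat head ++ (encList (encList encLiteral) (L ++ body :: R) ++
        (encList encFact facts ++ encList encNat tuple)) →
      ∀ s', (evaluate σ).Rel N (Function.update (Function.update (Function.update (Function.update
        (Function.update (loaded w A B y) .e (encList encPair env)) .inp []) .c
        (encList encFact facts)) .bd (encList encNat head ++ encList encLiteral body)) .t'
        (encList encNat tuple).reverse) s' ↔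
      ((∀ x ∈ head, Assigned env x) ∧ head.map (assign env) = tuple ∧
        ∀ α ∈ body, α.HoldsIn facts A B env) ∧ s' = Function.update (Function.update
        (Function.update (Function.update (Function.update (Function.update
        (Function.update (loaded w A B y) .e (encList encPair env)) .inp []) .c
        (encList encFact facts)) .bd (encList encNat head ++ encList encLiteral body)) .t'
        (encList encNat tuple).reverse) .bd []) .t' [] := by
    intro env henv head L body R facts tuple hw' s'
    have h5 := length_le_of_mem (e := encList encLiteral) (v := body) (l := L ++ body :: R)
      (by simp)
    have hlen := congrArg List.length hw'
    simp only [List.length_append] at hlen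
    refine rel_evaluate ?_ (by simp) ?_ (by simp) ?_
    · constructor
      case length_e =>
        simpa using henv.trans (Nat.pow_le_pow_right (by omega) (by norm_num))
      case short_c =>
        rw [Short]
        simpa using pow_one_le_pow_eight (by omega)
      case short_a => simpa [Short, loaded] using hA
      case short_d => simpa [Short, loaded] using hB
      all_goals simp [loaded]
    · simp; omega
    · simp; omega
  constructor
  · rintro ⟨s', h, rfl⟩
    obtain ⟨env, henv, h3⟩ := (rel_seq_of fun t => rel_guessEnv hN rfl rfl).1 h
    obtain ⟨⟨head, L, body, R, facts, tuple⟩, ⟨h4, h5⟩, h6⟩ := (h1 env henv s' _ rfl).1 h3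
    obtain ⟨⟨h7, h8, h9⟩, rfl⟩ := (h2 env henv head L body R facts tuple h5 s').1 h6
    exact ⟨⟨head, L, body, R, facts, tuple, env, h4, h5, henv, h7, h8, h9⟩, by simp [loaded]⟩
  · rintro ⟨⟨head, L, body, R, facts, tuple, env, h4, h5, henv, h7, h8, h9⟩, rfl⟩
    obtain ⟨s', hs'⟩ : ∃ s', _ = s' := ⟨_, rfl⟩
    have h6 := (h2 env henv head L body R facts tuple h5 s').2 ⟨⟨h7, h8, h9⟩, hs'.symm⟩
    refine ⟨s', (rel_seq_of fun t => rel_guessEnv hN rfl rfl).2 ⟨env, henv, ?_⟩, ?_⟩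
    · exact (h1 env henv _ _ rfl).2 ⟨⟨head, L, body, R, facts, tuple⟩, ⟨h4, h5⟩, h6⟩
    · simp [← hs', loaded]

/-- The program `solve` accepts exactly the certificates of repairs. -/
theorem exists_rel_solve {p w y : List Bool} :
    (∃ s', (solve σ).Rel (w.length + 2) (Ctrl.initStore .inp .pre p w) s' ∧ s' .out = y) ↔
      ∃ A B : List (DBFact σ), (certificate (A.length + B.length) A B).length ≤
          4 * (w.length + 2) ^ 2 ∧ p <+: certificate (A.length + B.length) A B ∧
        Accepted ((w.length + 2) ^ 3) w A B ∧ y = binSucc^[A.length + B.length] [] := by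
  obtain ⟨N, hN⟩ : ∃ N, w.length + 2 = N := ⟨_, rfl⟩
  rw [hN]
  have h8 : 4 * N ^ 2 ≤ N ^ 8 := by
    calc 4 * N ^ 2 ≤ N ^ 2 * N ^ 2 := Nat.mul_le_mul_right _ (by nlinarith)
      _ = N ^ 4 := by ring
      _ ≤ N ^ 8 := Nat.pow_le_pow_right (by omega) (by norm_num)
  have h1 : ∀ s', (solve σ).Rel N (Ctrl.initStore .inp .pre p w) s' ↔ _ := fun s' =>
    rel_seq_of fun t => rel_guessCert (by omega) rfl rfl
  have hp : (Ctrl.initStore .inp .pre p w : Store Reg) .pre = p := by simp [Ctrl.initStore]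
  have hAB : ∀ {k} {A B : List (DBFact σ)}, (certificate k A B).length ≤ 4 * N ^ 2 →
      (encList encFact A).length ≤ N ^ 8 ∧ (encList encFact B).length ≤ N ^ 8 := by
    intro k A B h
    simp only [certificate, List.length_append, List.length_cons] at h
    omega
  constructor
  · rintro ⟨s', h, hy⟩
    obtain ⟨Z, ⟨hZ, hpZ⟩, h2⟩ := (h1 s').1 h
    rw [hp] at hpZ
    obtain ⟨A, B, rfl, h3⟩ := (rel_readCert_count (hZ.trans h8)).1 h2
    obtain ⟨h4, h5⟩ := (exists_rel_check (by omega) (by omega) (hAB hZ).1 (hAB hZ).2).1 ⟨s', h3, hy⟩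
    exact ⟨A, B, hZ, hpZ, h4, h5⟩
  · rintro ⟨A, B, hZ, hpZ, h4, h5⟩
    obtain ⟨s', h3, hy⟩ := (exists_rel_check (by omega) (by omega) (hAB hZ).1 (hAB hZ).2).2
      ⟨h4, h5⟩
    exact ⟨s', (h1 s').2 ⟨_, ⟨hZ, by rw [hp]; exact hpZ⟩,
      (rel_readCert_count (hZ.trans h8)).2 ⟨A, B, rfl, h3⟩⟩, hy⟩

end Prog

/-! ### Small repairs -/

/-- Finitely many values can be renamed, without changing the given constants, so that they become
constants or small numbers. -/
theorem exists_perm_small (D V : Finset ℕ) : ∃ π : Equiv.Perm ℕ, (∀ d ∈ D, π d = d) ∧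
    ∀ v ∈ V, π v ∈ D ∨ π v < D.card + V.card := by
  induction V using Finset.induction_on with
  | empty => exact ⟨1, by simp, by simp⟩
  | insert v V hv ih =>
    obtain ⟨π, h1, h2⟩ := ih
    rw [Finset.card_insert_of_notMem hv]
    by_cases hD : π v ∈ D
    · refine ⟨π, h1, fun u hu => ?_⟩
      rcases Finset.mem_insert.1 hu with rfl | hu
      · exact .inl hD
      · exact (h2 u hu).imp id fun h => by omega
    -- a number that is neither a constant nor the new name of an element of `V`
    obtain ⟨m, hm, hm'⟩ : ∃ m ∈ Finset.range (D.card + V.card + 1), m ∉ D ∪ V.image π := by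
      refine Finset.exists_mem_notMem_of_card_lt_card ?_
      rw [Finset.card_range]
      have := Finset.card_union_le D (V.image π)
      have := Finset.card_image_le (s := V) (f := π)
      omega
    rw [Finset.mem_range] at hm
    simp only [Finset.mem_union, Finset.mem_image, not_or, not_exists, not_and] at hm'
    refine ⟨π.trans (Equiv.swap (π v) m), fun d hd => ?_, fun u hu => ?_⟩
    · rw [Equiv.trans_apply, h1 d hd, Equiv.swap_apply_of_ne_of_ne]
      · rintro rfl; exact hD hd
      · rintro rfl; exact hm'.1 hd
    · rcases Finset.mem_insert.1 hu with rfl | hu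
      · right
        rw [Equiv.trans_apply, Equiv.swap_apply_left]
        omega
      · rw [Equiv.trans_apply, Equiv.swap_apply_of_ne_of_ne]
        · exact (h2 u hu).imp id fun h => by omega
        · intro h
          rw [π.injective h] at hu
          exact hv hu
        · exact hm'.2 u hu

/-- The fact with renamed constants. -/
def DBFact.rename {σ : Schema} (π : Equiv.Perm ℕ) (F : DBFact σ) : DBFact σ :=
  ⟨F.1, fun i => π (F.2 i)⟩

theorem DBFact.rename_injective {σ : Schema} (π : Equiv.Perm ℕ) :
    Function.Injective (DBFact.rename (σ := σ) π) := by
  rintro ⟨R, a⟩ ⟨R', a'⟩ h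
  simp only [rename, Sigma.mk.injEq] at h
  obtain ⟨rfl, h⟩ := h
  rw [heq_eq_eq] at h
  congr 1
  funext i
  exact π.injective (congrFun h i)

namespace Literal

variable {σ : Schema}

/-- The terms that occur in the literal. -/
def terms : Literal σ → List Term
  | rel _ _ args => List.ofFn args
  | eq _ s t => [s, t]

/-- The fact that an atom of the given sign stands for under an assignment. -/
def fact? (b : Bool) (g : ℕ → ℕ) : Literal σ → Option (DBFact σ)
  | rel b' R args => if b' = b then some ⟨R, fun i => (args i).eval g⟩ else none
  | eq _ _ _ => none

/-- The facts that the atoms of sign `b` of a body stand for. -/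
def bodyFacts (b : Bool) (g : ℕ → ℕ) (body : List (Literal σ)) : List (DBFact σ) :=
  body.filterMap (fact? b g)

theorem mem_bodyFacts {b : Bool} {g : ℕ → ℕ} {body : List (Literal σ)} {F : DBFact σ} :
    F ∈ bodyFacts b g body ↔
      ∃ R args, .rel b R args ∈ body ∧ F = ⟨R, fun i => (args i).eval g⟩ := by
  simp only [bodyFacts, List.mem_filterMap]
  constructor
  · rintro ⟨⟨b', R, args⟩ | ⟨b', s, t⟩, h1, h2⟩
    · by_cases hb : b' = b
      · subst hb
        simp only [fact?, if_true, Option.some.injEq] at h2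
        exact ⟨R, args, h1, h2.symm⟩
      · simp [fact?, hb] at h2
    · simp [fact?] at h2
  · rintro ⟨R, args, h, rfl⟩
    exact ⟨_, h, by simp [fact?]⟩

theorem length_terms_le (α : Literal σ) : α.terms.length ≤ (encLiteral α).length := by
  have ht : ∀ t : Term, 1 ≤ (encTerm t).length := by
    intro t
    cases t <;> simp [encTerm]
  have : ∀ l : List Term, l.length ≤ (l.flatMap encTerm).length := by
    intro l
    induction l with
    | nil => simp
    | cons t l ih =>
      have := ht t
      simp only [List.flatMap_cons, List.length_append, List.length_cons]
      omega
  cases α with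
  | rel b R args =>
    have := this (List.ofFn args)
    simp only [terms, encLiteral, List.length_cons, List.length_append, encTuple]
    omega
  | eq b s t =>
    have := ht s
    have := ht t
    simp only [terms, encLiteral, List.length_cons, List.length_append, List.length_nil]
    omega

theorem length_encTerm_le {α : Literal σ} {t : Term} (h : t ∈ α.terms) :
    (encTerm t).length ≤ (encLiteral α).length := by
  cases α with
  | rel b R args =>
    obtain ⟨l, l', hl⟩ := List.append_of_mem h
    simp only [terms] at hl
    simp only [encLiteral, encTuple, hl, List.length_cons, List.length_append, List.flatMap_append,
      List.flatMap_cons]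
    omega
  | eq b s t' =>
    simp only [terms, List.mem_cons, List.not_mem_nil, or_false] at h
    rcases h with rfl | rfl <;> simp [encLiteral] <;> omega

theorem mem_vars_iff {α : Literal σ} {x : ℕ} : x ∈ α.vars ↔ .var x ∈ α.terms := by
  have : ∀ t : Term, x ∈ t.vars ↔ t = .var x := by
    intro t
    cases t <;> simp [Term.vars, eq_comm]
  cases α with
  | rel b R args => simp [vars, terms, this, List.mem_ofFn]
  | eq b s t => simp [vars, terms, this, eq_comm]

/-- If the values of terms have codes of length at most `c`, then the codes of facts are longer than
those of literals by a factor of at most `c`. -/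
theorem two_add_length_encFact_le {c : ℕ} (hc : 1 ≤ c) {g : ℕ → ℕ} {b : Bool}
    {R : Fin σ.numRel} {args : Fin (σ.arity R) → Term}
    (h : ∀ i, (encNat ((args i).eval g)).length ≤ c) :
    2 + (encFact (⟨R, fun i => (args i).eval g⟩ : DBFact σ)).length ≤
      (encLiteral (.rel b R args)).length * c := by
  have h1 : encTuple encNat (fun i => (args i).eval g) =
      (List.ofFn args).flatMap fun t => encNat (t.eval g) := by
    unfold encTuple
    exact (congrArg (List.flatMap encNat) (List.map_ofFn (f := args)
      (g := fun t : Term => t.eval g)).symm).trans (List.flatMap_map ..)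
  have h2 := Prog.length_flatMap_le (fun t : Term => encNat (t.eval g)) encTerm c (List.ofFn args)
    (by
      intro t ht
      obtain ⟨i, rfl⟩ := (List.mem_ofFn' ..).1 ht
      refine (h i).trans (Nat.le_mul_of_pos_left _ ?_)
      cases args i <;> simp [encTerm])
  simp only [encFact, encLiteral, List.length_cons, List.length_append, h1, Nat.add_mul]
  have h3 := Nat.le_mul_of_pos_right (encNat R).length hc
  simp only [encTuple] at h2 ⊢
  omega

theorem sum_bodyFacts_le {c : ℕ} (hc : 1 ≤ c) {g : ℕ → ℕ} (body : List (Literal σ))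
    (h : ∀ α ∈ body, ∀ t ∈ α.terms, (encNat (t.eval g)).length ≤ c) :
    ((bodyFacts true g body).map fun F => 2 + (encFact F).length).sum +
      ((bodyFacts false g body).map fun F => 2 + (encFact F).length).sum ≤
        (body.map fun α => (encLiteral α).length * c).sum := by
  induction body with
  | nil => simp [bodyFacts]
  | cons α body ih =>
    have ih := ih fun β hβ => h β (by simp [hβ])
    have hα := h α (by simp)
    simp only [bodyFacts] at ih
    rcases α with ⟨b, R, args⟩ | ⟨b, s, t⟩
    · have h1 := two_add_length_encFact_le hc (b := b) (R := R) (args := args) (g := g)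
        fun i => hα _ (by simp [terms, List.mem_ofFn])
      cases b <;> simp only [bodyFacts, fact?, List.filterMap_cons, if_true, Bool.false_eq_true,
        if_false, List.map_cons, List.sum_cons, reduceCtorEq] <;> omega
    · simp only [bodyFacts, fact?, List.filterMap_cons, List.map_cons, List.sum_cons]
      omega

end Literal

theorem length_encNat (n : ℕ) : (encNat n).length = 2 * n.size + 1 := by
  have : ∀ l : List Bool, (l.flatMap fun b => [true, b]).length = 2 * l.length := by
    intro l
    induction l with
    | nil => rfl
    | cons b l ih =>
      simp only [List.flatMap_cons, List.length_append, List.length_cons, List.length_nil, ih]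
      omega
  rw [encNat, List.length_append, this, Nat.size_eq_bits_len]
  simp

theorem length_encNat_le (n : ℕ) : (encNat n).length ≤ 2 * n + 1 := by
  rw [length_encNat]
  have : n.size ≤ n := Nat.size_le.2 Nat.lt_two_pow_self
  omega

theorem length_certificate {σ : Schema} (A B : List (DBFact σ)) :
    (certificate (A.length + B.length) A B).length =
      (A.map fun F => 2 + (encFact F).length).sum + (B.map fun F => 2 + (encFact F).length).sum +
        4 := by
  have : ∀ A : List (DBFact σ), A.length + (encList encFact A).length =
      (A.map fun F => 2 + (encFact F).length).sum + 1 := by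
    intro A
    induction A with
    | nil => simp [encList]
    | cons F A ih => simp [encList] at ih ⊢; omega
  have h1 := this A
  have h2 := this B
  simp only [certificate, List.length_append, List.length_replicate, List.length_cons]
  omega

/-! ### Certificates and repairs -/

namespace Literal

variable {σ : Schema}

/-- The literal holds under an assignment that gives the same values to its terms. -/
theorem Holds.congr {J : Finset (DBFact σ)} {g g' : ℕ → ℕ} {α : Literal σ} (h : α.Holds J g)
    (hg : ∀ t ∈ α.terms, t.eval g' = t.eval g) : α.Holds J g' := by
  rcases α with ⟨b, R, args⟩ | ⟨b, s, t⟩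
  · have : (fun i => (args i).eval g') = fun i => (args i).eval g :=
      funext fun i => hg _ (by simp [terms, List.mem_ofFn])
    cases b <;> simpa only [Holds, this] using h
  · have h1 := hg s (by simp [terms])
    have h2 := hg t (by simp [terms])
    cases b <;> simpa only [Holds, h1, h2] using h

/-- The facts to be inserted into `I` so that all positive atoms of a body become true. -/
def insertions (I : List (DBFact σ)) (g : ℕ → ℕ) (body : List (Literal σ)) : List (DBFact σ) :=
  ((bodyFacts true g body).filter (· ∉ I)).dedup

/-- The facts to be deleted from `I` so that all negated atoms of a body become true. -/
def deletions (I : List (DBFact σ)) (g : ℕ → ℕ) (body : List (Literal σ)) : List (DBFact σ) :=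
  ((bodyFacts false g body).filter (· ∈ I)).dedup

/-- If a rule is satisfied after an update of `I`, then it is satisfied under the renamed assignment
after the insertions and deletions that its atoms require, and these are no more than those of the
given update. The renaming has to fix the constants of `I` and of the rule. -/
theorem renamed_update {I : List (DBFact σ)} {X Y : Finset (DBFact σ)} {body : List (Literal σ)}
    {g : ℕ → ℕ} {π : Equiv.Perm ℕ} (hI : ∀ F ∈ I, F.rename π = F)
    (hT : ∀ α ∈ body, ∀ t ∈ α.terms, t.eval (π ∘ g) = π (t.eval g))
    (h : ∀ α ∈ body, α.Holds ((I.toFinset ∪ X) \ Y) g) :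
    (insertions I (π ∘ g) body).length ≤ X.card ∧ (deletions I (π ∘ g) body).length ≤ Y.card ∧
      ∀ α ∈ body, α.Holds ((I.toFinset ∪ (insertions I (π ∘ g) body).toFinset) \
        (deletions I (π ∘ g) body).toFinset) (π ∘ g) := by
  -- the facts required under the renamed assignment are the renamed facts
  have hF : ∀ b, ∀ F ∈ bodyFacts b (π ∘ g) body, ∃ R args, .rel b R args ∈ body ∧
      F = DBFact.rename π ⟨R, fun i => (args i).eval g⟩ := by
    intro b F hF
    obtain ⟨R, args, h1, rfl⟩ := mem_bodyFacts.1 hF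
    refine ⟨R, args, h1, ?_⟩
    simp only [DBFact.rename]
    congr 1
    exact funext fun i => hT _ h1 _ (by simp [terms, List.mem_ofFn])
  -- no fact is required to be both present and absent, as `π` is injective
  have hdisj : ∀ F ∈ bodyFacts true (π ∘ g) body, F ∉ bodyFacts false (π ∘ g) body := by
    intro F h1 h2
    obtain ⟨R, args, h3, rfl⟩ := hF _ _ h1
    obtain ⟨R', args', h4, h5⟩ := hF _ _ h2
    have h3 := h _ h3
    have h4 := h _ h4
    simp only [Holds, DBFact.rename_injective π h5] at h3 h4
    exact h4 h3
  have hA : ∀ F, F ∈ insertions I (π ∘ g) body ↔ F ∈ bodyFacts true (π ∘ g) body ∧ F ∉ I := by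
    intro F
    simp [insertions]
  have hB : ∀ F, F ∈ deletions I (π ∘ g) body ↔ F ∈ bodyFacts false (π ∘ g) body ∧ F ∈ I := by
    intro F
    simp [deletions]
  refine ⟨?_, ?_, ?_⟩
  · have hd : (insertions I (π ∘ g) body).Nodup := List.nodup_dedup _
    rw [← List.toFinset_card_of_nodup hd,
      ← Finset.card_image_of_injective X (DBFact.rename_injective π)]
    refine Finset.card_le_card fun F h1 => ?_
    obtain ⟨h1, h2⟩ := (hA F).1 (List.mem_toFinset.1 h1)
    obtain ⟨R, args, h3, rfl⟩ := hF _ _ h1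
    have h3 := h _ h3
    simp only [Holds, Finset.mem_sdiff, Finset.mem_union, List.mem_toFinset] at h3
    -- a fact of `I` is fixed by the renaming, so a required fact outside `I` comes from `X`
    refine Finset.mem_image_of_mem _ (h3.1.resolve_left fun h4 => h2 ?_)
    rwa [hI _ h4]
  · have hd : (deletions I (π ∘ g) body).Nodup := List.nodup_dedup _
    rw [← List.toFinset_card_of_nodup hd]
    refine Finset.card_le_card fun F h1 => ?_
    obtain ⟨h1, h2⟩ := (hB F).1 (List.mem_toFinset.1 h1)
    obtain ⟨R, args, h1, h3⟩ := hF _ _ h1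
    rw [← hI F h2] at h3
    rw [DBFact.rename_injective π h3] at h2 ⊢
    have h1 := h _ h1
    simp only [Holds, Finset.mem_sdiff, Finset.mem_union, List.mem_toFinset] at h1
    by_contra h4
    exact h1 ⟨.inl h2, h4⟩
  · intro α hα
    have h1 := h α hα
    rcases α with ⟨b, R, args⟩ | ⟨b, s, t⟩
    · have hm : (⟨R, fun i => (args i).eval (π ∘ g)⟩ : DBFact σ) ∈ bodyFacts b (π ∘ g) body :=
        mem_bodyFacts.2 ⟨R, args, hα, rfl⟩
      cases b
      · simp only [Holds, Finset.mem_sdiff, Finset.mem_union, List.mem_toFinset, hA, hB]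
        have := fun h2 => hdisj _ h2 hm
        tauto
      · simp only [Holds, Finset.mem_sdiff, Finset.mem_union, List.mem_toFinset, hA, hB]
        have := hdisj _ hm
        tauto
    · have h2 := hT _ hα s (by simp [terms])
      have h3 := hT _ hα t (by simp [terms])
      cases b <;> simpa only [Holds, h2, h3, ne_eq, π.injective.eq_iff] using h1

theorem length_certificate_le {c : ℕ} (hc : 1 ≤ c) {g : ℕ → ℕ} (I : List (DBFact σ))
    {body : List (Literal σ)}
    (h : ∀ α ∈ body, ∀ t ∈ α.terms, (encNat (t.eval g)).length ≤ c) :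
    (certificate ((insertions I g body).length + (deletions I g body).length)
      (insertions I g body) (deletions I g body)).length ≤
        (encList encLiteral body).length * c + 4 := by
  rw [length_certificate]
  have h1 : ((insertions I g body).map fun F => 2 + (encFact F).length).sum ≤ _ :=
    (((List.dedup_sublist _).trans List.filter_sublist).map _).sum_le_sum (fun _ _ => Nat.zero_le _)
  have h2 : ((deletions I g body).map fun F => 2 + (encFact F).length).sum ≤ _ :=
    (((List.dedup_sublist _).trans List.filter_sublist).map _).sum_le_sum (fun _ _ => Nat.zero_le _)
  have h3 := sum_bodyFacts_le hc body h
  have h4 : (body.map fun α => (encLiteral α).length * c).sum ≤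
      (encList encLiteral body).length * c := by
    rw [List.sum_map_mul_right]
    refine Nat.mul_le_mul_right _ ?_
    clear h h1 h2 h3
    induction body with
    | nil => simp
    | cons α body ih => simp [encList] at ih ⊢; omega
  omega

end Literal

theorem lookup_map_self {l : List ℕ} {f : ℕ → ℕ} {x : ℕ} (hx : x ∈ l) :
    (l.map fun v => (v, f v)).lookup x = some (f x) := by
  induction l with
  | nil => simp at hx
  | cons v l ih =>
    rw [List.map_cons, List.lookup_cons]
    by_cases h : x = v
    · simp [h]
    · rw [show (x == v) = false by simpa using h]
      exact ih (by simpa [h] using hx)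

theorem length_le_length_encList {α : Type} (e : α → List Bool) (l : List α) :
    l.length ≤ (encList e l).length := by
  induction l with
  | nil => simp
  | cons a l ih => simp [encList] at ih ⊢; omega

theorem length_encNat_le_length_encFact {σ : Schema} (F : DBFact σ) (i : Fin (σ.arity F.1)) :
    (encNat (F.2 i)).length ≤ (encFact F).length := by
  obtain ⟨l, l', hl⟩ := List.append_of_mem ((List.mem_ofFn' F.2 (F.2 i)).2 ⟨i, rfl⟩)
  simp only [encFact, encTuple, hl, List.length_append, List.flatMap_append, List.flatMap_cons]
  omega

theorem length_args_le {σ : Schema} (l : List (DBFact σ)) :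
    (l.flatMap fun F => List.ofFn F.2).length ≤ (encList encFact l).length := by
  have h1 : ∀ l : List ℕ, l.length ≤ (l.flatMap encNat).length := by
    intro l
    induction l with
    | nil => simp
    | cons n l ih =>
      simp only [List.flatMap_cons, List.length_append, List.length_cons, length_encNat]
      omega
  induction l with
  | nil => simp
  | cons F l ih =>
    have := h1 (List.ofFn F.2)
    simp only [encList, List.flatMap_cons, List.length_append, List.length_cons, encFact,
      encTuple] at ih this ⊢
    omega

theorem length_flatMap_varList_le (T : List Term) : (T.flatMap Term.varList).length ≤ T.length := by
  induction T with
  | nil => simp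
  | cons t T ih =>
    cases t <;> simp only [List.flatMap_cons, Term.varList, List.length_append, List.length_cons,
      List.length_nil] <;> omega

theorem length_flatMap_terms_le {σ : Schema} (body : List (Literal σ)) :
    (body.flatMap Literal.terms).length ≤ (encList encLiteral body).length := by
  induction body with
  | nil => simp
  | cons α body ih =>
    have := α.length_terms_le
    simp only [encList, List.flatMap_cons, List.length_append, List.length_cons] at ih this ⊢
    omega

namespace MAInput

variable {σ : Schema}

theorem length_encode (x : MAInput σ) : x.encode.length =
    (encList encNat x.query.head).length + (encList (encList encLiteral) x.query.bodies).length +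
      (encList encFact x.facts).length + (encList encNat x.tuple).length := by
  simp only [encode, List.length_append]

/-- After a renaming of constants, the facts that a repair needs have codes of linear length. -/
theorem exists_rename (x : MAInput σ) {body : List (Literal σ)} (hb : body ∈ x.query.bodies)
    (g : ℕ → ℕ) : ∃ π : Equiv.Perm ℕ, (∀ F ∈ x.facts, F.rename π = F) ∧
      (∀ a ∈ x.tuple, π a = a) ∧
      ∀ α ∈ body, ∀ t ∈ α.terms, t.eval (π ∘ g) = π (t.eval g) ∧
        (encNat (t.eval (π ∘ g))).length ≤ 4 * x.encode.length + 1 := by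
  have hn := x.length_encode
  have hb' := Prog.length_le_of_mem (e := encList encLiteral) hb
  obtain ⟨T, hT⟩ : ∃ T, body.flatMap Literal.terms = T := ⟨_, rfl⟩
  have hTl : T.length ≤ (encList encLiteral body).length := hT ▸ length_flatMap_terms_le body
  have hTc : ∀ t ∈ T, (encTerm t).length ≤ x.encode.length := by
    intro t ht
    rw [← hT, List.mem_flatMap] at ht
    obtain ⟨α, hα, ht⟩ := ht
    have := Literal.length_encTerm_le ht
    have := Prog.length_le_of_mem (e := encLiteral) hα
    omega
  -- the constants of the input, perhaps with 0 in addition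
  obtain ⟨D, hD⟩ : ∃ D, ((x.facts.flatMap fun F => List.ofFn F.2) ++ x.tuple ++
    T.map (Term.eval fun _ => 0)).toFinset = D := ⟨_, rfl⟩
  obtain ⟨V, hV⟩ : ∃ V, ((T.flatMap Term.varList).map g).toFinset = V := ⟨_, rfl⟩
  have hDV : D.card + V.card ≤ 2 * x.encode.length := by
    have h1 := List.toFinset_card_le ((x.facts.flatMap fun F => List.ofFn F.2) ++ x.tuple ++
      T.map (Term.eval fun _ => 0))
    have h2 := List.toFinset_card_le ((T.flatMap Term.varList).map g)
    have h3 := length_args_le x.facts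
    have h4 := length_le_length_encList encNat x.tuple
    have h5 := length_flatMap_varList_le T
    rw [hD] at h1
    rw [hV] at h2
    simp only [List.length_append, List.length_map] at h1 h2
    omega
  have hDc : ∀ d ∈ D, (encNat d).length ≤ 4 * x.encode.length + 1 := by
    intro d hd
    rw [← hD] at hd
    simp only [List.mem_toFinset, List.mem_append, List.mem_flatMap, List.mem_ofFn, List.mem_map]
      at hd
    rcases hd with (⟨F, hF, i, rfl⟩ | hd) | ⟨t, ht, rfl⟩
    · have := length_encNat_le_length_encFact F i
      have := Prog.length_le_of_mem (e := encFact) hF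
      omega
    · have := Prog.length_le_of_mem (e := encNat) hd
      omega
    · have := hTc t ht
      cases t with
      | var v => simp [Term.eval, encNat]
      | const a =>
        simp only [encTerm, List.length_cons] at this
        simp only [Term.eval]
        omega
  obtain ⟨π, h1, h2⟩ := exists_perm_small D V
  refine ⟨π, ?_, ?_, ?_⟩
  · rintro ⟨R, a⟩ hF
    simp only [DBFact.rename]
    congr 1
    funext i
    refine h1 _ ?_
    rw [← hD, List.mem_toFinset]
    exact List.mem_append_left _ (List.mem_append_left _ (List.mem_flatMap.2
      ⟨_, hF, (List.mem_ofFn' ..).2 ⟨i, rfl⟩⟩))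
  · intro a ha
    refine h1 _ ?_
    rw [← hD, List.mem_toFinset]
    exact List.mem_append_left _ (List.mem_append_right _ ha)
  · intro α hα t ht
    have htT : t ∈ T := hT ▸ List.mem_flatMap.2 ⟨α, hα, ht⟩
    cases t with
    | var v =>
      refine ⟨rfl, ?_⟩
      have hv : g v ∈ V := by
        rw [← hV, List.mem_toFinset]
        exact List.mem_map_of_mem (List.mem_flatMap.2 ⟨_, htT, by simp [Term.varList]⟩)
      rcases h2 _ hv with h3 | h3
      · exact hDc _ h3
      · have := length_encNat_le (π (g v))
        simp only [Term.eval, Function.comp_apply]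
        omega
    | const a =>
      have ha : a ∈ D := by
        rw [← hD, List.mem_toFinset]
        exact List.mem_append_right _ (List.mem_map.2 ⟨_, htT, rfl⟩)
      exact ⟨(h1 a ha).symm, hDc a ha⟩

/-- If there is a repair, then there is a short certificate of a repair that is no larger. -/
theorem IsRepair.exists_certificate {x : MAInput σ} {U : Update x.inst} (hU : x.IsRepair U) :
    ∃ A B : List (DBFact σ), A.length + B.length ≤ U.size ∧
      (certificate (A.length + B.length) A B).length ≤ 4 * (x.encode.length + 2) ^ 2 ∧
      Accepted ((x.encode.length + 2) ^ 3) x.encode A B := by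
  obtain ⟨body, hb, g, hg, hhead⟩ := hU
  obtain ⟨π, h1, h2, h3⟩ := x.exists_rename hb g
  obtain ⟨h4, h5, h6⟩ := Literal.renamed_update h1 (fun α hα t ht => (h3 α hα t ht).1) hg
  have hn := x.length_encode
  have hb' := Prog.length_le_of_mem (e := encList encLiteral) hb
  refine ⟨_, _, (Nat.add_le_add h4 h5).trans ?_, ?_, ?_⟩
  · rw [Update.size, Finset.card_union_of_disjoint]
    exact Finset.disjoint_left.2 fun F h7 h8 => U.ins_new F h7 (U.del_old h8)
  · refine (Literal.length_certificate_le (by omega) _ fun α hα t ht => (h3 α hα t ht).2).trans ?_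
    have : (encList encLiteral body).length ≤ x.encode.length := by omega
    nlinarith [Nat.mul_le_mul_right (4 * x.encode.length + 1) this]
  · obtain ⟨L, R, hLR⟩ := List.append_of_mem hb
    obtain ⟨l, hl⟩ : ∃ l, (body.flatMap Literal.terms).flatMap Term.varList = l := ⟨_, rfl⟩
    have hmem : ∀ v, (∃ α ∈ body, v ∈ α.vars) → v ∈ l := by
      rintro v ⟨α, hα, hv⟩
      rw [← hl, List.mem_flatMap]
      exact ⟨_, List.mem_flatMap.2 ⟨α, hα, Literal.mem_vars_iff.1 hv⟩, by simp [Term.varList]⟩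
    have hval : ∀ v ∈ l, assign (l.map fun v => (v, (π ∘ g) v)) v = π (g v) := by
      intro v hv
      rw [assign, lookup_map_self hv]
      rfl
    have has : ∀ v ∈ l, Assigned (l.map fun v => (v, (π ∘ g) v)) v :=
      fun v hv => ⟨_, lookup_map_self hv⟩
    have hheadl : ∀ v ∈ x.query.head, v ∈ l := by
      intro v hv
      obtain ⟨α, hα, -, h7⟩ := x.query.safe body hb v (.inl hv)
      exact hmem v ⟨α, hα, h7⟩
    refine ⟨x.query.head, L, body, R, x.facts, x.tuple, l.map fun v => (v, (π ∘ g) v), ?_, ?_, ?_,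
      fun v hv => has v (hheadl v hv), ?_, fun α hα => ⟨?_, (h6 α hα).congr ?_⟩⟩
    · intro b hb
      exact x.query.safe b (hLR ▸ hb)
    · rw [← hLR]
      simp only [encode, List.append_assoc]
    · have h7 : ∀ v ∈ l, (encNat v).length ≤ x.encode.length ∧
          (encNat (π (g v))).length ≤ 4 * x.encode.length + 1 := by
        intro v hv
        rw [← hl, List.mem_flatMap] at hv
        obtain ⟨t, ht, hv⟩ := hv
        rw [List.mem_flatMap] at ht
        obtain ⟨α, hα, ht⟩ := ht
        cases t with
        | const a => simp [Term.varList] at hv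
        | var u =>
          simp only [Term.varList, List.mem_singleton] at hv
          subst hv
          refine ⟨?_, (h3 α hα _ ht).2⟩
          have h8 := Literal.length_encTerm_le ht
          have := Prog.length_le_of_mem (e := encLiteral) hα
          simp only [encTerm, List.length_cons] at h8
          omega
      -- an entry has a code of length at most `n + (4 * n + 1)` for the length `n` of the input
      have h8 : ∀ l : List ℕ, (∀ v ∈ l, (encNat v).length ≤ x.encode.length ∧
          (encNat (π (g v))).length ≤ 4 * x.encode.length + 1) →
          (encList encPair (l.map fun v => (v, (π ∘ g) v))).length ≤
            l.length * (5 * x.encode.length + 2) + 1 := by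
        intro l
        induction l with
        | nil => simp [encList]
        | cons v l ih =>
          intro h
          have := ih fun u hu => h u (by simp [hu])
          have h9 := h v (by simp)
          simp only [encList, List.map_cons, List.flatMap_cons, List.length_append,
            List.length_cons, encPair, Function.comp_apply, Nat.add_mul] at this ⊢
          omega
      have h9 := h8 l h7
      have h10 : l.length ≤ x.encode.length := by
        have := length_flatMap_terms_le body
        have := length_flatMap_varList_le (body.flatMap Literal.terms)
        rw [hl] at this
        omega
      have h11 := Nat.mul_le_mul_right (5 * x.encode.length + 2) h10
      nlinarith [sq_nonneg x.encode.length, Nat.zero_le (x.encode.length ^ 3),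
        Nat.zero_le (x.encode.length ^ 2)]
    · rw [← hhead]
      refine List.map_congr_left fun v hv => ?_
      rw [hval v (hheadl v hv)]
      exact h2 _ (hhead ▸ List.mem_map_of_mem hv)
    · have h7 : ∀ t ∈ α.terms, t.Assigned (l.map fun v => (v, (π ∘ g) v)) := by
        intro t ht
        cases t with
        | const a => trivial
        | var v => exact has v (hmem v ⟨α, hα, Literal.mem_vars_iff.2 ht⟩)
      rcases α with ⟨b, R, args⟩ | ⟨b, s, t⟩
      · exact fun i => h7 _ (by simp [Literal.terms, List.mem_ofFn])
      · exact ⟨h7 s (by simp [Literal.terms]), h7 t (by simp [Literal.terms])⟩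
    · intro t ht
      cases t with
      | const a => rfl
      | var v => exact hval v (hmem v ⟨α, hα, Literal.mem_vars_iff.2 ht⟩)

end MAInput

variable {σ : Schema} in
/-- A certificate describes a repair of the encoded input. -/
theorem Accepted.exists_repair {m : ℕ} {w : List Bool} {A B : List (DBFact σ)}
    (h : Accepted m w A B) : ∃ x : MAInput σ, x.encode = w ∧ ∃ U : Update x.inst, x.IsRepair U ∧
      U.ins = (A.toFinset \ x.inst) \ B.toFinset ∧ U.del = B.toFinset ∩ x.inst := by
  obtain ⟨head, L, body, R, facts, tuple, env, h1, rfl, -, -, h2, h3⟩ := h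
  refine ⟨⟨⟨head, L ++ body :: R, h1⟩, facts, tuple, by simp [← h2]⟩, ?_,
    ⟨(A.toFinset \ facts.toFinset) \ B.toFinset, B.toFinset ∩ facts.toFinset, ?_, ?_⟩, ?_, rfl, rfl⟩
  · simp only [MAInput.encode, List.append_assoc]
  · intro F hF
    simp only [Finset.mem_sdiff] at hF
    exact hF.1.2
  · exact Finset.inter_subset_right
  · refine ⟨body, by simp, assign env, fun α hα => ?_, h2⟩
    convert (h3 α hα).2 using 1
    ext F
    simp only [Update.result, MAInput.inst, Finset.mem_sdiff, Finset.mem_union, Finset.mem_inter]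
    tauto

/-! ### The complexity of the missing answer problems -/

/-- An encoded update of the size that is given in unary is a minimum repair, if no repair is
smaller: then the lists of insertions and deletions have no repetitions and no void entries. -/
theorem Accepted.exists_minRepair {σ : Schema} {m : ℕ} {w : List Bool} {A B : List (DBFact σ)}
    (h : Accepted m w A B) (hmin : ∀ x : MAInput σ, x.encode = w → ∀ V : Update x.inst,
      x.IsRepair V → A.length + B.length ≤ V.size) :
    ∃ x : MAInput σ, x.encode = w ∧ ∃ U : Update x.inst, x.IsMinRepair U ∧
      U.size = A.length + B.length ∧
        U.EncodedBy (true :: (encList encFact A ++ encList encFact B)) := by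
  obtain ⟨x, hx, U, hU, h1, h2⟩ := h.exists_repair
  have h3 := hmin x hx U hU
  have h4 : U.ins ⊆ A.toFinset := by
    rw [h1]
    exact Finset.sdiff_subset.trans Finset.sdiff_subset
  have h5 : U.del ⊆ B.toFinset := by
    rw [h2]
    exact Finset.inter_subset_left
  have h6 : U.size ≤ U.ins.card + U.del.card := Finset.card_union_le _ _
  have h7 := Finset.card_le_card h4
  have h8 := Finset.card_le_card h5
  have h9 := List.toFinset_card_le A
  have h10 := List.toFinset_card_le B
  exact ⟨x, hx, U, ⟨hU, fun V hV => by have := hmin x hx V hV; omega⟩, by omega, A, B,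
    (Finset.eq_of_subset_of_card_le h4 (by omega)).symm,
    (Finset.eq_of_subset_of_card_le h5 (by omega)).symm, rfl⟩

theorem pairCode_injective {p p' w w' : List Bool} (h : Ctrl.pairCode p w = Ctrl.pairCode p' w') :
    p = p' ∧ w = w' := by
  have hb : PrefixFree (fun b : Bool => [b]) := by
    intro x y s t h
    simpa using h
  have h1 := prefixFree_encList hb p.reverse p'.reverse w w'
    (by simpa [encList, Ctrl.pairCode, Ctrl.pairs] using h)
  exact ⟨List.reverse_injective h1.1, h1.2⟩

/-- The certificates of repairs of the input encoded by `w`. -/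
def certificates (σ : Schema) (w : List Bool) : Set (List Bool) :=
  {Z | ∃ A B : List (DBFact σ), Z = certificate (A.length + B.length) A B ∧
    (certificate (A.length + B.length) A B).length ≤ 4 * (w.length + 2) ^ 2 ∧
    Accepted ((w.length + 2) ^ 3) w A B}

theorem inNP_certificates (σ : Schema) :
    ∃ L, InNP L ∧ ∀ p w, Ctrl.pairCode p w ∈ L ↔ PrefixSearch.Ext (certificates σ w) p := by
  obtain ⟨M, hM, h⟩ := Ctrl.exists_ntm_pair (inp := Reg.inp) (pre := .pre) (tmp := .tmp)
    (by decide) (by decide) (by decide) (Prog.solve σ)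
  have hE : ∀ p w, (∃ s', (Prog.solve σ).Rel (w.length + 2) (Ctrl.initStore .inp .pre p w) s') ↔
      PrefixSearch.Ext (certificates σ w) p := by
    intro p w
    constructor
    · rintro ⟨s', hs'⟩
      obtain ⟨A, B, h1, h2, h3, -⟩ := Prog.exists_rel_solve.1 ⟨s', hs', rfl⟩
      exact ⟨_, ⟨A, B, rfl, h1, h3⟩, h2⟩
    · rintro ⟨_, ⟨A, B, rfl, h1, h3⟩, h2⟩
      obtain ⟨s', hs', -⟩ := Prog.exists_rel_solve.2 ⟨A, B, h1, h2, h3, rfl⟩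
      exact ⟨s', hs'⟩
  refine ⟨{x | ∃ ch, M.AcceptsAlong x ch}, ⟨M, hM, fun _ => Iff.rfl⟩, fun p w => ?_⟩
  rw [Set.mem_ofPred_eq, h, ← hE]
  constructor
  · rintro ⟨p', w', s', h1, h2⟩
    obtain ⟨rfl, rfl⟩ := pairCode_injective h1
    exact ⟨s', h2⟩
  · rintro ⟨s', h2⟩
    exact ⟨p, w, s', rfl, h2⟩

theorem binVal_iterate_binSucc (k : ℕ) : binVal (binSucc^[k] []) = k := by
  induction k with
  | zero => rfl
  | succ k ih => rw [Function.iterate_succ_apply', binVal_binSucc, ih]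

/-- Only short certificates need to be considered for the minimum size of a repair. -/
theorem maSize_eq_sInf (σ : Schema) (w : List Bool) :
    maSize σ w = sInf {v : ℕ∞ | ∃ A B : List (DBFact σ),
      (certificate (A.length + B.length) A B).length ≤ 4 * (w.length + 2) ^ 2 ∧
        Accepted ((w.length + 2) ^ 3) w A B ∧ v = (A.length + B.length : ℕ)} := by
  refine le_antisymm (le_sInf ?_) (le_sInf ?_)
  · rintro _ ⟨A, B, -, h, rfl⟩
    obtain ⟨x, hx, U, hU, h1, h2⟩ := h.exists_repair
    have h8 : maSize σ w ≤ x.minSize := sInf_le ⟨x, hx, rfl⟩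
    have h9 : x.minSize ≤ U.size := sInf_le ⟨U, hU, rfl⟩
    refine h8.trans (h9.trans (Nat.cast_le.2 ?_))
    have h3 : U.size ≤ U.ins.card + U.del.card := Finset.card_union_le _ _
    have h4 : U.ins.card ≤ A.toFinset.card := by
      rw [h1]
      exact Finset.card_le_card (Finset.sdiff_subset.trans Finset.sdiff_subset)
    have h5 : U.del.card ≤ B.toFinset.card := by
      rw [h2]
      exact Finset.card_le_card Finset.inter_subset_left
    have h6 := List.toFinset_card_le A
    have h7 := List.toFinset_card_le B
    omega
  · rintro _ ⟨x, rfl, rfl⟩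
    refine le_sInf ?_
    rintro _ ⟨U, hU, rfl⟩
    obtain ⟨A, B, h1, h2, h3⟩ := hU.exists_certificate
    refine le_trans (sInf_le ?_) (Nat.cast_le.2 h1)
    exact ⟨A, B, h2, h3, rfl⟩

theorem inOptP_maSize (σ : Schema) : InOptP (maSize σ) := by
  obtain ⟨M, hM, h⟩ := Ctrl.exists_ntm (inp := Reg.inp) (pre := .pre) (tmp := .tmp)
    (by decide) (by decide) (by decide) .out (Prog.solve σ)
  refine ⟨M, hM, fun w => ?_⟩
  rw [maSize_eq_sInf, NTM.opt]
  congr 1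
  ext v
  simp only [Set.mem_ofPred_eq]
  constructor
  · rintro ⟨A, B, h1, h2, rfl⟩
    obtain ⟨ch, h3, h4⟩ := (h w _).2 (Prog.exists_rel_solve.2 ⟨A, B, h1, List.nil_prefix, h2, rfl⟩)
    exact ⟨ch, h3, by rw [h4, binVal_iterate_binSucc]⟩
  · rintro ⟨ch, h1, rfl⟩
    obtain ⟨A, B, h2, -, h3, h4⟩ := Prog.exists_rel_solve.1 ((h w _).1 ⟨ch, h1, rfl⟩)
    exact ⟨A, B, h2, h3, by rw [h4, binVal_iterate_binSucc]⟩

/-- A certificate is at least as long as the number it begins with. -/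
theorem maSize_le {σ : Schema} {w : List Bool} {v : ℕ} (h : maSize σ w = v) :
    v ≤ 4 * (w.length + 2) ^ 2 := by
  rw [maSize_eq_sInf] at h
  have hne : ({v : ℕ∞ | ∃ A B : List (DBFact σ),
      (certificate (A.length + B.length) A B).length ≤ 4 * (w.length + 2) ^ 2 ∧
        Accepted ((w.length + 2) ^ 3) w A B ∧ v = (A.length + B.length : ℕ)}).Nonempty := by
    by_contra hne
    rw [Set.not_nonempty_iff_eq_empty] at hne
    rw [hne, sInf_empty] at h
    exact ENat.top_ne_natCast _ h
  obtain ⟨A, B, h1, -, h2⟩ := h ▸ csInf_mem hne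
  rw [length_certificate] at h1
  rw [Nat.cast_inj] at h2
  have h3 : ∀ A : List (DBFact σ), A.length ≤ (A.map fun F => 2 + (encFact F).length).sum := by
    intro A
    induction A with
    | nil => simp
    | cons F A ih =>
      simp only [List.length_cons, List.map_cons, List.sum_cons]
      omega
  have := h3 A
  have := h3 B
  omega

theorem isBigO_size_sq : (fun n : ℕ => ((4 * (n + 2) ^ 2).size : ℝ)) =O[atTop]
    fun n => Real.log (n : ℝ) := by
  refine IsBigO.of_bound (5 / Real.log 2) ?_
  filter_upwards [eventually_ge_atTop 4] with n hn
  have h2 : 0 < Real.log 2 := Real.log_pos (by norm_num)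
  have hn' : (4 : ℝ) ≤ n := by exact_mod_cast hn
  have hlog : 0 < Real.log n := Real.log_pos (by linarith)
  rw [Real.norm_of_nonneg (by positivity), Real.norm_of_nonneg hlog.le]
  -- for `n ≥ 4`, the number is at most `n ^ 4`
  have h5 : 4 * (n + 2) ^ 2 ≤ n ^ 4 := by
    have : n + 2 ≤ 2 * n := by omega
    calc 4 * (n + 2) ^ 2 ≤ 4 * (2 * n) ^ 2 := by gcongr
      _ = 4 * 4 * n ^ 2 := by ring
      _ ≤ n * n * n ^ 2 := by gcongr
      _ = n ^ 4 := by ring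
  have h6 : (4 * (n + 2) ^ 2).size ≤ Nat.log 2 (n ^ 4) + 1 :=
    Nat.size_le.2 (h5.trans_lt (Nat.lt_pow_succ_log_self (by norm_num) _))
  have h7 : (Nat.log 2 (n ^ 4) : ℝ) * Real.log 2 ≤ 4 * Real.log n := by
    have := Nat.pow_log_le_self 2 (x := n ^ 4) (by positivity)
    have h8 : ((2 : ℝ) ^ Nat.log 2 (n ^ 4)) ≤ (n : ℝ) ^ 4 := by exact_mod_cast this
    have := Real.log_le_log (by positivity) h8
    rwa [Real.log_pow, Real.log_pow] at this
  have h8 : Real.log 2 ≤ Real.log n := Real.log_le_log (by norm_num) (by linarith)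
  have h9 : ((4 * (n + 2) ^ 2).size : ℝ) ≤ Nat.log 2 (n ^ 4) + 1 := by exact_mod_cast h6
  rw [div_mul_eq_mul_div, le_div_iff₀ h2]
  nlinarith

/-- Where a certificate with a larger number still has a `1`, one with the number `k'` has a `0`,
and before that place they agree. -/
theorem take_certificate {σ : Schema} {k k' : ℕ} (h : k' < k) (A B A' B' : List (DBFact σ)) :
    (certificate k A B).take k' ++ [false] <+: certificate k' A' B' := by
  have h1 : (certificate k A B).take k' = List.replicate k' true := by
    rw [certificate, List.take_append_of_le_length (by simp; omega), List.take_replicate,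
      min_eq_left h.le]
  rw [h1, certificate]
  exact ⟨true :: (encList encFact A' ++ encList encFact B'), by simp⟩

theorem output_certificate {σ : Schema} (k : ℕ) (A B : List (DBFact σ)) :
    PrefixSearch.output (certificate k A B) =
      true :: (encList encFact A ++ encList encFact B) := by
  induction k with
  | zero => rfl
  | succ k ih =>
    rw [certificate, List.replicate_succ, List.cons_append, PrefixSearch.output]
    exact ih

theorem inFPNPQueries_maMin (σ : Schema) : InFPNPQueries (fun n => n ^ 2) (MAMin σ) := by
  obtain ⟨L, hL, hLW⟩ := inNP_certificates σ
  refine PrefixSearch.inFPNPQueries (4 * (.X + 2) ^ 2) hL hLW ?_ ?_ ?_ ?_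
  · rintro w _ ⟨A, B, rfl, h, -⟩
    simpa using h
  · refine IsBigO.of_bound 74 ?_
    filter_upwards [eventually_ge_atTop 1] with n hn
    have hn' : (1 : ℝ) ≤ n := by exact_mod_cast hn
    simp only [Polynomial.eval_mul, Polynomial.eval_pow, Polynomial.eval_add, Polynomial.eval_X,
      Polynomial.eval_ofNat]
    push_cast
    rw [Real.norm_of_nonneg (by positivity), Real.norm_of_nonneg (by positivity)]
    nlinarith
  · intro w hw
    refine .inr ⟨?_, rfl⟩
    rintro ⟨x, rfl, U, hU⟩
    obtain ⟨A, B, -, h2, h3⟩ := hU.exists_certificate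
    have : certificate (A.length + B.length) A B ∈ certificates σ x.encode := ⟨A, B, rfl, h2, h3⟩
    rw [hw] at this
    exact this
  · rintro w _ ⟨A, B, rfl, -, h⟩ hG
    rw [output_certificate]
    obtain ⟨x, hx, U, h1, -, h2⟩ := h.exists_minRepair (by
      rintro x rfl V hV
      obtain ⟨A', B', h1, h2, h3⟩ := hV.exists_certificate
      by_contra hlt
      have hk : A'.length + B'.length < A.length + B.length := by omega
      -- the unary size would have a 0 at the place of one of its 1s
      refine hG (A'.length + B'.length) ?_ ⟨_, ⟨A', B', rfl, h2, h3⟩, take_certificate hk A B A' B'⟩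
      rw [certificate, List.getElem?_append_left (by simpa using hk)]
      simp [hk])
    exact .inl ⟨x, hx, U, h1, h2⟩

theorem mainTheorem4 (σ : Schema) :
    (∃ l : ℕ → ℕ, ((fun n => (l n : ℝ)) =O[atTop] fun n => Real.log (n : ℝ)) ∧
      InOptPBounded l (maSize σ)) ∧
    InFPNPQueries (fun n => n ^ 2) (MAMin σ) :=
  ⟨⟨_, isBigO_size_sq, inOptP_maSize σ, fun _ _ h => Nat.size_le_size (maSize_le h)⟩,
    inFPNPQueries_maMin σ⟩
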